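/- Let $K$ be a field. For coprime integers $0<p<q$ let $\sigma\subset\mathbb R^2$ be the cone generated by $(1,0)$ and $(p,q)$, let $M=\mathbb Z^2$, and let $S=S_{p,q}=\operatorname{Spec}K[\sigma^\vee\cap M]$ be the corresponding singular affine normal toric surface over $K$, with singular point $O$ (the point whose maximal ideal is generated by the monomials $x^u$, $u\neq 0$). Let $$\frac qp=[c_2,\dots,c_{e-1}]=c_2-\cfrac{1}{c_3-\cfrac{1}{\ddots-\cfrac1{c_{e-1}}}},\qquad c_i\ge 2,$$ be the Hirzebruch–Jung continued fraction, let $u_1=(0,1),u_2,\dots,u_e=(q,-p)$ be the points of $M$ on the compact edges of the boundary of the convex hull of $(\sigma^\vee\cap M)\setminus\{0\}$, in this order, and let $x_i=x^{u_i}$. For $m\ge 1$ let $S_m$ be the $m$-th jet scheme of $S$ and $S_m^0$ the preimage of $O$ under $S_m\to S$; for a point $\gamma\in S_m$ and a regular function $f$ on $S$ let $\operatorname{ord}_\gamma f$ be the $t$-order of $f\circ\gamma$. Let $\pi_{m+1,m}:S_{m+1}\to S_m$ be the truncation. Let $\Gamma=\Gamma(S)$ be the graph whose vertices are the irreducible components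 of $S_m^0$, for all $m\ge1$ (the integer $m$ is the level of the vertex), where a component $C'$ of $S_{m+1}^0$ and a component $C$ of $S_m^0$ are joined if and only if $\pi_{m+1,m}(C')\subseteq C$. A vertex $C$ carries as weights the dimension of $C$ and its index of speciality $s=\min_f\operatorname{ord}_\gamma f$, where $f$ runs over the maximal ideal of $O$ and $\gamma$ is the generic point of $C$. For $2\le i\le e-1$ let $\Gamma_i\subseteq\Gamma$ be the subgraph induced on the components of the form $$C_{i,m}^{s,l}=\overline{\{\gamma\in S_m:\operatorname{ord}_\gamma x_i=s,\ \operatorname{ord}_\gamma x_{i+1}=l\}},\qquad 1\le s\le\lceil m/2\rceil,\quad s\le l\le\min\{(c_i-1)s,\,m+1-s\}.$$ The graph $\Gamma$ is considered together with the unordered family of its subgraphs $\Gamma_i$, so that the identifications between lines of different $\Gamma_i$ are part of the data: an isomorphism from $\Gamma(S)$ to $\Gamma(S')$ is a level-preserving isomorphism of graphs together with a bijection $\tau$ of the index sets such that $\Gamma_i$ is mapped onto $\Gamma'_{\tau(i)}$ for every $i$. Let $S=S_{p,q}$ and $S'=S_{p',q'}$ be two such surfaces, with continued fractions $[c_2,\dots,c_{e-1}]$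 and $[c'_2,\dots,c'_{e'-1}]$. Then the following are equivalent: 1. there is an isomorphism from $\Gamma(S)$ to $\Gamma(S')$ that preserves the weights of the vertices; 2. there is an isomorphism from $\Gamma(S)$ to $\Gamma(S')$ (regardless of the weights); 3. the sequences $(c_2,\dots,c_{e-1})$ and $(c'_2,\dots,c'_{e'-1})$ are equal up to reversal; 4. $S$ and $S'$ have the same analytic type, i.e. the completed local rings $\widehat{\mathcal O}_{S,O}$ and $\widehat{\mathcal O}_{S',O'}$ are isomorphic as $K$-algebras. -/

import Mathlib

noncomputable section

namespace ToricJets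

section JetSchemes

variable (K : Type*) [Field K] (A : Type*) [CommRing A] [Algebra K A]

/-- The relations between the symbols `X (k, a)`, to be read as the `k`-th coefficient `a^(k)`
(`0 ≤ k ≤ m`) of the image of `a` under the universal `K`-algebra homomorphism
`A → R[t]/(t^(m+1))`: additivity, the product rule, and the values on constants. -/
inductive JetRel (m : ℕ) : MvPolynomial (Fin (m + 1) × A) K → Prop
  | add (k : Fin (m + 1)) (a b : A) : JetRel m
      (MvPolynomial.X (k, a + b) - (MvPolynomial.X (k, a) + MvPolynomial.X (k, b)))
  | mul (k : Fin (m + 1)) (a b : A) : JetRel m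
      (MvPolynomial.X (k, a * b) - ∑ i : Fin (m + 1), ∑ j : Fin (m + 1),
        if (i : ℕ) + (j : ℕ) = k then MvPolynomial.X (i, a) * MvPolynomial.X (j, b) else 0)
  | const (k : Fin (m + 1)) (r : K) : JetRel m
      (MvPolynomial.X (k, algebraMap K A r) - MvPolynomial.C (if (k : ℕ) = 0 then r else 0))

/-- The ideal generated by the jet relations. -/
def jetIdeal (m : ℕ) : Ideal (MvPolynomial (Fin (m + 1) × A) K) :=
  Ideal.span {f | JetRel K A m f}

/-- The coordinate ring of the `m`-th jet scheme of `Spec A` over `K`. It represents the functor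
`R ↦ Hom_K (A, R[t]/(t^(m+1)))` on `K`-algebras. -/
abbrev JetAlgebra (m : ℕ) : Type _ :=
  MvPolynomial (Fin (m + 1) × A) K ⧸ jetIdeal K A m

/-- The `m`-th jet scheme of `Spec A`, as a topological space. -/
abbrev JetScheme (m : ℕ) : Type _ := PrimeSpectrum (JetAlgebra K A m)

variable {A}

/-- The regular function `a^(k)` on the `m`-th jet scheme: the coefficient of `t^k` in the
composition of `a` with the universal `m`-jet. -/
def jetCoeff (m : ℕ) (k : Fin (m + 1)) (a : A) : JetAlgebra K A m :=
  Ideal.Quotient.mk (jetIdeal K A m) (MvPolynomial.X (k, a))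

variable {K}

theorem jetCoeff_add (m : ℕ) (k : Fin (m + 1)) (a b : A) :
    jetCoeff K m k (a + b) = jetCoeff K m k a + jetCoeff K m k b := by
  unfold jetCoeff
  rw [← map_add]
  exact Ideal.Quotient.eq.2 (Ideal.subset_span (JetRel.add k a b))

theorem jetCoeff_mul (m : ℕ) (k : Fin (m + 1)) (a b : A) :
    jetCoeff K m k (a * b) = ∑ i : Fin (m + 1), ∑ j : Fin (m + 1),
      if (i : ℕ) + (j : ℕ) = k then jetCoeff K m i a * jetCoeff K m j b else 0 := by
  unfold jetCoeff
  have h : Ideal.Quotient.mk (jetIdeal K A m) (MvPolynomial.X (k, a * b)) =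
      Ideal.Quotient.mk (jetIdeal K A m) (∑ i : Fin (m + 1), ∑ j : Fin (m + 1),
        if (i : ℕ) + (j : ℕ) = k then MvPolynomial.X (i, a) * MvPolynomial.X (j, b) else 0) :=
    Ideal.Quotient.eq.2 (Ideal.subset_span (JetRel.mul k a b))
  rw [h]
  simp only [map_sum, apply_ite (Ideal.Quotient.mk (jetIdeal K A m)), map_mul, map_zero]

theorem jetCoeff_const (m : ℕ) (k : Fin (m + 1)) (r : K) :
    jetCoeff K m k (algebraMap K A r) =
      algebraMap K (JetAlgebra K A m) (if (k : ℕ) = 0 then r else 0) := by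
  unfold jetCoeff
  exact Ideal.Quotient.eq.2 (Ideal.subset_span (JetRel.const k r))

variable (K A)

/-- The ring homomorphism `a ↦ a^(0)` that induces the projection of the `m`-th jet scheme to
`Spec A`. -/
def jetBase (m : ℕ) : A →+* JetAlgebra K A m where
  toFun a := jetCoeff K m 0 a
  map_one' := by
    have h := jetCoeff_const (K := K) (A := A) m 0 1
    simpa using h
  map_zero' := by
    have h := jetCoeff_const (K := K) (A := A) m 0 0
    simpa using h
  map_add' a b := jetCoeff_add m 0 a b
  map_mul' a b := by
    rw [jetCoeff_mul, Finset.sum_eq_single 0, Finset.sum_eq_single 0]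
    · simp
    · intro j _ hj
      have : (j : ℕ) ≠ 0 := fun h => hj (Fin.ext h)
      simp [this]
    · simp
    · intro i _ hi
      have : (i : ℕ) ≠ 0 := fun h => hi (Fin.ext h)
      simp [this]
    · simp

theorem sum_castLE {R : Type*} [AddCommMonoid R] {n m : ℕ} (h : n + 1 ≤ m + 1)
    (F : Fin (m + 1) → R) (hF : ∀ i : Fin (m + 1), n < (i : ℕ) → F i = 0) :
    ∑ i : Fin (n + 1), F (Fin.castLE h i) = ∑ i : Fin (m + 1), F i := by
  refine Finset.sum_of_injOn (Fin.castLE h) (Fin.castLE_injective h).injOn (by simp) ?_ (by simp)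
  intro i _ hi
  refine hF i ?_
  by_contra hlt
  exact hi ⟨⟨i, by omega⟩, by simp, Fin.ext rfl⟩

/-- The homomorphism `a^(k) ↦ a^(k)` between the coordinate rings of the `n`-th and the `m`-th jet
scheme, for `n ≤ m`. -/
def jetInclusion {n m : ℕ} (h : n ≤ m) : JetAlgebra K A n →ₐ[K] JetAlgebra K A m :=
  Ideal.Quotient.liftₐ (jetIdeal K A n)
    (MvPolynomial.aeval fun v : Fin (n + 1) × A =>
      jetCoeff K m (Fin.castLE (Nat.succ_le_succ h) v.1) v.2) (by
    have hle : jetIdeal K A n ≤ RingHom.ker (MvPolynomial.aeval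
        fun v : Fin (n + 1) × A =>
          jetCoeff K m (Fin.castLE (Nat.succ_le_succ h) v.1) v.2).toRingHom := by
      refine Ideal.span_le.2 ?_
      intro f hf
      rw [SetLike.mem_coe, RingHom.mem_ker]
      rcases hf with ⟨k, a, b⟩ | ⟨k, a, b⟩ | ⟨k, r⟩
      · simp [jetCoeff_add]
      · simp only [AlgHom.toRingHom_eq_coe, map_sub, RingHom.coe_coe, MvPolynomial.aeval_X,
          map_sum, apply_ite (MvPolynomial.aeval fun v : Fin (n + 1) × A =>
            jetCoeff K m (Fin.castLE (Nat.succ_le_succ h) v.1) v.2), map_mul, map_zero]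
        rw [sub_eq_zero, jetCoeff_mul, ← sum_castLE (Nat.succ_le_succ h)]
        · refine Finset.sum_congr rfl fun i _ => ?_
          rw [← sum_castLE (Nat.succ_le_succ h)]
          · simp
          · intro j hj
            have hk := k.isLt
            exact if_neg (by simp; omega)
        · intro i hi
          refine Finset.sum_eq_zero fun j _ => ?_
          have hk := k.isLt
          exact if_neg (by simp; omega)
      · simp [jetCoeff_const]
    exact fun a ha => hle ha)

/-- The truncation `π_{m,n}` from `m`-jets to `n`-jets, for `n ≤ m`. -/
def truncation {n m : ℕ} (h : n ≤ m) : JetScheme K A m → JetScheme K A n :=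
  PrimeSpectrum.comap (jetInclusion K A h).toRingHom

variable {A}

/-- The contact locus of the `m`-jets `γ` with `ord_γ f = d`, where `d ≤ m` (a point `γ` of the
jet scheme is a prime ideal, and `f ∘ γ` has the coefficients `f^(k)` modulo this prime). -/
def contact (m d : ℕ) (f : A) : Set (JetScheme K A m) :=
  {P | (∀ k : Fin (m + 1), (k : ℕ) < d → jetCoeff K m k f ∈ P.asIdeal) ∧
    ∃ k : Fin (m + 1), (k : ℕ) = d ∧ jetCoeff K m k f ∉ P.asIdeal}

end JetSchemes

section ToricSurfaces

/-- The semigroup `σ^∨ ∩ M`, where `M = ℤ²` and `σ` is the cone generated by `(1, 0)` and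
`(p, q)`. -/
def dualSemigroup (p q : ℕ) : AddSubmonoid (ℤ × ℤ) where
  carrier := {u | 0 ≤ u.1 ∧ 0 ≤ p * u.1 + q * u.2}
  zero_mem' := by simp
  add_mem' := by
    rintro u v ⟨h1, h2⟩ ⟨h3, h4⟩
    refine ⟨add_nonneg h1 h3, ?_⟩
    have h := add_nonneg h2 h4
    simp only [Prod.fst_add, Prod.snd_add]
    linarith

/-- The points of `M` on the compact edges of the boundary of the convex hull of
`(σ^∨ ∩ M) \ {0}`: the points at which some linear form in the interior of `σ` attains its minimum
over `(σ^∨ ∩ M) \ {0}`. -/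
def compactBoundary (p q : ℕ) : Set (ℤ × ℤ) :=
  {u | u ∈ dualSemigroup p q ∧ u ≠ 0 ∧ ∃ n : ℝ × ℝ, 0 < n.2 ∧ 0 < q * n.1 - p * n.2 ∧
    ∀ w ∈ dualSemigroup p q, w ≠ 0 → n.1 * u.1 + n.2 * u.2 ≤ n.1 * w.1 + n.2 * w.2}

/-- The points `u_1 = (0, 1), u_2, …, u_e = (q, -p)` of `compactBoundary p q` in their order on the
boundary polygon, that is by increasing first coordinate: `boundaryPoint p q k = u_(k+1)`. -/
def boundaryPoint (p q k : ℕ) : ℤ × ℤ :=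
  Classical.epsilon fun u => u ∈ compactBoundary p q ∧
    {w | w ∈ compactBoundary p q ∧ w.1 < u.1}.ncard = k

/-- The value `c₁ - 1/(c₂ - 1/(⋯ - 1/c_r))` of a Hirzebruch-Jung continued fraction. -/
def hjValue : List ℕ → ℚ
  | [] => 0
  | [c] => c
  | c :: d :: t => c - 1 / hjValue (d :: t)

/-- `c = [c_2, …, c_(e-1)]` is the Hirzebruch-Jung continued fraction expansion of `q / p`. -/
def IsHJExpansion (p q : ℕ) (c : List ℕ) : Prop :=
  (∀ x ∈ c, 2 ≤ x) ∧ hjValue c = (q : ℚ) / p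

variable (K : Type*) [Field K]

/-- The coordinate ring `K[σ^∨ ∩ M]` of the affine toric surface `S`. -/
abbrev CoordRing (p q : ℕ) : Type _ := AddMonoidAlgebra K (dualSemigroup p q)

/-- The maximal ideal of the singular point `O` of `S`, generated by the monomials other
than `1`. -/
def originIdeal (p q : ℕ) : Ideal (CoordRing K p q) :=
  Ideal.span {f | ∃ u : dualSemigroup p q, u ≠ 0 ∧ f = AddMonoidAlgebra.single u 1}

open Classical in
/-- The regular function `x^(u_(k+1))` on `S` (for `k < e`). -/
def coordFun (p q k : ℕ) : CoordRing K p q :=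
  if h : boundaryPoint p q k ∈ dualSemigroup p q then
    AddMonoidAlgebra.single ⟨boundaryPoint p q k, h⟩ 1 else 0

/-- The closed subset `S_m^0` of the `m`-jets of `S` that are centred at `O`. -/
def centralFiber (p q m : ℕ) : Set (JetScheme K (CoordRing K p q) m) :=
  {P | (PrimeSpectrum.comap (jetBase K (CoordRing K p q) m) P).asIdeal = originIdeal K p q}

/-- The vertices of the graph: the irreducible components of `S_m^0`, for all `m ≥ 1`. -/
structure Vertex (p q : ℕ) where
  level : ℕ
  one_le_level : 1 ≤ level
  carrier : Set (JetScheme K (CoordRing K p q) level)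
  isComponent : Maximal (fun s => IsIrreducible s ∧ s ⊆ centralFiber K p q level) carrier

variable {K}

/-- `v` is a component at level `m + 1`, `w` is one at level `m`, and `π_{m+1,m}` maps `v`
into `w`. -/
def Vertex.MapsTo {p q : ℕ} (v w : Vertex K p q) : Prop :=
  ∃ h : v.level = w.level + 1,
    truncation K (CoordRing K p q) (h ▸ Nat.le_succ w.level) '' v.carrier ⊆ w.carrier

theorem Vertex.MapsTo.level_eq {p q : ℕ} {v w : Vertex K p q} (h : v.MapsTo w) :
    v.level = w.level + 1 := h.1

/-- The dimension of a component. -/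
def Vertex.dim {p q : ℕ} (v : Vertex K p q) : WithBot ℕ∞ := topologicalKrullDim v.carrier

/-- The index of speciality of a component `C`: the minimum of `ord_γ f` over all `f` in the maximal
ideal of `O`, where `γ` is the generic point of `C` (a coefficient `f^(k)` is nonzero at `γ` if and
only if it does not vanish at all points of `C`). -/
def Vertex.speciality {p q : ℕ} (v : Vertex K p q) : ℕ :=
  sInf {d | ∃ k : Fin (v.level + 1), (k : ℕ) = d ∧ ∃ f ∈ originIdeal K p q, ∃ P ∈ v.carrier,
    jetCoeff K v.level k f ∉ P.asIdeal}

variable (K)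

/-- The graph `Γ` of a toric surface. -/
def jetGraph (p q : ℕ) : SimpleGraph (Vertex K p q) where
  Adj v w := v.MapsTo w ∨ w.MapsTo v
  symm := ⟨fun _ _ h => h.symm⟩
  loopless := ⟨fun v h => by
    rcases h with h | h <;> exact absurd h.level_eq (by omega)⟩

/-- The set `C_{i,m}^{s,l}`, the closure of the locus where `ord_γ x_i = s` and
`ord_γ x_(i+1) = l`; here `i = j + 2`. -/
def contactClosure (p q m j s l : ℕ) : Set (JetScheme K (CoordRing K p q) m) :=
  closure (contact K m s (coordFun K p q (j + 1)) ∩ contact K m l (coordFun K p q (j + 2)))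

/-- The vertices of the subgraph `Γ_i` of `Γ`, `i = j + 2`: the components of the form
`C_{i,m}^{s,l}` with `1 ≤ s ≤ ⌈m / 2⌉` and `s ≤ l ≤ min ((c_i - 1) s) (m + 1 - s)`. -/
def subgraphVertices (p q : ℕ) (c : List ℕ) (j : Fin c.length) : Set (Vertex K p q) :=
  {v | ∃ s l : ℕ, 1 ≤ s ∧ 2 * s ≤ v.level + 1 ∧ s ≤ l ∧
    l ≤ min ((c.get j - 1) * s) (v.level + 1 - s) ∧
    v.carrier = contactClosure K p q v.level j s l}

/-- An isomorphism between the graphs of two toric surfaces: an isomorphism of graphs which respects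
the levels `m` and maps the family of subgraphs `Γ_i` of the first onto the family of subgraphs
`Γ'_i` of the second, in some order. It thus respects the identifications between lines of
different `Γ_i`. -/
structure JetGraphIso (p q : ℕ) (c : List ℕ) (p' q' : ℕ) (c' : List ℕ) where
  graphIso : jetGraph K p q ≃g jetGraph K p' q'
  level_eq : ∀ v, (graphIso v).level = v.level
  indexEquiv : Fin c.length ≃ Fin c'.length
  map_subgraph : ∀ j,
    graphIso '' subgraphVertices K p q c j = subgraphVertices K p' q' c' (indexEquiv j)

variable {K}

/-- The isomorphism respects the weights of the vertices: the dimension and the index of speciality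
of the component. -/
def JetGraphIso.PreservesWeights {p q : ℕ} {c : List ℕ} {p' q' : ℕ} {c' : List ℕ}
    (φ : JetGraphIso K p q c p' q' c') : Prop :=
  ∀ v, (φ.graphIso v).dim = v.dim ∧ (φ.graphIso v).speciality = v.speciality

variable (K)

/-- The completed local ring of `S` at `O`. -/
abbrev CompletedLocalRing (p q : ℕ) : Type _ :=
  AdicCompletion (originIdeal K p q) (CoordRing K p q)

/-- Two toric surfaces have the same analytic type: their completed local rings at the singular
points are isomorphic as `K`-algebras. -/
def SameAnalyticType (p q p' q' : ℕ) : Prop :=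
  Nonempty (CompletedLocalRing K p q ≃ₐ[K] CompletedLocalRing K p' q')

end ToricSurfaces

end ToricJets

end

/-! Let r be the number of coefficients and index the generators from 0 as x_0, …, x_(r+1). The
coefficient c_k = `hjCoeff c k` belongs to x_(k+1), through x_k x_(k+2) = x_(k+1)^(c_k).

Condition 3 implies the others by symmetry. The list c determines (p, q), because the last boundary
vector is (q, -p). The linear map that reverses the boundary vectors is an isomorphism of
semigroups, hence induces isomorphisms of coordinate rings, jet schemes, graphs and completions.

For the converses one needs the generic points of the contact loci. A jet in the locus with
parameters (s, l) is determined by its free coefficients, of which there are 2(m+1) + (r-2)s, and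
these are algebraically independent at the generic point (`exists_generic_jet`, `jet_unique`,
`exists_generic_point`). Every centred jet of minimal order s with 2s ≤ m+1 has at most this
transcendence degree (`trdeg_le_of_min_order`), so the loci are dense in components if r ≥ 2 or s =
1 (`contactPoint_minimal`). The coefficients of t^2 in the relations show that, at a generic point
with s = 1, the generators with nonzero linear part are either one interior generator or a chain:
all generators on one compact edge of the polygon, the coefficients strictly inside being 2.

2 → 3: counting the vertices of Γ_i at a suitable level recovers c_i (`JetGraphIso.hjCoeff_eq`); for
r = 1 this needs `contactPoint_not_minimal`. The vertices of level 2 in the subgraphs correspond to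
the chains, and Γ_i contains exactly those of the chains through its own generator. Hence an
isomorphism acts on the path of chains, and a path has only two automorphisms (`path_rigidity`).

4 → 3: an isomorphism of completions respects the maximal ideals, hence induces isomorphisms of the
truncations A / I^(m+1), through which all centred m-jets factor. The points with nonzero linear
part and greatest transcendence degree are exactly the generic points with s = 1. For two of them,
the codimension of the sum of the kernels of their linear parts is the number of generators common
to their supports. For large m the supports are the chains, once each, and the junction of two
chains as a singleton, c_k - 3 times. These intersection numbers determine c up to reversal
(`IsChainFamily.eq_or_eq_reverse`). -/

namespace ToricJets

/-! ### Boundary vectors of the dual semigroup and the continued fraction. -/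

section Lattice

/-- The coefficients of a continued fraction, continued by `2`. -/
def hjCoeff (c : List ℕ) (k : ℕ) : ℕ := c.getD k 2

/-- The vectors `u_1 = (0, 1), u_2 = (1, 0), …` with `u_(k-1) + u_(k+1) = c_k u_k`, indexed from
`0`. -/
def hjVec (c : List ℕ) : ℕ → ℤ × ℤ
  | 0 => (0, 1)
  | 1 => (1, 0)
  | k + 2 => (hjCoeff c k : ℤ) • hjVec c (k + 1) - hjVec c k

/-- The linear form `w ↦ det (w, u_k)`. -/
def hjDet (c : List ℕ) (k : ℕ) : ℤ × ℤ →+ ℤ where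
  toFun w := w.1 * (hjVec c k).2 - (hjVec c k).1 * w.2
  map_zero' := by simp
  map_add' v w := by simp only [Prod.fst_add, Prod.snd_add]; ring

/-- The linear form with value `1` at `u_k` and at `u_(k+1)`. -/
def hjDeg (c : List ℕ) (k : ℕ) : ℤ × ℤ →+ ℤ := hjDet c k - hjDet c (k + 1)

variable {c : List ℕ}

theorem hjDet_apply (k : ℕ) (w : ℤ × ℤ) :
    hjDet c k w = w.1 * (hjVec c k).2 - (hjVec c k).1 * w.2 := rfl

theorem hjDeg_apply (k : ℕ) (w : ℤ × ℤ) : hjDeg c k w = hjDet c k w - hjDet c (k + 1) w := rfl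

theorem hjVec_add_two (k : ℕ) :
    hjVec c (k + 2) = (hjCoeff c k : ℤ) • hjVec c (k + 1) - hjVec c k := rfl

theorem hjVec_add_hjVec (k : ℕ) :
    hjVec c k + hjVec c (k + 2) = hjCoeff c k • hjVec c (k + 1) := by
  rw [hjVec_add_two]; simp

theorem two_le_hjCoeff (hc : ∀ x ∈ c, 2 ≤ x) (k : ℕ) : 2 ≤ hjCoeff c k := by
  unfold hjCoeff
  rcases lt_or_ge k c.length with h | h
  · rw [List.getD_eq_getElem _ _ h]; exact hc _ (List.getElem_mem h)
  · rw [List.getD_eq_default _ _ h]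

theorem hjDet_add_two (k : ℕ) (w : ℤ × ℤ) :
    hjDet c (k + 2) w = hjCoeff c k * hjDet c (k + 1) w - hjDet c k w := by
  simp only [hjDet_apply, hjVec_add_two, Prod.fst_sub, Prod.snd_sub, Prod.smul_fst, Prod.smul_snd,
    smul_eq_mul]
  ring

theorem hjDet_self (k : ℕ) : hjDet c k (hjVec c k) = 0 := by
  rw [hjDet_apply]; ring

theorem hjDet_antisymm (k j : ℕ) : hjDet c k (hjVec c j) = -hjDet c j (hjVec c k) := by
  simp only [hjDet_apply]; ring

theorem hjDet_hjVec_add_two (k j : ℕ) : hjDet c k (hjVec c (j + 2)) =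
    hjCoeff c j * hjDet c k (hjVec c (j + 1)) - hjDet c k (hjVec c j) := by
  rw [hjDet_antisymm, hjDet_add_two, hjDet_antisymm k (j + 1), hjDet_antisymm k j]; ring

theorem hjDet_succ (k : ℕ) : hjDet c k (hjVec c (k + 1)) = 1 := by
  induction k with
  | zero => simp [hjDet_apply, hjVec]
  | succ k ih => rw [hjDet_hjVec_add_two, hjDet_self, hjDet_antisymm, ih]; ring

theorem hjDet_succ' (k : ℕ) : hjDet c (k + 1) (hjVec c k) = -1 := by
  rw [hjDet_antisymm, hjDet_succ]

/-- The sequence of determinants is convex: since every coefficient is at least 2, the differences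
of consecutive terms never decrease, and the sequence starts with 0, 1. -/
theorem hjDet_step (hc : ∀ x ∈ c, 2 ≤ x) {k j : ℕ} (h : k ≤ j) :
    0 ≤ hjDet c k (hjVec c j) ∧ hjDet c k (hjVec c j) < hjDet c k (hjVec c (j + 1)) := by
  induction j, h using Nat.le_induction with
  | base => rw [hjDet_self, hjDet_succ]; simp
  | succ j _ ih =>
    obtain ⟨h1, h2⟩ := ih
    refine ⟨by omega, ?_⟩
    rw [hjDet_hjVec_add_two]
    have h3 : (2 : ℤ) ≤ hjCoeff c j := by exact_mod_cast two_le_hjCoeff hc j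
    nlinarith

theorem hjDet_nonneg (hc : ∀ x ∈ c, 2 ≤ x) {k j : ℕ} (h : k ≤ j) : 0 ≤ hjDet c k (hjVec c j) :=
  (hjDet_step hc h).1

theorem hjDet_nonpos (hc : ∀ x ∈ c, 2 ≤ x) {k j : ℕ} (h : j ≤ k) : hjDet c k (hjVec c j) ≤ 0 := by
  rw [hjDet_antisymm]; have := hjDet_nonneg hc h; omega

theorem hjDet_pos (hc : ∀ x ∈ c, 2 ≤ x) {k j : ℕ} (h : k < j) : 0 < hjDet c k (hjVec c j) := by
  obtain ⟨j, rfl⟩ := Nat.exists_eq_add_of_lt h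
  have := hjDet_step hc (show k ≤ k + j by omega)
  omega

theorem hjVec_fst (k : ℕ) : (hjVec c k).1 = hjDet c 0 (hjVec c k) := by
  simp [hjDet_apply, hjVec]

theorem hjVec_fst_strictMono (hc : ∀ x ∈ c, 2 ≤ x) : StrictMono fun k => (hjVec c k).1 := by
  refine strictMono_nat_of_lt_succ fun k => ?_
  simp only [hjVec_fst]
  exact (hjDet_step hc (Nat.zero_le k)).2

theorem hjVec_injective (hc : ∀ x ∈ c, 2 ≤ x) : Function.Injective (hjVec c) := fun a b h =>
  (hjVec_fst_strictMono hc).injective (by simp only [h])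

/-- Cramer's rule: consecutive vectors have determinant 1, so they form a basis of the lattice. -/
theorem hjVec_decomp (k : ℕ) (w : ℤ × ℤ) :
    w = (-hjDet c (k + 1) w) • hjVec c k + hjDet c k w • hjVec c (k + 1) := by
  have h := hjDet_succ (c := c) k
  rw [hjDet_apply] at h
  ext
  · simp only [hjDet_apply, Prod.fst_add, Prod.smul_fst, smul_eq_mul]
    linear_combination (-w.1) * h
  · simp only [hjDet_apply, Prod.snd_add, Prod.smul_snd, smul_eq_mul]
    linear_combination (-w.2) * h

theorem hjDeg_self (k : ℕ) : hjDeg c k (hjVec c k) = 1 := by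
  rw [hjDeg_apply, hjDet_self, hjDet_succ']; ring

theorem hjDeg_succ (k : ℕ) : hjDeg c k (hjVec c (k + 1)) = 1 := by
  rw [hjDeg_apply, hjDet_self, hjDet_succ]; ring

theorem hjDeg_eq (k : ℕ) (w : ℤ × ℤ) :
    hjDeg c k w = hjDeg c (k + 1) w + ((hjCoeff c k : ℤ) - 2) * hjDet c (k + 1) w := by
  rw [hjDeg_apply, hjDeg_apply, hjDet_add_two]; ring

/-- The value is 1 for k = j, and by `hjDeg_eq` moving k away from j adds a coefficient minus 2
times a determinant of the right sign. This is the convexity of the boundary polygon. -/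
theorem one_le_hjDeg_hjVec (hc : ∀ x ∈ c, 2 ≤ x) (k j : ℕ) : 1 ≤ hjDeg c k (hjVec c j) := by
  have h2 (n : ℕ) : (2 : ℤ) ≤ hjCoeff c n := by exact_mod_cast two_le_hjCoeff hc n
  rcases le_total j k with h | h
  · induction k, h using Nat.le_induction with
    | base => rw [hjDeg_self]
    | succ k hk ih =>
      have := hjDeg_eq (c := c) k (hjVec c j)
      have := hjDet_nonpos hc (show j ≤ k + 1 by omega)
      have := h2 k
      nlinarith
  · induction h using Nat.decreasingInduction with
    | self => rw [hjDeg_self]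
    | of_succ k hk ih =>
      have := hjDeg_eq (c := c) k (hjVec c j)
      have := hjDet_nonneg hc (show k + 1 ≤ j by omega)
      have := h2 k
      nlinarith

/-- The three-term relations telescope. In jets this becomes the binomial equation that expresses
the product of two distant generators by generators strictly between them. -/
theorem hjVec_add_hjVec_add (hc : ∀ x ∈ c, 2 ≤ x) (i n : ℕ) :
    hjVec c i + hjVec c (i + n + 1) = hjVec c (i + 1) + hjVec c (i + n) +
      ∑ k ∈ Finset.range n, (hjCoeff c (i + k) - 2) • hjVec c (i + k + 1) := by
  induction n with
  | zero => simp [add_comm]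
  | succ n ih =>
    rw [Finset.sum_range_succ, show i + (n + 1) + 1 = i + n + 2 by ring, ← add_assoc i n 1]
    have h1 := hjVec_add_hjVec (c := c) (i + n)
    have h2 : hjCoeff c (i + n) • hjVec c (i + n + 1) =
        (hjCoeff c (i + n) - 2) • hjVec c (i + n + 1) + 2 • hjVec c (i + n + 1) := by
      rw [← add_smul, Nat.sub_add_cancel (two_le_hjCoeff hc _)]
    rw [h2, two_smul] at h1
    calc _ = (hjVec c i + hjVec c (i + n + 1)) + (hjVec c (i + n) + hjVec c (i + n + 2)) -
          hjVec c (i + n) - hjVec c (i + n + 1) := by abel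
      _ = _ := by rw [ih, h1]; abel

/-- The numerator and the denominator of a Hirzebruch-Jung continued fraction. -/
def hjFrac : List ℕ → ℤ × ℤ
  | [] => (1, 0)
  | a :: t => (a * (hjFrac t).1 - (hjFrac t).2, (hjFrac t).1)

theorem hjFrac_pos {c : List ℕ} (hc : ∀ x ∈ c, 2 ≤ x) :
    0 ≤ (hjFrac c).2 ∧ (hjFrac c).2 < (hjFrac c).1 := by
  induction c with
  | nil => simp [hjFrac]
  | cons a t ih =>
    obtain ⟨h1, h2⟩ := ih fun x hx => hc x (by simp [hx])
    have h3 : (2 : ℤ) ≤ a := by exact_mod_cast hc a (by simp)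
    simp only [hjFrac]
    constructor
    · omega
    · nlinarith

theorem hjFrac_coprime (c : List ℕ) : IsCoprime (hjFrac c).1 (hjFrac c).2 := by
  induction c with
  | nil => exact ⟨1, 0, by simp [hjFrac]⟩
  | cons a t ih =>
    obtain ⟨x, y, h⟩ := ih
    exact ⟨-y, x + a * y, by simp only [hjFrac]; linear_combination h⟩

theorem hjValue_eq {c : List ℕ} (hc : ∀ x ∈ c, 2 ≤ x) (hne : c ≠ []) :
    hjValue c = ((hjFrac c).1 : ℚ) / (hjFrac c).2 := by
  induction c with
  | nil => exact absurd rfl hne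
  | cons a t ih =>
    match t, ih, hc with
    | [], _, _ => simp [hjValue, hjFrac]
    | d :: t, ih, hc =>
      have h := hjFrac_pos (c := d :: t) fun x hx => hc x (List.mem_cons_of_mem _ hx)
      have h0 : ((hjFrac (d :: t)).1 : ℚ) ≠ 0 := by
        have : (hjFrac (d :: t)).1 ≠ 0 := by omega
        exact_mod_cast this
      have e : hjFrac (a :: d :: t) =
          (a * (hjFrac (d :: t)).1 - (hjFrac (d :: t)).2, (hjFrac (d :: t)).1) := rfl
      rw [hjValue, ih (fun x hx => hc x (List.mem_cons_of_mem _ hx)) (by simp), e]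
      push_cast
      field_simp

theorem IsHJExpansion.ne_nil {p q : ℕ} (hp : 0 < p) (hq : 0 < q) (hc : IsHJExpansion p q c) :
    c ≠ [] := by
  rintro rfl
  have hp' : (p : ℚ) ≠ 0 := by exact_mod_cast hp.ne'
  have := (div_eq_zero_iff.1 hc.2.symm).resolve_right hp'
  exact hq.ne' (by exact_mod_cast this)

/-- Both fractions are reduced, so their equality as rational numbers is an equality of pairs. -/
theorem hjFrac_eq {p q : ℕ} (hp : 0 < p) (hq : 0 < q) (hcop : Nat.Coprime p q)
    (hc : IsHJExpansion p q c) : hjFrac c = ((q : ℤ), (p : ℤ)) := by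
  have hne := hc.ne_nil hp hq
  obtain ⟨h2, hv⟩ := hc
  rw [hjValue_eq h2 hne] at hv
  have hpos := hjFrac_pos h2
  have h0 : 0 < (hjFrac c).2 := by
    rcases c with _ | ⟨a, t⟩
    · exact absurd rfl hne
    · have := hjFrac_pos (c := t) fun x hx => h2 x (List.mem_cons_of_mem _ hx)
      simp only [hjFrac]
      omega
  have hA : ((hjFrac c).1 : ℚ) / (hjFrac c).2 = (q : ℤ) / (p : ℤ) := by simpa using hv
  have hcp' : Nat.Coprime (hjFrac c).1.natAbs (hjFrac c).2.natAbs :=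
    Int.isCoprime_iff_gcd_eq_one.1 (hjFrac_coprime c)
  have hcq : Nat.Coprime (q : ℤ).natAbs (p : ℤ).natAbs := by simpa using hcop.symm
  have hP : (0 : ℤ) < p := by exact_mod_cast hp
  have e1 := Rat.num_div_eq_of_coprime h0 hcp'
  have e2 := Rat.num_div_eq_of_coprime hP hcq
  have e3 := Rat.den_div_eq_of_coprime h0 hcp'
  have e4 := Rat.den_div_eq_of_coprime hP hcq
  rw [hA] at e1 e3
  exact Prod.ext (e1.symm.trans e2) (e3.symm.trans e4)

/-- Unfolding the recursion downwards from the last vector produces the continued fractions of the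
tails. For k = 0 the last vector is (numerator, -denominator), which ties c to the second edge of
the dual cone. -/
theorem hjVec_length_eq {k : ℕ} (hk : k ≤ c.length) : hjVec c (c.length + 1) =
    (hjFrac (c.drop k)).1 • hjVec c (k + 1) - (hjFrac (c.drop k)).2 • hjVec c k := by
  induction hk using Nat.decreasingInduction with
  | self => simp [hjFrac]
  | of_succ k hk ih =>
    rw [ih, List.drop_eq_getElem_cons hk, hjVec_add_two, hjFrac]
    have : hjCoeff c k = c.get ⟨k, hk⟩ := List.getD_eq_getElem _ _ hk
    rw [this, List.get_eq_getElem]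
    module

/-- The lattice data of a toric surface: the continued fraction `c` of `q / p` in terms of the
vectors `hjVec c k`. -/
structure HJData (p q : ℕ) (c : List ℕ) : Prop where
  two_le : ∀ x ∈ c, 2 ≤ x
  pos : 0 < c.length
  hjVec_last : hjVec c (c.length + 1) = ((q : ℤ), -(p : ℤ))

theorem IsHJExpansion.hjData {p q : ℕ} (hp : 0 < p) (hq : 0 < q) (hcop : Nat.Coprime p q)
    (hc : IsHJExpansion p q c) : HJData p q c where
  two_le := hc.1
  pos := List.length_pos_iff.2 (hc.ne_nil hp hq)
  hjVec_last := by
    rw [hjVec_length_eq (Nat.zero_le _), List.drop_zero, hjFrac_eq hp hq hcop hc]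
    simp [hjVec]

namespace HJData

variable {p q : ℕ} (H : HJData p q c)
include H

theorem mem_dualSemigroup {w : ℤ × ℤ} :
    w ∈ dualSemigroup p q ↔ 0 ≤ hjDet c 0 w ∧ hjDet c (c.length + 1) w ≤ 0 := by
  have e : w ∈ dualSemigroup p q ↔ 0 ≤ w.1 ∧ 0 ≤ p * w.1 + q * w.2 := Iff.rfl
  rw [e, hjDet_apply, hjDet_apply, H.hjVec_last]
  simp only [hjVec, mul_one, zero_mul, sub_zero]
  refine and_congr Iff.rfl ?_
  constructor <;> intro h <;> linarith

theorem hjVec_mem {k : ℕ} (hk : k ≤ c.length + 1) : hjVec c k ∈ dualSemigroup p q :=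
  H.mem_dualSemigroup.2 ⟨hjDet_nonneg H.two_le (Nat.zero_le k), hjDet_nonpos H.two_le hk⟩

/-- Consecutive vectors cut the cone into unimodular sectors. The sector of w is given by the first
k for which w does not lie beyond u_(k+1). -/
theorem exists_decomp {w : ℤ × ℤ} (hw : w ∈ dualSemigroup p q) :
    ∃ k ≤ c.length, ∃ a b : ℕ, w = a • hjVec c k + b • hjVec c (k + 1) := by
  obtain ⟨h0, h1⟩ := H.mem_dualSemigroup.1 hw
  have hex : ∃ k, hjDet c (k + 1) w ≤ 0 := ⟨_, h1⟩
  classical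
  have h2 := Nat.find_spec hex
  have h3 : Nat.find hex ≤ c.length := Nat.find_min' hex h1
  have h4 : 0 ≤ hjDet c (Nat.find hex) w := by
    rcases hk : Nat.find hex with _ | k
    · exact h0
    · have := Nat.find_min hex (m := k) (by omega)
      omega
  refine ⟨_, h3, (-hjDet c (Nat.find hex + 1) w).toNat, (hjDet c (Nat.find hex) w).toNat, ?_⟩
  conv_lhs => rw [hjVec_decomp (c := c) (Nat.find hex) w]
  rw [← natCast_zsmul, ← natCast_zsmul, Int.toNat_of_nonneg (by omega), Int.toNat_of_nonneg h4]

theorem one_le_hjDeg {w : ℤ × ℤ} (hw : w ∈ dualSemigroup p q) (h0 : w ≠ 0) (k : ℕ) :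
    1 ≤ hjDeg c k w := by
  obtain ⟨j, hj, a, b, rfl⟩ := H.exists_decomp hw
  have h1 := one_le_hjDeg_hjVec H.two_le k j
  have h2 := one_le_hjDeg_hjVec H.two_le k (j + 1)
  have h3 : 0 < a + b := by
    rcases Nat.eq_zero_or_pos (a + b) with h | h
    · exfalso; apply h0
      have : a = 0 ∧ b = 0 := by omega
      simp [this.1, this.2]
    · exact h
  rw [map_add, map_nsmul, map_nsmul, nsmul_eq_mul, nsmul_eq_mul]
  have h4 : (1 : ℤ) ≤ (a : ℤ) + b := by exact_mod_cast h3
  nlinarith [Int.natCast_nonneg a, Int.natCast_nonneg b]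

omit H in
theorem hjVec_ne_zero (k : ℕ) : hjVec c k ≠ 0 := by
  intro h
  have := hjDeg_self (c := c) k
  simp [h] at this

/-- The form `hjDeg c k` has value 1 at u_k but at least 2 at a sum of two nonzero elements. -/
theorem hjVec_ne_add {k : ℕ} {v w : ℤ × ℤ} (hv : v ∈ dualSemigroup p q)
    (hw : w ∈ dualSemigroup p q) (hv0 : v ≠ 0) (hw0 : w ≠ 0) : hjVec c k ≠ v + w := by
  intro h
  have h1 := hjDeg_self (c := c) k
  rw [h, map_add] at h1
  have := H.one_le_hjDeg hv hv0 k
  have := H.one_le_hjDeg hw hw0 k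
  omega

/-- A form in the interior of σ is positive on nonzero elements, so nothing can be split off from a
minimum and `exists_decomp` leaves only the vectors u_k. Conversely `hjDeg c k` is an interior form
with minimum at u_k; for k = r + 1 it involves the vector u_(r+2) outside the cone, supplied by the
continuation of c by 2. -/
theorem compactBoundary_eq : compactBoundary p q = {w | ∃ k ≤ c.length + 1, w = hjVec c k} := by
  have hlast (x y : ℝ) : q * x - p * y = x * (hjVec c (c.length + 1)).1 +
      y * (hjVec c (c.length + 1)).2 := by
    rw [H.hjVec_last]; push_cast; ring
  ext w
  constructor
  · rintro ⟨hw, hw0, n, hn1, hn2, hmin⟩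
    have hpos {w : ℤ × ℤ} (hw : w ∈ dualSemigroup p q) (hw0 : w ≠ 0) :
        0 < n.1 * (w.1 : ℝ) + n.2 * (w.2 : ℝ) := by
      have e1 : 0 ≤ w.1 := hw.1
      have e2 : 0 ≤ p * w.1 + q * w.2 := hw.2
      have hq : (0 : ℝ) < q := by
        have : 0 < (hjVec c (c.length + 1)).1 := by
          rw [hjVec_fst]; exact hjDet_pos H.two_le (by omega)
        rw [H.hjVec_last] at this
        simp only at this
        exact_mod_cast this
      have e1' : (0 : ℝ) ≤ w.1 := by exact_mod_cast e1
      have e2' : (0 : ℝ) ≤ p * w.1 + q * w.2 := by exact_mod_cast e2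
      -- A multiple of the form is a combination, with positive coefficients, of the two forms that
      -- define the cone.
      have key : q * (n.1 * (w.1 : ℝ) + n.2 * w.2) =
        (q * n.1 - p * n.2) * w.1 + n.2 * (p * w.1 + q * w.2) := by ring
      refine pos_of_mul_pos_right (a := (q : ℝ)) ?_ hq.le
      rw [key]
      rcases e1'.eq_or_lt with h | h
      · rcases e2'.eq_or_lt with h' | h'
        · exfalso; apply hw0
          have h1 : w.1 = 0 := by exact_mod_cast h.symm
          have h2 : (q : ℝ) * w.2 = 0 := by rw [← h] at h'; linarith
          have h3 : w.2 = 0 := by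
            exact_mod_cast (mul_eq_zero.1 h2).resolve_left hq.ne'
          exact Prod.ext h1 h3
        · have := mul_pos hn1 h'
          rw [← h, mul_zero, zero_add]; rw [← h] at this; exact this
      · exact add_pos_of_pos_of_nonneg (mul_pos hn2 h) (mul_nonneg hn1.le e2')
    obtain ⟨k, hk, a, b, hab⟩ := H.exists_decomp hw
    have hred {v w' : ℤ × ℤ} (hv : v ∈ dualSemigroup p q) (hv0 : v ≠ 0)
        (hw' : w' ∈ dualSemigroup p q) (e : w = v + w') : w = v := by
      by_contra hne
      have hw0' : w' ≠ 0 := by rintro rfl; exact hne (by simpa using e)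
      have h1 := hmin v hv hv0
      have h2 := hpos hw' hw0'
      rw [e] at h1
      push_cast [Prod.fst_add, Prod.snd_add] at h1
      nlinarith
    rcases a with _ | a
    · rcases b with _ | b
      · exact absurd (by simpa using hab) hw0
      · refine ⟨k + 1, by omega, hred (w' := b • hjVec c (k + 1)) (H.hjVec_mem (by omega))
          (hjVec_ne_zero _) (nsmul_mem (H.hjVec_mem (by omega)) _) ?_⟩
        rw [hab]; module
    · refine ⟨k, by omega, hred (w' := a • hjVec c k + b • hjVec c (k + 1))
        (H.hjVec_mem (by omega)) (hjVec_ne_zero _)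
        (add_mem (nsmul_mem (H.hjVec_mem (by omega)) _)
          (nsmul_mem (H.hjVec_mem (by omega)) _)) ?_⟩
      rw [hab]; module
  · rintro ⟨k, hk, rfl⟩
    have hval (w : ℤ × ℤ) : (((hjVec c k).2 - (hjVec c (k + 1)).2 : ℤ) : ℝ) * w.1 +
        (((hjVec c (k + 1)).1 - (hjVec c k).1 : ℤ) : ℝ) * w.2 = (hjDeg c k w : ℤ) := by
      rw [hjDeg_apply, hjDet_apply, hjDet_apply]; push_cast; ring
    refine ⟨H.hjVec_mem hk, hjVec_ne_zero k,
      ((((hjVec c k).2 - (hjVec c (k + 1)).2 : ℤ) : ℝ),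
        (((hjVec c (k + 1)).1 - (hjVec c k).1 : ℤ) : ℝ)), ?_, ?_, ?_⟩
    · have : (hjVec c k).1 < (hjVec c (k + 1)).1 := hjVec_fst_strictMono H.two_le (Nat.lt_succ_self k)
      have : (0 : ℤ) < (hjVec c (k + 1)).1 - (hjVec c k).1 := by omega
      simp only
      exact_mod_cast this
    · rw [hlast, hval]
      have := one_le_hjDeg_hjVec H.two_le k (c.length + 1)
      exact_mod_cast (by omega : 0 < hjDeg c k (hjVec c (c.length + 1)))
    · intro w hw hw0
      rw [hval, hval, hjDeg_self]
      exact_mod_cast H.one_le_hjDeg hw hw0 k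

/-- The first coordinates increase strictly, so exactly k boundary points lie to the left of u_k. -/
theorem boundaryPoint_eq {k : ℕ} (hk : k ≤ c.length + 1) : boundaryPoint p q k = hjVec c k := by
  have hmono := hjVec_fst_strictMono H.two_le
  have hcard {j : ℕ} (hj : j ≤ c.length + 1) :
      {w | w ∈ compactBoundary p q ∧ w.1 < (hjVec c j).1}.ncard = j := by
    have : {w | w ∈ compactBoundary p q ∧ w.1 < (hjVec c j).1} =
        hjVec c '' (Finset.range j : Set ℕ) := by
      rw [H.compactBoundary_eq]
      ext w
      simp only [Set.mem_ofPred_eq, Set.mem_image, Finset.coe_range, Set.mem_Iio]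
      constructor
      · rintro ⟨⟨i, _, rfl⟩, h⟩
        exact ⟨i, hmono.lt_iff_lt.1 h, rfl⟩
      · rintro ⟨i, hi, rfl⟩
        exact ⟨⟨i, by omega, rfl⟩, hmono hi⟩
    rw [this, Set.ncard_image_of_injective _ (hjVec_injective H.two_le), Set.ncard_coe_finset,
      Finset.card_range]
  have h := Classical.epsilon_spec (p := fun u => u ∈ compactBoundary p q ∧
    {w | w ∈ compactBoundary p q ∧ w.1 < u.1}.ncard = k)
    ⟨hjVec c k, by rw [H.compactBoundary_eq]; exact ⟨k, hk, rfl⟩, hcard hk⟩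
  change boundaryPoint p q k ∈ _ ∧ _ = k at h
  obtain ⟨h1, h2⟩ := h
  rw [H.compactBoundary_eq] at h1
  obtain ⟨j, hj, e⟩ := h1
  change Set.ncard {w | w ∈ compactBoundary p q ∧ w.1 < (boundaryPoint p q k).1} = k at h2
  rw [e, hcard hj] at h2
  rw [e, h2]

open Classical in
/-- The vector `u_k` as an element of the semigroup (for `k ≤ c.length + 1`). -/
noncomputable def _root_.ToricJets.hjGen (p q : ℕ) (c : List ℕ) (k : ℕ) : dualSemigroup p q :=
  if h : hjVec c k ∈ dualSemigroup p q then ⟨hjVec c k, h⟩ else 0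

theorem coe_hjGen {k : ℕ} (hk : k ≤ c.length + 1) : (hjGen p q c k : ℤ × ℤ) = hjVec c k := by
  rw [hjGen, dif_pos (H.hjVec_mem hk)]

theorem coordFun_eq (K : Type*) [Field K] {k : ℕ} (hk : k ≤ c.length + 1) :
    coordFun K p q k = AddMonoidAlgebra.single (hjGen p q c k) 1 := by
  unfold coordFun
  have e := H.boundaryPoint_eq hk
  have h : boundaryPoint p q k ∈ dualSemigroup p q := by rw [e]; exact H.hjVec_mem hk
  rw [dif_pos h]
  congr 1
  exact Subtype.ext (by simp only [e, H.coe_hjGen hk])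

theorem hjGen_add (i n : ℕ) (hn : i + n ≤ c.length) :
    hjGen p q c i + hjGen p q c (i + n + 1) = hjGen p q c (i + 1) + hjGen p q c (i + n) +
      ∑ k ∈ Finset.range n, (hjCoeff c (i + k) - 2) • hjGen p q c (i + k + 1) := by
  apply Subtype.ext
  push_cast
  rw [H.coe_hjGen (by omega), H.coe_hjGen (by omega), H.coe_hjGen (by omega),
    H.coe_hjGen (by omega), hjVec_add_hjVec_add H.two_le i n]
  congr 1
  refine Finset.sum_congr rfl fun k hk => ?_
  rw [H.coe_hjGen (by have := Finset.mem_range.1 hk; omega)]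

theorem hjGen_add_hjGen (k : ℕ) (hk : k < c.length) :
    hjGen p q c k + hjGen p q c (k + 2) = hjCoeff c k • hjGen p q c (k + 1) := by
  apply Subtype.ext
  push_cast
  rw [H.coe_hjGen (by omega), H.coe_hjGen (by omega), H.coe_hjGen (by omega), hjVec_add_hjVec]

theorem hjGen_ne_zero {k : ℕ} (hk : k ≤ c.length + 1) : hjGen p q c k ≠ 0 := by
  intro h
  apply hjVec_ne_zero k
  rw [← H.coe_hjGen hk, h]; rfl

theorem hjGen_injOn {j k : ℕ} (hj : j ≤ c.length + 1) (hk : k ≤ c.length + 1)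
    (h : hjGen p q c j = hjGen p q c k) : j = k := by
  apply hjVec_injective H.two_le
  rw [← H.coe_hjGen hj, ← H.coe_hjGen hk, h]

theorem hjGen_ne_add {k : ℕ} (hk : k ≤ c.length + 1) {v w : dualSemigroup p q} (hv : v ≠ 0)
    (hw : w ≠ 0) : hjGen p q c k ≠ v + w := by
  intro h
  refine H.hjVec_ne_add (k := k) v.2 w.2 (by simpa using hv) (by simpa using hw) ?_
  rw [← H.coe_hjGen hk, h]; rfl

theorem hjGen_induction {P : dualSemigroup p q → Prop} (h0 : P 0)
    (hu : ∀ k ≤ c.length + 1, P (hjGen p q c k)) (hadd : ∀ v w, P v → P w → P (v + w))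
    (w : dualSemigroup p q) : P w := by
  have hn (n : ℕ) (v : dualSemigroup p q) (hv : P v) : P (n • v) := by
    induction n with
    | zero => simpa using h0
    | succ n ih => rw [succ_nsmul]; exact hadd _ _ ih hv
  obtain ⟨k, hk, a, b, h⟩ := H.exists_decomp w.2
  have : w = a • hjGen p q c k + b • hjGen p q c (k + 1) := by
    apply Subtype.ext
    push_cast
    rw [h, H.coe_hjGen (by omega), H.coe_hjGen (by omega)]
  rw [this]
  exact hadd _ _ (hn _ _ (hu _ (by omega))) (hn _ _ (hu _ (by omega)))

/-- Every nonzero element is a generator or a sum of two nonzero elements. -/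
theorem eq_hjGen_or_add {w : dualSemigroup p q} (hw : w ≠ 0) :
    (∃ k ≤ c.length + 1, w = hjGen p q c k) ∨ ∃ v v', v ≠ 0 ∧ v' ≠ 0 ∧ w = v + v' := by
  revert hw
  refine H.hjGen_induction (P := fun w => w ≠ 0 → (∃ k ≤ c.length + 1, w = hjGen p q c k) ∨
    ∃ v v', v ≠ 0 ∧ v' ≠ 0 ∧ w = v + v') (fun h => absurd rfl h)
    (fun k hk _ => Or.inl ⟨k, hk, rfl⟩) (fun v v' hv hv' hne => ?_) w
  by_cases h : v = 0
  · subst h; rw [zero_add] at hne ⊢; exact hv' hne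
  · by_cases h' : v' = 0
    · subst h'; rw [add_zero] at hne ⊢; exact hv hne
    · exact Or.inr ⟨v, v', h, h', rfl⟩

end HJData

theorem hjCoeff_reverse {k : ℕ} (hk : k < c.length) :
    hjCoeff c.reverse k = hjCoeff c (c.length - 1 - k) := by
  unfold hjCoeff
  rw [List.getD_eq_getElem _ _ (by simpa using hk), List.getD_eq_getElem _ _ (by omega),
    List.getElem_reverse]

/-- The linear map that reverses the order of the vectors `u_k`. -/
def hjRev (c : List ℕ) : ℤ × ℤ →+ ℤ × ℤ where
  toFun w := w.1 • hjVec c.reverse c.length + w.2 • hjVec c.reverse (c.length + 1)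
  map_zero' := by simp
  map_add' v w := by simp only [Prod.fst_add, Prod.snd_add]; module

/-- The relation u_k + u_(k+2) = c_k u_(k+1) reads the same in both directions, so the prescribed
images of u_0 and u_1 propagate. -/
theorem hjRev_hjVec {k : ℕ} (hk : k ≤ c.length + 1) :
    hjRev c (hjVec c k) = hjVec c.reverse (c.length + 1 - k) := by
  induction k using Nat.twoStepInduction with
  | zero => simp [hjRev, hjVec]
  | one => simp [hjRev, hjVec]
  | more k ih1 ih2 =>
    rw [hjVec_add_two, map_sub, map_zsmul, ih1 (by omega), ih2 (by omega)]
    have h := hjVec_add_hjVec (c := c.reverse) (c.length + 1 - (k + 2))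
    rw [hjCoeff_reverse (by omega), show c.length - 1 - (c.length + 1 - (k + 2)) = k by omega,
      show c.length + 1 - (k + 2) + 2 = c.length + 1 - k by omega,
      show c.length + 1 - (k + 2) + 1 = c.length + 1 - (k + 1) by omega] at h
    rw [natCast_zsmul, ← h]
    abel

theorem hjRev_hjRev (w : ℤ × ℤ) : hjRev c.reverse (hjRev c w) = w := by
  have h (k : ℕ) (hk : k ≤ c.length + 1) : hjRev c.reverse (hjRev c (hjVec c k)) = hjVec c k := by
    rw [hjRev_hjVec hk, hjRev_hjVec (by simp), List.reverse_reverse, List.length_reverse]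
    congr 1; omega
  have e : w = w.2 • hjVec c 0 + w.1 • hjVec c 1 := by
    ext <;> simp [hjVec]
  rw [e, map_add, map_add, map_zsmul, map_zsmul, map_zsmul, map_zsmul, h 0 (by omega),
    h 1 (by omega)]

theorem HJData.hjRev_mem {p q p' q' : ℕ} (H : HJData p q c) (H' : HJData p' q' c.reverse)
    {w : ℤ × ℤ} (hw : w ∈ dualSemigroup p q) : hjRev c w ∈ dualSemigroup p' q' := by
  obtain ⟨k, hk, a, b, rfl⟩ := H.exists_decomp hw
  rw [map_add, map_nsmul, map_nsmul, hjRev_hjVec (by omega), hjRev_hjVec (by omega)]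
  exact add_mem (nsmul_mem (H'.hjVec_mem (by rw [List.length_reverse]; omega)) _)
    (nsmul_mem (H'.hjVec_mem (by rw [List.length_reverse]; omega)) _)

/-- The isomorphism of semigroups that reverses the order of the generators. -/
def hjRevEquiv {p q p' q' : ℕ} (H : HJData p q c) (H' : HJData p' q' c.reverse) :
    dualSemigroup p q ≃+ dualSemigroup p' q' where
  toFun w := ⟨hjRev c w, H.hjRev_mem H' w.2⟩
  invFun w := ⟨hjRev c.reverse w, H'.hjRev_mem (by rwa [List.reverse_reverse]) w.2⟩
  left_inv w := Subtype.ext (hjRev_hjRev _)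
  right_inv w := Subtype.ext (by
    have := hjRev_hjRev (c := c.reverse) w
    rwa [List.reverse_reverse] at this)
  map_add' v w := Subtype.ext (by simp)

theorem hjRevEquiv_hjGen {p q p' q' : ℕ} (H : HJData p q c) (H' : HJData p' q' c.reverse)
    {k : ℕ} (hk : k ≤ c.length + 1) :
    hjRevEquiv H H' (hjGen p q c k) = hjGen p' q' c.reverse (c.length + 1 - k) := by
  apply Subtype.ext
  rw [H'.coe_hjGen (by simp)]
  change hjRev c (hjGen p q c k : ℤ × ℤ) = _
  rw [H.coe_hjGen hk, hjRev_hjVec hk]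

end Lattice
end ToricJets

namespace ToricJets

/-! ### Points of jet schemes as homomorphisms to truncated power series. -/

section JetHoms

open PowerSeries

/-- The ring `R[t]/(t^(m+1))`. -/
abbrev TruncSeries (R : Type*) [CommRing R] (m : ℕ) : Type _ :=
  R⟦X⟧ ⧸ Ideal.span {(X : R⟦X⟧) ^ (m + 1)}

/-- The class of a power series modulo `t^(m+1)`. -/
noncomputable abbrev truncMk {R : Type*} [CommRing R] (m : ℕ) : R⟦X⟧ →+* TruncSeries R m :=
  Ideal.Quotient.mk _

variable {R : Type*} [CommRing R] {m : ℕ}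

theorem truncMk_eq_iff_dvd {f g : R⟦X⟧} : truncMk m f = truncMk m g ↔ X ^ (m + 1) ∣ f - g := by
  rw [Ideal.Quotient.eq, Ideal.mem_span_singleton]

theorem truncMk_eq_iff {f g : R⟦X⟧} :
    truncMk m f = truncMk m g ↔ ∀ k ≤ m, coeff k f = coeff k g := by
  rw [truncMk_eq_iff_dvd, X_pow_dvd_iff]
  refine forall_congr' fun k => ?_
  rw [Nat.lt_succ_iff, map_sub, sub_eq_zero]

theorem truncMk_surjective : Function.Surjective (truncMk (R := R) m) :=
  Ideal.Quotient.mk_surjective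

/-- The `k`-th coefficient of an element of `R[t]/(t^(m+1))`, for `k ≤ m`. -/
noncomputable def truncCoeff (k : ℕ) (z : TruncSeries R m) : R :=
  coeff k (Function.surjInv truncMk_surjective z)

theorem truncCoeff_mk {k : ℕ} (hk : k ≤ m) (f : R⟦X⟧) : truncCoeff k (truncMk m f) = coeff k f :=
  truncMk_eq_iff.1 (Function.surjInv_eq truncMk_surjective (truncMk m f)) k hk

theorem truncSeries_ext {y z : TruncSeries R m} (h : ∀ k ≤ m, truncCoeff k y = truncCoeff k z) :
    y = z := by
  obtain ⟨f, rfl⟩ := truncMk_surjective y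
  obtain ⟨g, rfl⟩ := truncMk_surjective z
  refine truncMk_eq_iff.2 fun k hk => ?_
  rw [← truncCoeff_mk hk, ← truncCoeff_mk hk, h k hk]

variable {K : Type*} [Field K] {A : Type*} [CommRing A] [Algebra K A] [Algebra K R]

/-- The power series with the coefficients of the image of `a` under a jet. -/
noncomputable def jetSeries (π : JetAlgebra K A m →ₐ[K] R) (a : A) : R⟦X⟧ :=
  -- The coefficients above m are 0, so a nonzero coefficient always has index at most m.
  PowerSeries.mk fun k => if h : k < m + 1 then π (jetCoeff K m ⟨k, h⟩ a) else 0

theorem coeff_jetSeries (π : JetAlgebra K A m →ₐ[K] R) (a : A) (k : Fin (m + 1)) :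
    coeff (k : ℕ) (jetSeries π a) = π (jetCoeff K m k a) := by
  rw [jetSeries, coeff_mk, dif_pos k.2]

theorem coeff_jetSeries' (π : JetAlgebra K A m →ₐ[K] R) (a : A) {k : ℕ} (hk : k ≤ m) :
    coeff k (jetSeries π a) = π (jetCoeff K m ⟨k, Nat.lt_succ_of_le hk⟩ a) :=
  coeff_jetSeries π a ⟨k, Nat.lt_succ_of_le hk⟩

theorem sum_fin_ite_add_eq {M : Type*} [AddCommMonoid M] (F : ℕ → ℕ → M) {k : ℕ} (hk : k ≤ m) :
    ∑ i : Fin (m + 1), ∑ j : Fin (m + 1), (if (i : ℕ) + (j : ℕ) = k then F i j else 0) =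
      ∑ x ∈ Finset.HasAntidiagonal.antidiagonal k, F x.1 x.2 := by
  rw [← Finset.sum_range (f := fun i => ∑ j : Fin (m + 1), if i + (j : ℕ) = k then F i j else 0)]
  simp_rw [fun i => (Finset.sum_range (n := m + 1)
    (f := fun j => if i + j = k then F i j else 0)).symm]
  rw [← Finset.sum_product', ← Finset.sum_filter]
  refine Finset.sum_congr ?_ fun _ _ => rfl
  ext ⟨i, j⟩
  simp only [Finset.mem_filter, Finset.mem_product, Finset.mem_range, Finset.HasAntidiagonal.mem_antidiagonal]
  omega

/-- A point of the jet scheme with values in `R` is a homomorphism to `R[t]/(t^(m+1))`. -/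
noncomputable def jetHom (π : JetAlgebra K A m →ₐ[K] R) : A →ₐ[K] TruncSeries R m where
  toFun a := truncMk m (jetSeries π a)
  map_one' := by
    rw [← map_one (truncMk m), truncMk_eq_iff]
    intro k hk
    have := jetCoeff_const (K := K) (A := A) m ⟨k, Nat.lt_succ_of_le hk⟩ 1
    rw [map_one] at this
    rw [coeff_jetSeries' π _ hk, this, coeff_one]
    split_ifs <;> simp
  map_zero' := by
    rw [← map_zero (truncMk m), truncMk_eq_iff]
    intro k hk
    have := jetCoeff_const (K := K) (A := A) m ⟨k, Nat.lt_succ_of_le hk⟩ 0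
    rw [map_zero] at this
    rw [coeff_jetSeries' π _ hk, this]
    simp
  map_add' a b := by
    rw [← map_add (truncMk m), truncMk_eq_iff]
    intro k hk
    rw [map_add, coeff_jetSeries' π _ hk, coeff_jetSeries' π _ hk, coeff_jetSeries' π _ hk,
      jetCoeff_add, map_add]
  map_mul' a b := by
    rw [← map_mul (truncMk m), truncMk_eq_iff]
    intro k hk
    rw [coeff_jetSeries' π _ hk, jetCoeff_mul, coeff_mul]
    rw [← sum_fin_ite_add_eq (m := m)
      (fun i j => coeff i (jetSeries π a) * coeff j (jetSeries π b)) hk]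
    simp only [map_sum, apply_ite π, map_mul, map_zero, coeff_jetSeries]
  commutes' r := by
    change _ = truncMk m (algebraMap K R⟦X⟧ r)
    rw [truncMk_eq_iff]
    intro k hk
    rw [coeff_jetSeries' π _ hk, jetCoeff_const, PowerSeries.algebraMap_apply, coeff_C]
    split_ifs <;> simp

theorem jetHom_apply (π : JetAlgebra K A m →ₐ[K] R) (a : A) :
    jetHom π a = truncMk m (jetSeries π a) := rfl

theorem truncCoeff_jetHom (π : JetAlgebra K A m →ₐ[K] R) (a : A) {k : ℕ} (hk : k ≤ m) :
    truncCoeff k (jetHom π a) = π (jetCoeff K m ⟨k, Nat.lt_succ_of_le hk⟩ a) := by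
  rw [jetHom_apply, truncCoeff_mk hk, coeff_jetSeries' π a hk]

theorem jetAlgebra_hom_ext {π π' : JetAlgebra K A m →ₐ[K] R}
    (h : ∀ k a, π (jetCoeff K m k a) = π' (jetCoeff K m k a)) : π = π' := by
  refine Ideal.Quotient.algHom_ext K (MvPolynomial.algHom_ext fun v => ?_)
  exact h v.1 v.2

theorem truncCoeff_add {k : ℕ} (hk : k ≤ m) (y z : TruncSeries R m) :
    truncCoeff k (y + z) = truncCoeff k y + truncCoeff k z := by
  obtain ⟨f, rfl⟩ := truncMk_surjective y
  obtain ⟨g, rfl⟩ := truncMk_surjective z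
  rw [← map_add, truncCoeff_mk hk, truncCoeff_mk hk, truncCoeff_mk hk, map_add]

theorem truncCoeff_mul {k : ℕ} (hk : k ≤ m) (y z : TruncSeries R m) :
    truncCoeff k (y * z) = ∑ i : Fin (m + 1), ∑ j : Fin (m + 1),
      if (i : ℕ) + (j : ℕ) = k then truncCoeff i y * truncCoeff j z else 0 := by
  rw [sum_fin_ite_add_eq (m := m) (fun i j => truncCoeff i y * truncCoeff j z) hk]
  obtain ⟨f, rfl⟩ := truncMk_surjective y
  obtain ⟨g, rfl⟩ := truncMk_surjective z
  rw [← map_mul, truncCoeff_mk hk, coeff_mul]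
  refine Finset.sum_congr rfl fun x hx => ?_
  have := Finset.HasAntidiagonal.mem_antidiagonal.1 hx
  rw [truncCoeff_mk (by omega), truncCoeff_mk (by omega)]

theorem truncCoeff_algebraMap {k : ℕ} (hk : k ≤ m) (r : K) :
    truncCoeff k (algebraMap K (TruncSeries R m) r) = algebraMap K R (if k = 0 then r else 0) := by
  change truncCoeff k (truncMk m (algebraMap K R⟦X⟧ r)) = _
  rw [truncCoeff_mk hk, PowerSeries.algebraMap_apply, coeff_C]
  split_ifs <;> simp

/-- The point of the jet scheme which corresponds to a homomorphism to `R[t]/(t^(m+1))`. -/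
noncomputable def jetLift (g : A →ₐ[K] TruncSeries R m) : JetAlgebra K A m →ₐ[K] R :=
  Ideal.Quotient.liftₐ (jetIdeal K A m)
    (MvPolynomial.aeval fun v : Fin (m + 1) × A => truncCoeff (v.1 : ℕ) (g v.2)) (by
    have hle : jetIdeal K A m ≤ RingHom.ker (MvPolynomial.aeval
        fun v : Fin (m + 1) × A => truncCoeff (v.1 : ℕ) (g v.2)).toRingHom := by
      refine Ideal.span_le.2 ?_
      intro f hf
      rw [SetLike.mem_coe, RingHom.mem_ker]
      rcases hf with ⟨k, a, b⟩ | ⟨k, a, b⟩ | ⟨k, r⟩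
      · simp [truncCoeff_add (Nat.lt_succ_iff.1 k.2)]
      · simp only [AlgHom.toRingHom_eq_coe, map_sub, RingHom.coe_coe, MvPolynomial.aeval_X,
          map_sum, apply_ite (MvPolynomial.aeval fun v : Fin (m + 1) × A =>
            truncCoeff (v.1 : ℕ) (g v.2)), map_mul, map_zero]
        rw [sub_eq_zero, truncCoeff_mul (Nat.lt_succ_iff.1 k.2)]
      · simp only [AlgHom.toRingHom_eq_coe, map_sub, RingHom.coe_coe, MvPolynomial.aeval_X,
          MvPolynomial.aeval_C, AlgHom.commutes]
        rw [truncCoeff_algebraMap (Nat.lt_succ_iff.1 k.2), sub_self]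
    exact fun a ha => hle ha)

theorem jetLift_jetCoeff (g : A →ₐ[K] TruncSeries R m) (k : Fin (m + 1)) (a : A) :
    jetLift g (jetCoeff K m k a) = truncCoeff (k : ℕ) (g a) := by
  exact MvPolynomial.aeval_X _ _

theorem jetHom_jetLift (g : A →ₐ[K] TruncSeries R m) : jetHom (jetLift g) = g := by
  ext a
  refine truncSeries_ext fun k hk => ?_
  rw [truncCoeff_jetHom _ _ hk, jetLift_jetCoeff]

end JetHoms

section Monomials

open PowerSeries

variable {R : Type*} [CommRing R] {m : ℕ} {K : Type*} [Field K] [Algebra K R]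
  {S : Type*} [AddCommMonoid S]

/-- The homomorphism to `R[t]/(t^(m+1))` given by the images of the monomials. -/
noncomputable def monomialJet (φ : S → R⟦X⟧) (h0 : truncMk m (φ 0) = 1)
    (hadd : ∀ v w, truncMk m (φ (v + w)) = truncMk m (φ v * φ w)) :
    AddMonoidAlgebra K S →ₐ[K] TruncSeries R m :=
  AddMonoidAlgebra.lift K _ S
    { toFun := fun w => truncMk m (φ w.toAdd)
      map_one' := h0
      map_mul' := fun v w => by rw [← map_mul]; exact hadd _ _ }

theorem monomialJet_single (φ : S → R⟦X⟧) (h0 : truncMk m (φ 0) = 1)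
    (hadd : ∀ v w, truncMk m (φ (v + w)) = truncMk m (φ v * φ w)) (w : S) :
    monomialJet (K := K) φ h0 hadd (AddMonoidAlgebra.single w 1) = truncMk m (φ w) := by
  rw [monomialJet, AddMonoidAlgebra.lift_single, one_smul]; rfl

theorem single_add_one (v w : S) : (AddMonoidAlgebra.single (v + w) 1 : AddMonoidAlgebra K S) =
    AddMonoidAlgebra.single v 1 * AddMonoidAlgebra.single w 1 := by
  rw [AddMonoidAlgebra.single_mul_single, one_mul]

theorem single_nsmul_one (n : ℕ) (w : S) :
    (AddMonoidAlgebra.single (n • w) 1 : AddMonoidAlgebra K S) =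
      AddMonoidAlgebra.single w 1 ^ n := by
  rw [AddMonoidAlgebra.single_pow, one_pow]

theorem single_sum_one {ι : Type*} (s : Finset ι) (w : ι → S) :
    (AddMonoidAlgebra.single (∑ i ∈ s, w i) 1 : AddMonoidAlgebra K S) =
      ∏ i ∈ s, AddMonoidAlgebra.single (w i) 1 := by
  classical
  induction s using Finset.induction_on with
  | empty => rfl
  | insert i s hi ih => rw [Finset.sum_insert hi, Finset.prod_insert hi, single_add_one, ih]

end Monomials

end ToricJets

namespace ToricJets

open PowerSeries

/-! ### Power series with coefficients in a subalgebra. -/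

section CoeffsIn

variable {K R : Type*} [Field K] [CommRing R] [Algebra K R]

/-- The first `n` coefficients of `f` lie in `L`. -/
def CoeffsIn (L : Subalgebra K R) (n : ℕ) (f : R⟦X⟧) : Prop := ∀ k < n, coeff k f ∈ L

variable {L : Subalgebra K R} {n s : ℕ} {f g : R⟦X⟧}

theorem CoeffsIn.mul (hf : CoeffsIn L n f) (hg : CoeffsIn L n g) : CoeffsIn L n (f * g) := by
  intro k hk
  rw [coeff_mul]
  refine sum_mem fun x hx => ?_
  have := Finset.HasAntidiagonal.mem_antidiagonal.1 hx
  exact mul_mem (hf _ (by omega)) (hg _ (by omega))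

theorem CoeffsIn.one : CoeffsIn L n (1 : R⟦X⟧) := by
  intro k _
  rw [coeff_one]
  split_ifs
  · exact one_mem L
  · exact zero_mem L

theorem CoeffsIn.pow (hf : CoeffsIn L n f) (a : ℕ) : CoeffsIn L n (f ^ a) := by
  induction a with
  | zero => rw [pow_zero]; exact CoeffsIn.one
  | succ a ih => rw [pow_succ]; exact ih.mul hf

theorem CoeffsIn.prod {ι : Type*} {t : Finset ι} {f : ι → R⟦X⟧}
    (h : ∀ i ∈ t, CoeffsIn L n (f i)) : CoeffsIn L n (∏ i ∈ t, f i) := by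
  classical
  induction t using Finset.induction_on with
  | empty => rw [Finset.prod_empty]; exact CoeffsIn.one
  | insert i t hi ih =>
    rw [Finset.prod_insert hi]
    exact (h i (by simp)).mul (ih fun j hj => h j (by simp [hj]))

theorem CoeffsIn.mono {n' : ℕ} (hf : CoeffsIn L n f) (h : n' ≤ n) : CoeffsIn L n' f :=
  fun k hk => hf k (by omega)

/-- Below the index n + s, a coefficient of one factor with index at least n only meets coefficients
of the other with index below s, and these vanish. -/
theorem CoeffsIn.mul_of_dvd (hf : CoeffsIn L n f) (hg : CoeffsIn L n g) (hsf : X ^ s ∣ f)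
    (hsg : X ^ s ∣ g) : CoeffsIn L (n + s) (f * g) := by
  intro k hk
  rw [coeff_mul]
  refine sum_mem fun x hx => ?_
  have := Finset.HasAntidiagonal.mem_antidiagonal.1 hx
  rw [X_pow_dvd_iff] at hsf hsg
  rcases lt_or_ge x.1 s with h | h
  · rw [hsf _ h, zero_mul]; exact zero_mem L
  rcases lt_or_ge x.2 s with h' | h'
  · rw [hsg _ h', mul_zero]; exact zero_mem L
  exact mul_mem (hf _ (by omega)) (hg _ (by omega))

theorem CoeffsIn.mul_of_dvd' (hf : CoeffsIn L (n + s) f) (hg : CoeffsIn L n g) (hsf : X ^ s ∣ f) :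
    CoeffsIn L (n + s) (f * g) := by
  intro k hk
  rw [coeff_mul]
  refine sum_mem fun x hx => ?_
  have := Finset.HasAntidiagonal.mem_antidiagonal.1 hx
  rw [X_pow_dvd_iff] at hsf
  rcases lt_or_ge x.1 s with h | h
  · rw [hsf _ h, zero_mul]; exact zero_mem L
  exact mul_mem (hf _ (by omega)) (hg _ (by omega))

/-- Division by a series of order s: the coefficient k + s of f g is the leading coefficient of f
times the k-th one of g, up to earlier coefficients of g. The hypothesis `hs` stands for division
inside L. It is used for a diagonal (uniqueness of jets) and for a relative algebraic closure
(dimension bounds). -/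
theorem CoeffsIn.of_mul (hf : CoeffsIn L (n + s) f) (hfg : CoeffsIn L (n + s) (f * g))
    (hsf : X ^ s ∣ f) (hs : ∀ x, coeff s f * x ∈ L → x ∈ L) : CoeffsIn L n g := by
  intro k
  induction k using Nat.strong_induction_on with
  | _ k ih =>
  intro hk
  apply hs
  have h := hfg (k + s) (by omega)
  have hmem : (s, k) ∈ Finset.HasAntidiagonal.antidiagonal (k + s) :=
    Finset.HasAntidiagonal.mem_antidiagonal.2 (by omega)
  rw [coeff_mul, ← Finset.add_sum_erase _ _ hmem] at h
  refine (add_mem_cancel_right (sum_mem fun x hx => ?_)).1 h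
  obtain ⟨hne, hx⟩ := Finset.mem_erase.1 hx
  have hx' := Finset.HasAntidiagonal.mem_antidiagonal.1 hx
  rw [X_pow_dvd_iff] at hsf
  rcases lt_trichotomy x.1 s with h | h | h
  · rw [hsf _ h, zero_mul]; exact zero_mem L
  · exact absurd (Prod.ext h (by simp only; omega)) hne
  · exact mul_mem (hf _ (by omega)) (ih _ (by omega) (by omega))

theorem CoeffsIn.congr {m : ℕ} (h : truncMk m f = truncMk m g) (hf : CoeffsIn L (m + 1) f) :
    CoeffsIn L (m + 1) g := fun k hk => by
  rw [← truncMk_eq_iff.1 h k (by omega)]; exact hf k hk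

end CoeffsIn

section Orders

theorem X_pow_dvd_of_truncMk_eq {R : Type*} [CommRing R] {m s : ℕ} {f g : R⟦X⟧}
    (h : truncMk m f = truncMk m g) (hs : s ≤ m + 1) (hf : X ^ s ∣ f) : X ^ s ∣ g := by
  rw [X_pow_dvd_iff] at hf ⊢
  intro k hk
  rw [← truncMk_eq_iff.1 h k (by omega), hf k hk]

theorem X_pow_dvd_of_mul {R : Type*} [CommRing R] [IsDomain R] {a b : ℕ} {f g : R⟦X⟧}
    (hf : X ^ a ∣ f) (ha : coeff a f ≠ 0) (h : X ^ (a + b) ∣ f * g) : X ^ b ∣ g := by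
  obtain ⟨f, rfl⟩ := hf
  have hX : (X : R⟦X⟧) ^ a ≠ 0 := pow_ne_zero _ PowerSeries.X_ne_zero
  rw [pow_add, mul_assoc] at h
  refine X_prime.pow_dvd_of_dvd_mul_left b ?_ ((mul_dvd_mul_iff_left hX).1 h)
  rintro hd
  rw [X_dvd_iff] at hd
  apply ha
  have := coeff_X_pow_mul f a 0
  rw [zero_add] at this
  rw [this, coeff_zero_eq_constantCoeff_apply, hd]

end Orders

/-! ### How the relations propagate from a generator of minimal order to the others. -/

section Generators

variable {K : Type*} [Field K] {p q m : ℕ} {R : Type*} [CommRing R] [Algebra K R]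

/-- The series of the monomial `x^w` under a jet. -/
noncomputable abbrev monSeries (π : JetAlgebra K (CoordRing K p q) m →ₐ[K] R)
    (w : dualSemigroup p q) : R⟦X⟧ :=
  jetSeries π (AddMonoidAlgebra.single w 1)

/-- The series of the `k`-th generator of the coordinate ring under a jet. -/
noncomputable abbrev genSeries (c : List ℕ) (π : JetAlgebra K (CoordRing K p q) m →ₐ[K] R)
    (k : ℕ) : R⟦X⟧ :=
  monSeries π (hjGen p q c k)

variable {c : List ℕ} (H : HJData p q c) (π : JetAlgebra K (CoordRing K p q) m →ₐ[K] R)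

theorem monSeries_add (v w : dualSemigroup p q) :
    truncMk m (monSeries π (v + w)) = truncMk m (monSeries π v * monSeries π w) := by
  rw [map_mul, ← jetHom_apply, ← jetHom_apply, ← jetHom_apply, ← map_mul, single_add_one]

theorem monSeries_zero : truncMk m (monSeries π (0 : dualSemigroup p q)) = truncMk m 1 := by
  rw [map_one, ← jetHom_apply, ← map_one (jetHom π)]; rfl

include H in
theorem genSeries_mul (i n : ℕ) (hn : i + n ≤ c.length) :
    truncMk m (genSeries c π i * genSeries c π (i + n + 1)) =
      truncMk m (genSeries c π (i + 1) * genSeries c π (i + n) *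
        ∏ k ∈ Finset.range n, genSeries c π (i + k + 1) ^ (hjCoeff c (i + k) - 2)) := by
  rw [← monSeries_add, H.hjGen_add i n hn, ← jetHom_apply, single_add_one, single_add_one,
    single_sum_one]
  simp only [map_mul, map_prod, single_nsmul_one, map_pow, jetHom_apply]

include H in
theorem genSeries_mul_two (k : ℕ) (hk : k < c.length) :
    truncMk m (genSeries c π k * genSeries c π (k + 2)) =
      truncMk m (genSeries c π (k + 1) ^ hjCoeff c k) := by
  rw [← monSeries_add, H.hjGen_add_hjGen k hk, ← jetHom_apply, single_nsmul_one]
  simp only [map_pow, jetHom_apply]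

/-- Induction outwards from i, adapted to `genSeries_mul`: the product of x_i and a generator at
distance at least 2 is expressed by the generators strictly between them. -/
theorem generator_induction {r i : ℕ} {P : ℕ → Prop} (hi : i ≤ r + 1)
    (near : ∀ j ≤ r + 1, j ≤ i + 1 → i ≤ j + 1 → P j)
    (right : ∀ n, 1 ≤ n → i + n ≤ r → (∀ k, i < k → k ≤ i + n → P k) → P (i + n + 1))
    (left : ∀ j n, 1 ≤ n → j + n + 1 = i → (∀ k, j < k → k ≤ j + n → P k) → P j) :
    ∀ j ≤ r + 1, P j := by
  have h1 : ∀ n, i + n ≤ r + 1 → P (i + n) := by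
    intro n
    induction n using Nat.strong_induction_on with
    | _ n ih =>
    intro hn
    rcases le_or_gt n 1 with h | h
    · exact near _ hn (by omega) (by omega)
    · obtain ⟨n, rfl⟩ := Nat.exists_eq_add_of_lt h
      rw [show i + (1 + n + 1) = i + (n + 1) + 1 by ring]
      refine right (n + 1) (by omega) (by omega) fun k hk hk' => ?_
      obtain ⟨d, rfl⟩ := Nat.exists_eq_add_of_lt hk
      exact ih (d + 1) (by omega) (by omega)
  have h2 : ∀ n, n ≤ i → P (i - n) := by
    intro n
    induction n using Nat.strong_induction_on with
    | _ n ih =>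
    intro hn
    rcases le_or_gt n 1 with h | h
    · exact near _ (by omega) (by omega) (by omega)
    · refine left (i - n) (n - 1) (by omega) (by omega) fun k hk hk' => ?_
      have := ih (i - k) (by omega) (by omega)
      rwa [show i - (i - k) = k by omega] at this
  intro j hj
  rcases le_total i j with h | h
  · have := h1 (j - i) (by omega)
    rwa [show i + (j - i) = j by omega] at this
  · have := h2 (i - j) (by omega)
    rwa [show i - (i - j) = j by omega] at this

include H in
/-- If `x_i` has order `s` and its neighbours have order `≥ s`, then so have all generators. -/
theorem X_pow_dvd_genSeries [IsDomain R] {i s : ℕ} (hi : i ≤ c.length + 1) (hs : 2 * s ≤ m + 1)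
    (near : ∀ j ≤ c.length + 1, j ≤ i + 1 → i ≤ j + 1 → X ^ s ∣ genSeries c π j)
    (hne : coeff s (genSeries c π i) ≠ 0) :
    ∀ j ≤ c.length + 1, X ^ s ∣ genSeries c π j := by
  have hsi := near i hi (by omega) (by omega)
  have key (f g h : R⟦X⟧) (hf : X ^ s ∣ f) (hg : X ^ s ∣ g) : X ^ (s + s) ∣ f * g * h := by
    rw [pow_add]; exact (mul_dvd_mul hf hg).mul_right _
  -- The right side of the relation has two factors of order at least s, and 2s ≤ m + 1, so
  -- truncation does no harm. Division by x_i, of order exactly s, leaves order s.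
  refine generator_induction hi near (fun n h1 hn ih => ?_) (fun j n h1 hn ih => ?_)
  · refine X_pow_dvd_of_mul hsi hne (X_pow_dvd_of_truncMk_eq (genSeries_mul H π i n hn).symm
      (by omega) (key _ _ _ (ih _ (by omega) (by omega)) (ih _ (by omega) (by omega))))
  · refine X_pow_dvd_of_mul hsi hne ?_
    rw [mul_comm]
    subst hn
    exact X_pow_dvd_of_truncMk_eq (genSeries_mul H π j n (by omega)).symm (by omega)
      (key _ _ _ (ih _ (by omega) (by omega)) (ih _ (by omega) (by omega)))

theorem jetCoeff_subalgebra_eq_top {A : Type*} [CommRing A] [Algebra K A]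
    (T : Subalgebra K (JetAlgebra K A m)) (h : ∀ k a, jetCoeff K m k a ∈ T) (z : JetAlgebra K A m) :
    z ∈ T := by
  obtain ⟨f, rfl⟩ := Ideal.Quotient.mk_surjective z
  induction f using MvPolynomial.induction_on with
  | C r => exact T.algebraMap_mem r
  | add f g hf hg => rw [map_add]; exact add_mem hf hg
  | mul_X f v hf => rw [map_mul]; exact mul_mem hf (h v.1 v.2)

theorem jetCoeff_smul {A : Type*} [CommRing A] [Algebra K A] (k : Fin (m + 1)) (r : K) (a : A) :
    jetCoeff K m k (r • a) = r • jetCoeff K m k a := by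
  have h (a : A) := truncCoeff_jetHom (AlgHom.id K (JetAlgebra K A m)) a (Nat.lt_succ_iff.1 k.2)
  simp only [AlgHom.id_apply] at h
  change jetCoeff K m ⟨k, k.2⟩ _ = r • jetCoeff K m ⟨k, k.2⟩ _
  rw [← h, ← h, map_smul]
  obtain ⟨f, hf⟩ := truncMk_surjective (jetHom (AlgHom.id K (JetAlgebra K A m)) a)
  rw [← hf]
  change truncCoeff _ (truncMk m (r • f)) = _
  rw [truncCoeff_mk (by omega), truncCoeff_mk (by omega), coeff_smul]

theorem jetCoeff_mem_of_monomials {S : Type*} [AddCommMonoid S]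
    (T : Submodule K (JetAlgebra K (AddMonoidAlgebra K S) m)) {k : Fin (m + 1)}
    (h : ∀ w, jetCoeff K m k (AddMonoidAlgebra.single w 1) ∈ T) (a : AddMonoidAlgebra K S) :
    jetCoeff K m k a ∈ T := by
  induction a using AddMonoidAlgebra.induction_linear with
  | zero =>
    have := jetCoeff_smul (A := AddMonoidAlgebra K S) k (0 : K) 0
    rw [smul_zero, zero_smul] at this
    rw [this]; exact zero_mem T
  | add a b ha hb => rw [jetCoeff_add]; exact add_mem ha hb
  | single w r =>
    have : (AddMonoidAlgebra.single w r : AddMonoidAlgebra K S) =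
        r • AddMonoidAlgebra.single w 1 := by simp
    rw [this, jetCoeff_smul]; exact T.smul_mem r (h w)

include H in
theorem mem_of_coeffsIn_genSeries {L : Subalgebra K R}
    (h : ∀ j ≤ c.length + 1, CoeffsIn L (m + 1) (genSeries c π j)) (z) : π z ∈ L := by
  refine jetCoeff_subalgebra_eq_top (L.comap π) (fun k a => ?_) z
  refine jetCoeff_mem_of_monomials (L.comap π).toSubmodule (fun w => ?_) a
  have hw : CoeffsIn L (m + 1) (monSeries π w) := by
    refine H.hjGen_induction (P := fun w => CoeffsIn L (m + 1) (monSeries π w)) ?_ h ?_ w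
    · exact CoeffsIn.one.congr (monSeries_zero π).symm
    · exact fun v w hv hw => (hv.mul hw).congr (monSeries_add π v w).symm
  have := hw k k.2
  rwa [coeff_jetSeries] at this

include H in
/-- A jet with all orders at least `s` is determined by the series of a generator of order `s` and of
its neighbours, and by the last `s` coefficients of the other generators. -/
theorem mem_of_coeffsIn_near {L : Subalgebra K R} {i s : ℕ} (hi : i ≤ c.length + 1)
    (hs : 2 * s ≤ m + 1) (hord : ∀ j ≤ c.length + 1, X ^ s ∣ genSeries c π j)
    (hcancel : ∀ x, coeff s (genSeries c π i) * x ∈ L → x ∈ L)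
    (near : ∀ j ≤ c.length + 1, j ≤ i + 1 → i ≤ j + 1 → CoeffsIn L (m + 1) (genSeries c π j))
    (top : ∀ j ≤ c.length + 1, ∀ k, m + 1 - s ≤ k → k ≤ m → coeff k (genSeries c π j) ∈ L)
    (z) : π z ∈ L := by
  have hn : m + 1 - s + s = m + 1 := by omega
  have hi' := near i hi (by omega) (by omega)
  -- Multiplying two series of order at least s extends the control from m + 1 - s to m + 1
  -- coefficients; the later division by x_i gives these s coefficients back. Hence exactly the last
  -- s coefficients remain as extra data.
  have key (j n : ℕ) (h1 : 1 ≤ n) (hn' : j + n ≤ c.length)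
      (ih : ∀ k, j < k → k ≤ j + n → CoeffsIn L (m + 1 - s) (genSeries c π k)) :
      CoeffsIn L (m + 1) (genSeries c π j * genSeries c π (j + n + 1)) := by
    refine CoeffsIn.congr (genSeries_mul H π j n hn').symm ?_
    have h2 : CoeffsIn L (m + 1 - s + s)
        (genSeries c π (j + 1) * genSeries c π (j + n)) :=
      (ih _ (by omega) (by omega)).mul_of_dvd (ih _ (by omega) (by omega))
        (hord _ (by omega)) (hord _ (by omega))
    rw [← hn]
    refine h2.mul_of_dvd' (CoeffsIn.prod fun k hk => ?_) ((hord _ (by omega)).mul_right _)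
    have := Finset.mem_range.1 hk
    exact (ih _ (by omega) (by omega)).pow _
  have hlow : ∀ j ≤ c.length + 1, CoeffsIn L (m + 1 - s) (genSeries c π j) := by
    refine generator_induction hi (fun j hj h1 h2 => (near j hj h1 h2).mono (by omega))
      (fun n h1 hn' ih => ?_) (fun j n h1 hn' ih => ?_)
    · refine CoeffsIn.of_mul (f := genSeries c π i) (s := s) ?_ ?_ (hord i hi) hcancel
      · rwa [hn]
      · rw [hn]; exact key i n h1 hn' ih
    · refine CoeffsIn.of_mul (f := genSeries c π i) (s := s) ?_ ?_ (hord i hi) hcancel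
      · rwa [hn]
      · rw [hn, mul_comm]; subst hn'; exact key j n h1 (by omega) ih
  refine mem_of_coeffsIn_genSeries H π (fun j hj k hk => ?_) z
  rcases lt_or_ge k (m + 1 - s) with h | h
  · exact hlow j hj k h
  · exact top j hj k h (by omega)

end Generators

end ToricJets

namespace ToricJets

open PowerSeries

/-! ### Construction of jets with prescribed coefficients. -/

section Splice

variable {R : Type*} [CommRing R]

/-- The series with the first `n` coefficients of `f` and the other coefficients of `g`. -/
noncomputable def splice (n : ℕ) (f g : R⟦X⟧) : R⟦X⟧ :=
  PowerSeries.mk fun k => if k < n then coeff k f else coeff k g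

theorem coeff_splice_of_lt {n k : ℕ} (h : k < n) (f g : R⟦X⟧) :
    coeff k (splice n f g) = coeff k f := by
  rw [splice, coeff_mk, if_pos h]

theorem coeff_splice_of_le {n k : ℕ} (h : n ≤ k) (f g : R⟦X⟧) :
    coeff k (splice n f g) = coeff k g := by
  rw [splice, coeff_mk, if_neg (by omega)]

theorem X_pow_dvd_splice_sub (n : ℕ) (f g : R⟦X⟧) : X ^ n ∣ splice n f g - f := by
  rw [X_pow_dvd_iff]
  intro k hk
  rw [map_sub, coeff_splice_of_lt hk, sub_self]

/-- An error of order m + 1 - s disappears in any product with a factor of order s. So the values at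
irreducible elements may be changed from the index m + 1 - s on. -/
theorem truncMk_perturb {S : Type*} [AddCommMonoid S] {m s : ℕ} (hs : s ≤ m + 1)
    {φ φ' : S → R⟦X⟧} (h0 : truncMk m (φ 0) = 1)
    (hadd : ∀ v w, truncMk m (φ (v + w)) = truncMk m (φ v * φ w)) (h0' : φ' 0 = φ 0)
    (hadd' : ∀ v w, v ≠ 0 → w ≠ 0 → φ' (v + w) = φ (v + w))
    (hφ : ∀ w ≠ 0, X ^ s ∣ φ w) (hφ' : ∀ w ≠ 0, X ^ s ∣ φ' w)
    (hsub : ∀ w, X ^ (m + 1 - s) ∣ φ' w - φ w) (v w : S) :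
    truncMk m (φ' (v + w)) = truncMk m (φ' v * φ' w) := by
  by_cases hv : v = 0
  · subst hv; rw [zero_add, map_mul, h0', h0, one_mul]
  by_cases hw : w = 0
  · subst hw; rw [add_zero, map_mul, h0', h0, mul_one]
  rw [hadd' v w hv hw, hadd]
  symm
  rw [truncMk_eq_iff_dvd, show φ' v * φ' w - φ v * φ w =
    (φ' v - φ v) * φ' w + φ v * (φ' w - φ w) by ring]
  rw [show m + 1 = m + 1 - s + s by omega]
  refine dvd_add ?_ ?_
  · rw [pow_add]; exact mul_dvd_mul (hsub v) (hφ' w hw)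
  · rw [add_comm, pow_add]; exact mul_dvd_mul (hφ v hv) (hsub w)

end Splice

section Wedge

variable {R : Type*} [CommRing R] {S : Type*} [AddCommMonoid S]

/-- The map `w ↦ X^(α w) Y^(b w)` where `b ≥ 0`, and `w ↦ X^(α' w) Z^(-b w)` where `b < 0`. -/
noncomputable def wedge (b α α' : S →+ ℤ) (x y z : R⟦X⟧) (w : S) : R⟦X⟧ :=
  if 0 ≤ b w then x ^ (α w).toNat * y ^ (b w).toNat else x ^ (α' w).toNat * z ^ (-b w).toNat

variable {b α α' : S →+ ℤ} {x y z : R⟦X⟧}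

theorem wedge_of_nonneg {w : S} (h : 0 ≤ b w) :
    wedge b α α' x y z w = x ^ (α w).toNat * y ^ (b w).toNat := if_pos h

theorem wedge_of_nonpos {κ : ℕ} (hα : ∀ w, α' w = α w + κ * b w) {w : S} (h : b w ≤ 0) :
    wedge b α α' x y z w = x ^ (α' w).toNat * z ^ (-b w).toNat := by
  rcases h.lt_or_eq with h | h
  · exact if_neg (by omega)
  · rw [wedge_of_nonneg h.ge, hα, h]; simp

theorem wedge_zero : wedge b α α' x y z 0 = 1 := by
  rw [wedge_of_nonneg (by simp)]; simp

/-- On either side of the line b = 0 the map is visibly multiplicative. In the mixed case factors of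
Y cancel against factors of Z by the relation Y Z = X^κ, and `hα` matches the resulting exponents of
X. -/
theorem truncMk_wedge_add {m κ : ℕ} (hα : ∀ w, α' w = α w + κ * b w)
    (hpos : ∀ w, 0 ≤ b w → 0 ≤ α w) (hneg : ∀ w, b w ≤ 0 → 0 ≤ α' w)
    (hrel : ∀ v w, 0 < b v → b w < 0 → truncMk m (x ^ (α v + α' w).toNat * (y * z)) =
      truncMk m (x ^ (α v + α' w).toNat * x ^ κ)) (v w : S) :
    truncMk m (wedge b α α' x y z (v + w)) =
      truncMk m (wedge b α α' x y z v * wedge b α α' x y z w) := by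
  have mixed : ∀ v w, 0 < b v → b w < 0 → truncMk m (wedge b α α' x y z (v + w)) =
      truncMk m (wedge b α α' x y z v * wedge b α α' x y z w) := by
    intro v w hv hw
    have hr := hrel v w hv hw
    obtain ⟨β, hβ⟩ := Int.eq_ofNat_of_zero_le hv.le
    obtain ⟨γ, hγ⟩ := Int.eq_ofNat_of_zero_le (show 0 ≤ -b w by omega)
    obtain ⟨A, hA⟩ := Int.eq_ofNat_of_zero_le (hpos v hv.le)
    obtain ⟨B, hB⟩ := Int.eq_ofNat_of_zero_le (hneg w hw.le)
    -- The relation is only available after multiplication by x^(A+B), so this factor is kept while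
    -- the relation is applied k times.
    have hr' (k : ℕ) : truncMk m (x ^ (A + B) * (y * z) ^ k) =
        truncMk m (x ^ (A + B) * (x ^ κ) ^ k) := by
      rw [hA, hB, show ((A : ℤ) + B).toNat = A + B by omega] at hr
      induction k with
      | zero => simp
      | succ k ih =>
        calc _ = truncMk m (x ^ (A + B) * (y * z) ^ k) * truncMk m (y * z) := by
              rw [← map_mul]; ring_nf
          _ = truncMk m (x ^ (A + B) * (y * z)) * truncMk m ((x ^ κ) ^ k) := by
              rw [ih, ← map_mul, ← map_mul]; ring_nf
          _ = _ := by rw [hr, ← map_mul]; ring_nf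
    rw [wedge_of_nonneg hv.le, wedge_of_nonpos hα hw.le, hA, hB, hβ, hγ]
    simp only [Int.toNat_natCast]
    rcases le_total γ β with h | h
    · have e : α (v + w) = (A + B + κ * γ : ℕ) := by
        have := hα w
        rw [map_add, hA]; push_cast
        rw [← hB, ← hγ, this]; ring
      have e' : b (v + w) = (β - γ : ℕ) := by rw [map_add]; omega
      rw [wedge_of_nonneg (by rw [e']; positivity), e, e']
      simp only [Int.toNat_natCast]
      calc _ = truncMk m (x ^ (A + B) * (x ^ κ) ^ γ) * truncMk m (y ^ (β - γ)) := by
            rw [← map_mul, pow_add x, pow_mul x]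
        _ = truncMk m (x ^ (A + B) * (y * z) ^ γ) * truncMk m (y ^ (β - γ)) := by rw [hr']
        _ = _ := by
            rw [← map_mul]
            congr 1
            calc _ = x ^ A * (y ^ γ * y ^ (β - γ)) * (x ^ B * z ^ γ) := by ring
              _ = _ := by rw [← pow_add, Nat.add_sub_cancel' h]
    · have e : α' (v + w) = (A + B + κ * β : ℕ) := by
        have := hα v
        rw [map_add, hB, this, hA, hβ]; push_cast; ring
      have e' : -b (v + w) = (γ - β : ℕ) := by rw [map_add]; omega
      rw [wedge_of_nonpos hα (by omega), e, e']
      simp only [Int.toNat_natCast]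
      calc _ = truncMk m (x ^ (A + B) * (x ^ κ) ^ β) * truncMk m (z ^ (γ - β)) := by
            rw [← map_mul, pow_add x, pow_mul x]
        _ = truncMk m (x ^ (A + B) * (y * z) ^ β) * truncMk m (z ^ (γ - β)) := by rw [hr']
        _ = _ := by
            rw [← map_mul]
            congr 1
            calc _ = x ^ A * y ^ β * (x ^ B * (z ^ β * z ^ (γ - β))) := by ring
              _ = _ := by rw [← pow_add z, Nat.add_sub_cancel' h]
  rcases le_or_gt 0 (b v) with hv | hv <;> rcases le_or_gt 0 (b w) with hw | hw
  · have := hpos v hv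
    have := hpos w hw
    rw [wedge_of_nonneg hv, wedge_of_nonneg hw, wedge_of_nonneg (by rw [map_add]; omega), map_add,
      map_add, Int.toNat_add (by omega) (by omega), Int.toNat_add (by omega) (by omega)]
    congr 1; ring
  · rcases hv.eq_or_lt with h | h
    · have := hneg v h.ge
      have := hneg w hw.le
      rw [wedge_of_nonpos hα h.ge, wedge_of_nonpos hα hw.le,
        wedge_of_nonpos hα (by rw [map_add]; omega), map_add, map_add, neg_add,
        Int.toNat_add (by omega) (by omega), Int.toNat_add (by omega) (by omega)]
      congr 1; ring
    · exact mixed v w h hw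
  · rcases hw.eq_or_lt with h | h
    · have := hneg v hv.le
      have := hneg w h.ge
      rw [wedge_of_nonpos hα h.ge, wedge_of_nonpos hα hv.le,
        wedge_of_nonpos hα (by rw [map_add]; omega), map_add, map_add, neg_add,
        Int.toNat_add (by omega) (by omega), Int.toNat_add (by omega) (by omega)]
      congr 1; ring
    · rw [add_comm v w, mul_comm]; exact mixed w v h hv
  · have := hneg v hv.le
    have := hneg w hw.le
    rw [wedge_of_nonpos hα hv.le, wedge_of_nonpos hα hw.le,
      wedge_of_nonpos hα (by rw [map_add]; omega), map_add, map_add, neg_add,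
      Int.toNat_add (by omega) (by omega), Int.toNat_add (by omega) (by omega)]
    congr 1; ring

end Wedge

section Existence

variable {K : Type*} [Field K] {p q : ℕ} {R : Type*} [CommRing R] [Algebra K R]
  {c : List ℕ} (H : HJData p q c)

/-- The restriction of `hjDet` to the semigroup. -/
def semiDet (p q : ℕ) (c : List ℕ) (k : ℕ) : dualSemigroup p q →+ ℤ :=
  (hjDet c k).comp (dualSemigroup p q).subtype

/-- The restriction of `hjDeg` to the semigroup. -/
def semiDeg (p q : ℕ) (c : List ℕ) (k : ℕ) : dualSemigroup p q →+ ℤ :=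
  (hjDeg c k).comp (dualSemigroup p q).subtype

include H

theorem semiDet_hjGen (k : ℕ) {j : ℕ} (hj : j ≤ c.length + 1) :
    semiDet p q c k (hjGen p q c j) = hjDet c k (hjVec c j) := by
  change hjDet c k (hjGen p q c j : ℤ × ℤ) = _; rw [H.coe_hjGen hj]

theorem semiDeg_hjGen (k : ℕ) {j : ℕ} (hj : j ≤ c.length + 1) :
    semiDeg p q c k (hjGen p q c j) = hjDeg c k (hjVec c j) := by
  change hjDeg c k (hjGen p q c j : ℤ × ℤ) = _; rw [H.coe_hjGen hj]

theorem one_le_semiDeg (k : ℕ) {w : dualSemigroup p q} (hw : w ≠ 0) : 1 ≤ semiDeg p q c k w :=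
  H.one_le_hjDeg w.2 (by simpa using hw) k

theorem semiDeg_nonneg (k : ℕ) (w : dualSemigroup p q) : 0 ≤ semiDeg p q c k w := by
  by_cases hw : w = 0
  · subst hw; rw [map_zero]
  · have := one_le_semiDeg H k hw; omega

theorem semiDeg_eq (k : ℕ) (w : dualSemigroup p q) : semiDeg p q c k w =
    semiDeg p q c (k + 1) w + ((hjCoeff c k - 2 : ℕ) : ℤ) * semiDet p q c (k + 1) w := by
  have := hjDeg_eq (c := c) k w
  rw [Nat.cast_sub (two_le_hjCoeff H.two_le k)]
  exact this

/-- The wedge map around u_(j+1), with exponents given by the degrees of the two adjacent edges,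
sends the generators j, j + 1, j + 2 to x z, x, x y. The condition on y z is only needed modulo
X^(m+1-2s): in a mixed product both factors have degree at least 1, so x^2 is present. Finally the
last s coefficients of the remaining generators are adjusted to those of g. -/
theorem exists_jet {m s j : ℕ} (hj : j < c.length) (hs : 2 * s ≤ m + 1) {x y z : R⟦X⟧}
    (hx : X ^ s ∣ x) (hyz : X ^ (m + 1 - 2 * s) ∣ y * z - x ^ (hjCoeff c j - 2))
    (g : ℕ → R⟦X⟧) :
    ∃ π : JetAlgebra K (CoordRing K p q) m →ₐ[K] R,
      truncMk m (genSeries c π (j + 1)) = truncMk m x ∧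
      truncMk m (genSeries c π (j + 2)) = truncMk m (x * y) ∧
      truncMk m (genSeries c π j) = truncMk m (x * z) ∧
      (∀ k ≤ c.length + 1, X ^ s ∣ genSeries c π k) ∧
      ∀ k ≤ c.length + 1, k ≠ j → k ≠ j + 1 → k ≠ j + 2 →
        ∀ n, m + 1 - s ≤ n → n ≤ m → coeff n (genSeries c π k) = coeff n (g k) := by
  classical
  set φ := wedge (semiDet p q c (j + 1)) (semiDeg p q c (j + 1)) (semiDeg p q c j) x y z with hφ
  have h0 : truncMk m (φ 0) = 1 := by rw [hφ, wedge_zero, map_one]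
  have hadd : ∀ v w, truncMk m (φ (v + w)) = truncMk m (φ v * φ w) := by
    refine truncMk_wedge_add (κ := hjCoeff c j - 2) (semiDeg_eq H j)
      (fun w _ => semiDeg_nonneg H _ w) (fun w _ => semiDeg_nonneg H _ w) fun v w hv hw => ?_
    have hv0 : v ≠ 0 := by rintro rfl; simp at hv
    have hw0 : w ≠ 0 := by rintro rfl; simp at hw
    have h1 := one_le_semiDeg H (j + 1) hv0
    have h2 := one_le_semiDeg H j hw0
    rw [truncMk_eq_iff_dvd, ← mul_sub]
    rw [show m + 1 = 2 * s + (m + 1 - 2 * s) by omega, pow_add]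
    refine mul_dvd_mul ?_ hyz
    rw [mul_comm 2 s, pow_mul]
    exact (pow_dvd_pow_of_dvd hx 2).trans (pow_dvd_pow _ (by omega))
  have hdvd : ∀ w ≠ 0, X ^ s ∣ φ w := by
    intro w hw
    have h1 := one_le_semiDeg H (j + 1) hw
    have h2 := one_le_semiDeg H j hw
    have hpow (n : ℕ) (hn : 1 ≤ n) (f : R⟦X⟧) : X ^ s ∣ x ^ n * f :=
      (hx.trans (dvd_pow_self x (by omega))).mul_right f
    rw [hφ, wedge]
    split_ifs
    · exact hpow _ (by omega) _
    · exact hpow _ (by omega) _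
  set P : dualSemigroup p q → ℕ → Prop := fun w k =>
    k ≤ c.length + 1 ∧ k ≠ j ∧ k ≠ j + 1 ∧ k ≠ j + 2 ∧ w = hjGen p q c k with hP
  -- Only generators are altered. They are no sums of two nonzero elements, as `truncMk_perturb`
  -- requires.
  set φ' : dualSemigroup p q → R⟦X⟧ := fun w =>
    if h : ∃ k, P w k then splice (m + 1 - s) (φ w) (g h.choose) else φ w with hφ'
  have hsub : ∀ w, X ^ (m + 1 - s) ∣ φ' w - φ w := by
    intro w
    simp only [hφ']
    split_ifs
    · exact X_pow_dvd_splice_sub _ _ _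
    · rw [sub_self]; exact dvd_zero _
  have hdvd' : ∀ w ≠ 0, X ^ s ∣ φ' w := by
    intro w hw
    have := dvd_add ((pow_dvd_pow X (show s ≤ m + 1 - s by omega)).trans (hsub w)) (hdvd w hw)
    rwa [sub_add_cancel] at this
  have h0' : φ' 0 = φ 0 := by
    refine dif_neg ?_
    rintro ⟨k, hk, -, -, -, h⟩
    exact H.hjGen_ne_zero hk h.symm
  have hnew : ∀ w, (¬ ∃ k, P w k) → φ' w = φ w := fun w hw => dif_neg hw
  have hadd' := truncMk_perturb (s := s) (by omega) h0 hadd h0' (fun v w hv hw => hnew _ (by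
    rintro ⟨k, hk, -, -, -, h⟩
    exact H.hjGen_ne_add hk hv hw h.symm)) hdvd hdvd' hsub
  have hnear : ∀ k ≤ c.length + 1, (k = j ∨ k = j + 1 ∨ k = j + 2) →
      φ' (hjGen p q c k) = φ (hjGen p q c k) := by
    intro k hk h
    refine hnew _ ?_
    rintro ⟨k', hk', h1, h2, h3, h4⟩
    have := H.hjGen_injOn hk hk' h4
    omega
  have hgen : ∀ w, truncMk m (monSeries (jetLift (monomialJet (K := K) φ' (by rw [h0', h0]) hadd')) w) =
      truncMk m (φ' w) := by
    intro w
    rw [← jetHom_apply, jetHom_jetLift, monomialJet_single]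
  refine ⟨jetLift (monomialJet φ' (by rw [h0', h0]) hadd'), ?_, ?_, ?_, ?_, ?_⟩
  · rw [hgen, hnear _ (by omega) (by omega), hφ, wedge_of_nonneg, semiDeg_hjGen H _ (by omega),
      semiDet_hjGen H _ (by omega), hjDet_self, hjDeg_self]
    · simp
    · rw [semiDet_hjGen H _ (by omega), hjDet_self]
  · rw [hgen, hnear _ (by omega) (by omega), hφ, wedge_of_nonneg, semiDeg_hjGen H _ (by omega),
      semiDet_hjGen H _ (by omega), hjDet_succ, hjDeg_succ]
    · simp
    · rw [semiDet_hjGen H _ (by omega), hjDet_succ]; norm_num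
  · rw [hgen, hnear _ (by omega) (by omega), hφ, wedge_of_nonpos (semiDeg_eq H j),
      semiDeg_hjGen H _ (by omega), semiDet_hjGen H _ (by omega), hjDet_succ', hjDeg_self]
    · simp
    · rw [semiDet_hjGen H _ (by omega), hjDet_succ']; norm_num
  · intro k hk
    exact X_pow_dvd_of_truncMk_eq (hgen _).symm (by omega) (hdvd' _ (H.hjGen_ne_zero hk))
  · intro k hk h1 h2 h3 n hn hn'
    have hex : ∃ k', P (hjGen p q c k) k' := ⟨k, hk, h1, h2, h3, rfl⟩
    have hk' : hex.choose = k :=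
      (H.hjGen_injOn hk hex.choose_spec.1 hex.choose_spec.2.2.2.2).symm
    rw [truncMk_eq_iff.1 (hgen _) n hn']
    simp only [hφ']
    rw [dif_pos hex, coeff_splice_of_le hn, hk']

/-- The jets of a hypersurface `x_1 x_3 = x_2^c`. -/
theorem exists_jet_of_length_eq_one {m : ℕ} (hr : c.length = 1) {x y z : R⟦X⟧}
    (h : truncMk m (y * z) = truncMk m (x ^ hjCoeff c 0)) :
    ∃ π : JetAlgebra K (CoordRing K p q) m →ₐ[K] R,
      truncMk m (genSeries c π 1) = truncMk m x ∧ truncMk m (genSeries c π 2) = truncMk m y ∧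
      truncMk m (genSeries c π 0) = truncMk m z := by
  have hα : ∀ w, semiDet p q c 0 w = (-semiDet p q c 2) w +
      ((hjCoeff c 0 : ℕ) : ℤ) * semiDet p q c 1 w := by
    intro w
    have : semiDet p q c 2 w = hjCoeff c 0 * semiDet p q c 1 w - semiDet p q c 0 w :=
      hjDet_add_two 0 w
    rw [AddMonoidHom.neg_apply, this]; ring
  have hmem (w : dualSemigroup p q) : 0 ≤ semiDet p q c 0 w ∧ semiDet p q c 2 w ≤ 0 := by
    have := H.mem_dualSemigroup.1 w.2
    rw [hr] at this
    exact this
  have hadd := truncMk_wedge_add (m := m) (x := x) (y := y) (z := z) hα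
    (fun w _ => by rw [AddMonoidHom.neg_apply]; have := (hmem w).2; omega)
    (fun w _ => (hmem w).1) (fun v w _ _ => by rw [map_mul, h, ← map_mul])
  have h0 : truncMk m (wedge (semiDet p q c 1) (-semiDet p q c 2) (semiDet p q c 0) x y z 0) = 1 := by
    rw [wedge_zero, map_one]
  have h2 : hjDet c 0 (hjVec c 0) = 0 := hjDet_self 0
  refine ⟨jetLift (monomialJet _ h0 hadd), ?_, ?_, ?_⟩
  · rw [← jetHom_apply, jetHom_jetLift, monomialJet_single, wedge_of_nonneg,
      AddMonoidHom.neg_apply, semiDet_hjGen H _ (by omega), semiDet_hjGen H _ (by omega),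
      hjDet_self, hjDet_succ']
    · simp
    · rw [semiDet_hjGen H _ (by omega), hjDet_self]
  · rw [← jetHom_apply, jetHom_jetLift, monomialJet_single, wedge_of_nonneg,
      AddMonoidHom.neg_apply, semiDet_hjGen H _ (by omega), semiDet_hjGen H _ (by omega),
      hjDet_self, hjDet_succ]
    · simp
    · rw [semiDet_hjGen H _ (by omega), hjDet_succ]; norm_num
  · rw [← jetHom_apply, jetHom_jetLift, monomialJet_single, wedge_of_nonpos hα,
      semiDet_hjGen H _ (by omega), semiDet_hjGen H _ (by omega), hjDet_self, hjDet_succ']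
    · simp
    · rw [semiDet_hjGen H _ (by omega), hjDet_succ']; norm_num

end Existence

end ToricJets

namespace ToricJets

open PowerSeries

/-! ### Points as kernels of homomorphisms to domains. -/

section Points

variable {K : Type*} [Field K] {m : ℕ} {A : Type*} [CommRing A] [Algebra K A]
  {R : Type*} [CommRing R] [Algebra K R]

/-- The point of the jet scheme given by a homomorphism to a domain. -/
noncomputable def kerPoint [IsDomain R] (π : JetAlgebra K A m →ₐ[K] R) : JetScheme K A m :=
  ⟨RingHom.ker π, RingHom.ker_isPrime _⟩

/-- The coordinate ring of the closure of a point of the jet scheme. -/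
def ResRing (P : JetScheme K A m) : Type _ := JetAlgebra K A m ⧸ P.asIdeal

noncomputable instance (P : JetScheme K A m) : CommRing (ResRing P) :=
  inferInstanceAs (CommRing (JetAlgebra K A m ⧸ P.asIdeal))

noncomputable instance (P : JetScheme K A m) : Algebra K (ResRing P) :=
  inferInstanceAs (Algebra K (JetAlgebra K A m ⧸ P.asIdeal))

instance (P : JetScheme K A m) : IsDomain (ResRing P) :=
  inferInstanceAs (IsDomain (JetAlgebra K A m ⧸ P.asIdeal))

/-- The residue homomorphism at a point of the jet scheme. -/
noncomputable def resHom (P : JetScheme K A m) : JetAlgebra K A m →ₐ[K] ResRing P :=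
  Ideal.Quotient.mkₐ K P.asIdeal

theorem resHom_surjective (P : JetScheme K A m) : Function.Surjective (resHom P) :=
  Ideal.Quotient.mk_surjective

theorem asIdeal_eq_ker_resHom (P : JetScheme K A m) : P.asIdeal = RingHom.ker (resHom P) :=
  (Ideal.Quotient.mkₐ_ker K P.asIdeal).symm

theorem resHom_eq_zero_iff {P : JetScheme K A m} {z : JetAlgebra K A m} :
    resHom P z = 0 ↔ z ∈ P.asIdeal := Ideal.Quotient.eq_zero_iff_mem

/-- The homomorphism to the residue field at a point of the jet scheme. -/
noncomputable def fracHom (P : JetScheme K A m) :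
    JetAlgebra K A m →ₐ[K] FractionRing (ResRing P) :=
  (IsScalarTower.toAlgHom K (ResRing P)
    (FractionRing (ResRing P))).comp (resHom P)

theorem asIdeal_eq_ker_fracHom (P : JetScheme K A m) :
    P.asIdeal = RingHom.ker (fracHom P) := by
  refine (asIdeal_eq_ker_resHom P).trans ?_
  ext z
  rw [RingHom.mem_ker, RingHom.mem_ker]
  exact (map_eq_zero_iff _ (IsFractionRing.injective (ResRing P)
    (FractionRing (ResRing P)))).symm

theorem jetCoeff_mem_iff {P : JetScheme K A m} {π : JetAlgebra K A m →ₐ[K] R}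
    (h : P.asIdeal = RingHom.ker π) (k : Fin (m + 1)) (a : A) :
    jetCoeff K m k a ∈ P.asIdeal ↔ coeff (k : ℕ) (jetSeries π a) = 0 := by
  rw [h, RingHom.mem_ker, coeff_jetSeries]

theorem mem_contact_iff {P : JetScheme K A m} {π : JetAlgebra K A m →ₐ[K] R}
    (h : P.asIdeal = RingHom.ker π) {d : ℕ} {a : A} : P ∈ contact K m d a ↔
      X ^ d ∣ jetSeries π a ∧ coeff d (jetSeries π a) ≠ 0 := by
  have hbig {k : ℕ} (hk : ¬ k < m + 1) : coeff k (jetSeries π a) = 0 := by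
    rw [jetSeries, coeff_mk, dif_neg hk]
  constructor
  · rintro ⟨h1, k, rfl, h2⟩
    rw [jetCoeff_mem_iff h] at h2
    refine ⟨X_pow_dvd_iff.2 fun n hn => ?_, h2⟩
    have := h1 ⟨n, by omega⟩ hn
    rwa [jetCoeff_mem_iff h] at this
  · rintro ⟨h1, h2⟩
    have hd : d < m + 1 := by by_contra hd; exact h2 (hbig hd)
    refine ⟨fun k hk => ?_, ⟨d, hd⟩, rfl, ?_⟩
    · rw [jetCoeff_mem_iff h]; exact X_pow_dvd_iff.1 h1 k hk
    · rwa [jetCoeff_mem_iff h]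

theorem coeff_jetSeries_comp {R' : Type*} [CommRing R'] [Algebra K R'] (f : R →ₐ[K] R')
    (π : JetAlgebra K A m →ₐ[K] R) (a : A) (n : ℕ) :
    coeff n (jetSeries (f.comp π) a) = f (coeff n (jetSeries π a)) := by
  simp only [jetSeries, coeff_mk]
  split_ifs
  · rfl
  · rw [map_zero]

theorem coeff_jetSeries_prod {R' : Type*} [CommRing R'] [Algebra K R']
    (π : JetAlgebra K A m →ₐ[K] R) (π' : JetAlgebra K A m →ₐ[K] R') (a : A) (n : ℕ) :
    coeff n (jetSeries (π.prod π') a) = (coeff n (jetSeries π a), coeff n (jetSeries π' a)) := by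
  simp only [jetSeries, coeff_mk]
  split_ifs
  · rfl
  · rfl

theorem X_pow_dvd_jetSeries_comp {R' : Type*} [CommRing R'] [Algebra K R'] (f : R →ₐ[K] R')
    (π : JetAlgebra K A m →ₐ[K] R) (a : A) {n : ℕ} (h : X ^ n ∣ jetSeries π a) :
    X ^ n ∣ jetSeries (f.comp π) a := by
  rw [X_pow_dvd_iff] at h ⊢
  intro k hk
  rw [coeff_jetSeries_comp, h k hk, map_zero]

theorem X_pow_dvd_jetSeries_prod {R' : Type*} [CommRing R'] [Algebra K R']
    {π : JetAlgebra K A m →ₐ[K] R} {π' : JetAlgebra K A m →ₐ[K] R'} {a : A} {n : ℕ}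
    (h : X ^ n ∣ jetSeries π a) (h' : X ^ n ∣ jetSeries π' a) :
    X ^ n ∣ jetSeries (π.prod π') a := by
  rw [X_pow_dvd_iff] at h h' ⊢
  intro k hk
  rw [coeff_jetSeries_prod, h k hk, h' k hk]; rfl

end Points

/-! ### Jets centred at the singular point. -/

section CentralFiber

variable {K : Type*} [Field K] {p q m : ℕ}

theorem exists_sub_algebraMap_mem_originIdeal (a : CoordRing K p q) :
    ∃ r : K, a - algebraMap K _ r ∈ originIdeal K p q := by
  induction a using AddMonoidAlgebra.induction_linear with
  | zero => exact ⟨0, by rw [map_zero, sub_zero]; exact zero_mem _⟩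
  | add a b ha hb =>
    obtain ⟨r, hr⟩ := ha
    obtain ⟨t, ht⟩ := hb
    refine ⟨r + t, ?_⟩
    rw [map_add, add_sub_add_comm]
    exact add_mem hr ht
  | single w r =>
    by_cases hw : w = 0
    · subst hw
      refine ⟨r, ?_⟩
      have : algebraMap K (CoordRing K p q) r = AddMonoidAlgebra.single 0 r := rfl
      rw [this, sub_self]; exact zero_mem _
    · refine ⟨0, ?_⟩
      have : (AddMonoidAlgebra.single w r : CoordRing K p q) =
          r • AddMonoidAlgebra.single w 1 := by simp
      rw [map_zero, sub_zero, this]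
      exact Submodule.smul_of_tower_mem _ r (Ideal.subset_span ⟨w, hw, rfl⟩)

/-- Every function is a constant modulo `originIdeal`, and a proper ideal contains no nonzero
constant. -/
theorem eq_originIdeal_of_le {I : Ideal (CoordRing K p q)} (hI : I ≠ ⊤)
    (hle : originIdeal K p q ≤ I) : I = originIdeal K p q := by
  refine le_antisymm (fun a ha => ?_) hle
  obtain ⟨r, hr⟩ := exists_sub_algebraMap_mem_originIdeal a
  have h1 : algebraMap K (CoordRing K p q) r ∈ I := by
    have := sub_mem ha (hle hr)
    rwa [sub_sub_cancel] at this
  have h2 : r = 0 := by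
    by_contra h0
    exact hI (Ideal.eq_top_of_isUnit_mem _ h1 ((IsUnit.mk0 r h0).map _))
  rwa [h2, map_zero, sub_zero] at hr

theorem mem_centralFiber_iff_monomials {P : JetScheme K (CoordRing K p q) m} :
    P ∈ centralFiber K p q m ↔ ∀ w : dualSemigroup p q, w ≠ 0 →
      jetCoeff K m 0 (AddMonoidAlgebra.single w 1 : CoordRing K p q) ∈ P.asIdeal := by
  have hiff : P ∈ centralFiber K p q m ↔
      (PrimeSpectrum.comap (jetBase K (CoordRing K p q) m) P).asIdeal = originIdeal K p q := Iff.rfl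
  rw [hiff]
  constructor
  · intro h w hw
    have : (AddMonoidAlgebra.single w 1 : CoordRing K p q) ∈
        (PrimeSpectrum.comap (jetBase K (CoordRing K p q) m) P).asIdeal := by
      rw [h]; exact Ideal.subset_span ⟨w, hw, rfl⟩
    exact this
  · intro h
    refine eq_originIdeal_of_le (Ideal.IsPrime.ne_top inferInstance) (Ideal.span_le.2 ?_)
    rintro _ ⟨w, hw, rfl⟩
    exact h w hw

theorem mem_centralFiber_iff {c : List ℕ} (H : HJData p q c) {R : Type*} [CommRing R]
    [Algebra K R] {P : JetScheme K (CoordRing K p q) m}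
    {π : JetAlgebra K (CoordRing K p q) m →ₐ[K] R} (h : P.asIdeal = RingHom.ker π) :
    P ∈ centralFiber K p q m ↔ ∀ k ≤ c.length + 1, X ∣ genSeries c π k := by
  have key (a : CoordRing K p q) : jetCoeff K m 0 a ∈ P.asIdeal ↔ X ∣ jetSeries π a := by
    rw [jetCoeff_mem_iff h, X_dvd_iff, ← coeff_zero_eq_constantCoeff_apply]; rfl
  rw [mem_centralFiber_iff_monomials]
  constructor
  · intro h k hk
    exact (key _).1 (h _ (H.hjGen_ne_zero hk))
  · intro hk w
    refine H.hjGen_induction (P := fun w => w ≠ 0 → jetCoeff K m 0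
      (AddMonoidAlgebra.single w 1 : CoordRing K p q) ∈ P.asIdeal) (fun h => absurd rfl h)
      (fun k h1 _ => (key _).2 (hk k h1)) (fun v w hv hw hne => ?_) w
    have hmul : jetCoeff K m 0 (AddMonoidAlgebra.single (v + w) 1 : CoordRing K p q) =
        jetCoeff K m 0 (AddMonoidAlgebra.single v 1) *
        jetCoeff K m 0 (AddMonoidAlgebra.single w 1) := by
      rw [single_add_one]; exact map_mul (jetBase K (CoordRing K p q) m) _ _
    rw [hmul]
    by_cases h0 : v = 0
    · exact Ideal.mul_mem_left _ _ (hw (by rintro rfl; simp [h0] at hne))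
    · exact Ideal.mul_mem_right _ _ (hv h0)

end CentralFiber

/-! ### Generic points of the contact loci. -/

section Generic

variable {K : Type*} [Field K] {p q m : ℕ} {c : List ℕ} (H : HJData p q c)

/-- The range of the parameters `s`, `l` of the sets `C_{i,m}^{s,l}`, `i = j + 2`. -/
structure ValidContact (c : List ℕ) (m j s l : ℕ) : Prop where
  lt : j < c.length
  one_le : 1 ≤ s
  two_mul_le : 2 * s ≤ m + 1
  le : s ≤ l
  le_mul : l ≤ (hjCoeff c j - 1) * s
  add_le : l + s ≤ m + 1

/-- The index of the first coefficient of the `k`-th generator which is free on the contact locus with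
the parameters `j`, `s`, `l`. -/
def freeStart (m j s l k : ℕ) : ℕ :=
  if k = j then m + 1 - l else if k = j + 1 then s else if k = j + 2 then l else m + 1 - s

include H

/-- With x_(j+1) = X^s u and x_(j+2) = X^l v for units u, v, the relation forces x_j = X^(c_j s - l)
u^(c_j) / v below the index m + 1 - l and leaves the rest free. The bounds s ≤ l ≤ (c_j - 1)s make
both neighbours divisible by x_(j+1), so that `exists_jet` applies. -/
theorem exists_generic_jet {R : Type*} [CommRing R] [Algebra K R] {j s l : ℕ}
    (V : ValidContact c m j s l) (a : ℕ → ℕ → R) (h1 : IsUnit (a (j + 1) s))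
    (h2 : IsUnit (a (j + 2) l)) :
    ∃ ψ : JetAlgebra K (CoordRing K p q) m →ₐ[K] R,
      (∀ k ≤ c.length + 1, X ^ s ∣ genSeries c ψ k) ∧ X ^ l ∣ genSeries c ψ (j + 2) ∧
      ∀ k ≤ c.length + 1, ∀ n, freeStart m j s l k ≤ n → n ≤ m →
        coeff n (genSeries c ψ k) = a k n := by
  obtain ⟨κ, hκ⟩ := Nat.exists_eq_add_of_le (two_le_hjCoeff H.two_le j)
  have hlt := V.lt
  have hs2 := V.two_mul_le
  have hsl := V.le
  have hadd := V.add_le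
  have hmul : l + s ≤ (2 + κ) * s := by
    have := V.le_mul
    rw [hκ, show 2 + κ - 1 = κ + 1 by omega] at this
    nlinarith
  have mkdvd (n : ℕ) (b : ℕ → R) : ∃ u : R⟦X⟧, X ^ n * u =
      PowerSeries.mk (fun k => if k < n then 0 else b k) ∧ constantCoeff u = b n := by
    have : X ^ n ∣ PowerSeries.mk (fun k => if k < n then 0 else b k) := by
      rw [X_pow_dvd_iff]
      intro k hk
      rw [coeff_mk, if_pos hk]
    obtain ⟨u, hu⟩ := this
    refine ⟨u, hu.symm, ?_⟩
    have h := coeff_X_pow_mul u n 0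
    rw [← hu, coeff_mk, zero_add, if_neg (lt_irrefl n)] at h
    rw [← coeff_zero_eq_constantCoeff_apply, ← h]
  obtain ⟨u, hu, hu0⟩ := mkdvd s (a (j + 1))
  obtain ⟨v, hv, hv0⟩ := mkdvd l (a (j + 2))
  obtain ⟨u', huu⟩ := (isUnit_iff_constantCoeff.2 (by rwa [hu0]) : IsUnit u).exists_right_inv
  obtain ⟨v', hvv⟩ := (isUnit_iff_constantCoeff.2 (by rwa [hv0]) : IsUnit v).exists_right_inv
  -- X^s z' is the quotient of x_(j+1)^(c_j) by x_(j+2), the forced value of x_j. From the index m +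
  -- 1 - l on it is overwritten by the free coefficients.
  set z' : R⟦X⟧ := X ^ ((2 + κ) * s - l - s) * u ^ (2 + κ) * v' with hz'
  obtain ⟨w, hw⟩ := X_pow_dvd_splice_sub (m + 1 - l) (X ^ s * z') (PowerSeries.mk (a j))
  have hxy : X ^ s * u * (X ^ (l - s) * v * u') = X ^ l * v := by
    calc _ = X ^ (s + (l - s)) * v * (u * u') := by rw [pow_add]; ring
      _ = _ := by rw [huu, Nat.add_sub_cancel' hsl, mul_one]
  have hxz : X ^ s * u * (u' * (z' + X ^ (m + 1 - l - s) * w)) =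
      splice (m + 1 - l) (X ^ s * z') (PowerSeries.mk (a j)) := by
    calc _ = u * u' * (X ^ s * z' + X ^ (s + (m + 1 - l - s)) * w) := by rw [pow_add]; ring
      _ = _ := by
        rw [huu, one_mul, show s + (m + 1 - l - s) = m + 1 - l by omega, ← hw]; ring
  obtain ⟨ψ, e1, e2, e3, e4, e5⟩ := exists_jet (K := K) (m := m) (s := s) H hlt hs2
    (x := X ^ s * u) (y := X ^ (l - s) * v * u') (z := u' * (z' + X ^ (m + 1 - l - s) * w))
    (dvd_mul_right _ _) (by
      rw [hκ, show 2 + κ - 2 = κ by omega]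
      -- Only the overwritten part violates y z = x^(c_j - 2), and its contribution to y z has order
      -- at least (l - s) + (m + 1 - l - s) = m + 1 - 2s.
      refine ⟨v * u' ^ 2 * w, ?_⟩
      have ea : X ^ (l - s) * v * u' * (u' * (z' + X ^ (m + 1 - l - s) * w)) =
          X ^ (l - s + ((2 + κ) * s - l - s)) * (u * u') ^ 2 * u ^ κ * (v * v') +
          X ^ (l - s + (m + 1 - l - s)) * (v * u' ^ 2 * w) := by
        rw [hz', pow_add, pow_add]; ring
      rw [ea, huu, hvv, show l - s + (m + 1 - l - s) = m + 1 - 2 * s by omega,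
        show l - s + ((2 + κ) * s - l - s) = s * κ by
          have : (2 + κ) * s = 2 * s + s * κ := by ring
          omega, mul_pow, pow_mul]
      ring) fun k => PowerSeries.mk (a k)
  rw [hxy, hv] at e2
  rw [hxz] at e3
  rw [hu] at e1
  refine ⟨ψ, e4, ?_, ?_⟩
  · refine X_pow_dvd_of_truncMk_eq e2.symm (by omega) ?_
    rw [← hv]; exact dvd_mul_right _ _
  · intro k hk n hn hn'
    unfold freeStart at hn
    split_ifs at hn with h1 h2 h3
    · subst h1
      rw [truncMk_eq_iff.1 e3 n hn', coeff_splice_of_le hn, coeff_mk]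
    · subst h2
      rw [truncMk_eq_iff.1 e1 n hn', coeff_mk, if_neg (by omega)]
    · subst h3
      rw [truncMk_eq_iff.1 e2 n hn', coeff_mk, if_neg (by omega)]
    · rw [e5 k hk h1 h2 h3 n hn hn', coeff_mk]

/-- On a contact locus with valid parameters, all generators have order at least `s`. -/
theorem X_pow_dvd_of_contact {R : Type*} [CommRing R] [IsDomain R] [Algebra K R] {j s l : ℕ}
    (V : ValidContact c m j s l) (π : JetAlgebra K (CoordRing K p q) m →ₐ[K] R)
    (h1 : X ^ s ∣ genSeries c π (j + 1)) (h1' : coeff s (genSeries c π (j + 1)) ≠ 0)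
    (h2 : X ^ l ∣ genSeries c π (j + 2)) (h2' : coeff l (genSeries c π (j + 2)) ≠ 0) :
    ∀ k ≤ c.length + 1, X ^ s ∣ genSeries c π k := by
  have hlt := V.lt
  have hs2 := V.two_mul_le
  have hsl := V.le
  have hadd := V.add_le
  have hc := two_le_hjCoeff H.two_le j
  have hmul : l + s ≤ s * hjCoeff c j := by
    have := V.le_mul
    obtain ⟨κ, hκ⟩ := Nat.exists_eq_add_of_le hc
    rw [hκ, show 2 + κ - 1 = κ + 1 by omega] at this
    rw [hκ]; nlinarith
  refine X_pow_dvd_genSeries H π (i := j + 1) (by omega) hs2 (fun k hk h3 h4 => ?_) h1'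
  have : k = j ∨ k = j + 1 ∨ k = j + 2 := by omega
  rcases this with rfl | rfl | rfl
  -- The power of x_(j+1) in the relation has order at least c_j s ≥ l + s; division by x_(j+2), of
  -- order l, leaves at least s.
  · refine X_pow_dvd_of_mul h2 h2' ?_
    rw [mul_comm]
    refine X_pow_dvd_of_truncMk_eq (genSeries_mul_two H π k hlt).symm hadd ?_
    refine (pow_dvd_pow X hmul).trans ?_
    rw [pow_mul]
    exact pow_dvd_pow_of_dvd h1 _
  · exact h1
  · exact (pow_dvd_pow X hsl).trans h2

/-- Two jets in the same contact locus coincide if their free coefficients coincide. -/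
theorem jet_unique {F : Type*} [Field F] [Algebra K F] {j s l : ℕ} (V : ValidContact c m j s l)
    {π π' : JetAlgebra K (CoordRing K p q) m →ₐ[K] F}
    (h1 : X ^ s ∣ genSeries c π (j + 1)) (h1' : coeff s (genSeries c π (j + 1)) ≠ 0)
    (h2 : X ^ l ∣ genSeries c π (j + 2)) (h2' : coeff l (genSeries c π (j + 2)) ≠ 0)
    (g1 : X ^ s ∣ genSeries c π' (j + 1)) (g2 : X ^ l ∣ genSeries c π' (j + 2))
    (h : ∀ k ≤ c.length + 1, ∀ n, freeStart m j s l k ≤ n → n ≤ m →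
      coeff n (genSeries c π k) = coeff n (genSeries c π' k)) : π = π' := by
  have hlt := V.lt
  have hs2 := V.two_mul_le
  have hsl := V.le
  have hadd := V.add_le
  have hs1' := V.one_le
  have f1 : freeStart m j s l (j + 1) = s := by simp [freeStart]
  have f2 : freeStart m j s l (j + 2) = l := by simp [freeStart]
  have f0 : freeStart m j s l j = m + 1 - l := by simp [freeStart]
  have hs1 := h (j + 1) (by omega) s f1.le (by omega)
  have hl1 := h (j + 2) (by omega) l f2.le (by omega)
  have hord := X_pow_dvd_of_contact H V π h1 h1' h2 h2'
  have hord' := X_pow_dvd_of_contact H V π' g1 (hs1 ▸ h1') g2 (hl1 ▸ h2')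
  -- The two jets form one jet over F × F, and they coincide if its values lie in the diagonal L.
  -- This reduces uniqueness to `mem_of_coeffsIn_near`.
  set L : Subalgebra K (F × F) := AlgHom.equalizer (AlgHom.fst K F F) (AlgHom.snd K F F) with hL
  have memL (x : F × F) : x ∈ L ↔ x.1 = x.2 := Iff.rfl
  have cL (k n : ℕ) (e : coeff n (genSeries c π k) = coeff n (genSeries c π' k)) :
      coeff n (genSeries c (π.prod π') k) ∈ L := by
    rw [memL, coeff_jetSeries_prod]; exact e
  have hcan (k d : ℕ) (e : coeff d (genSeries c π k) = coeff d (genSeries c π' k))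
      (hne : coeff d (genSeries c π k) ≠ 0) (x : F × F)
      (hx : coeff d (genSeries c (π.prod π') k) * x ∈ L) : x ∈ L := by
    rw [memL, coeff_jetSeries_prod, Prod.fst_mul, Prod.snd_mul, ← e] at hx
    exact mul_left_cancel₀ hne hx
  have n1 : CoeffsIn L (m + 1) (genSeries c (π.prod π') (j + 1)) := by
    intro n hn
    refine cL _ _ ?_
    rcases lt_or_ge n s with hns | hns
    · rw [X_pow_dvd_iff.1 h1 n hns, X_pow_dvd_iff.1 g1 n hns]
    · exact h _ (by omega) n (by omega) (by omega)
  have n2 : CoeffsIn L (m + 1) (genSeries c (π.prod π') (j + 2)) := by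
    intro n hn
    refine cL _ _ ?_
    rcases lt_or_ge n l with hns | hns
    · rw [X_pow_dvd_iff.1 h2 n hns, X_pow_dvd_iff.1 g2 n hns]
    · exact h _ (by omega) n (by omega) (by omega)
  have n0 : CoeffsIn L (m + 1) (genSeries c (π.prod π') j) := by
    have hlow : CoeffsIn L (m + 1 - l) (genSeries c (π.prod π') j) := by
      have e : m + 1 - l + l = m + 1 := by omega
      refine CoeffsIn.of_mul (f := genSeries c (π.prod π') (j + 2)) (s := l) ?_ ?_
        (X_pow_dvd_jetSeries_prod h2 g2) (hcan _ _ hl1 h2')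
      · rwa [e]
      · rw [e, mul_comm]
        exact (n1.pow _).congr (genSeries_mul_two H _ j hlt).symm
    intro n hn
    rcases lt_or_ge n (m + 1 - l) with hns | hns
    · exact hlow n hns
    · exact cL _ _ (h _ (by omega) n (by omega) (by omega))
  have key := mem_of_coeffsIn_near H (π.prod π') (L := L) (i := j + 1) (s := s) (by omega) hs2
    (fun k hk => X_pow_dvd_jetSeries_prod (hord k hk) (hord' k hk)) (hcan _ _ hs1 h1')
    (fun k hk h3 h4 => by
      have : k = j ∨ k = j + 1 ∨ k = j + 2 := by omega
      rcases this with rfl | rfl | rfl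
      exacts [n0, n1, n2])
    (fun k hk n hn hn' => by
      refine cL _ _ (h k hk n ?_ hn')
      unfold freeStart
      split_ifs <;> omega)
  exact AlgHom.ext key

/-- The generic point of a contact locus with valid parameters: it lies in the contact locus and in
every point of it, and its free coefficients are algebraically independent. -/
theorem exists_generic_point (K : Type*) [Field K] {j s l : ℕ} (V : ValidContact c m j s l) :
    ∃ P : JetScheme K (CoordRing K p q) m, P ∈ centralFiber K p q m ∧
      P ∈ contact K m s (coordFun K p q (j + 1)) ∩ contact K m l (coordFun K p q (j + 2)) ∧
      (∀ Q ∈ contact K m s (coordFun K p q (j + 1)) ∩ contact K m l (coordFun K p q (j + 2)),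
        P ≤ Q) ∧
      AlgebraicIndependent K
        fun x : (Σ k : Fin (c.length + 2), Fin (m + 1 - freeStart m j s l k)) =>
          resHom P (jetCoeff K m
            (⟨freeStart m j s l x.1 + (x.2 : ℕ), by omega⟩ : Fin (m + 1))
            (AddMonoidAlgebra.single (hjGen p q c x.1) 1)) := by
  have hlt := V.lt
  have hs2 := V.two_mul_le
  have hsl := V.le
  have hadd := V.add_le
  have hs1' := V.one_le
  have f1 : freeStart m j s l (j + 1) = s := by simp [freeStart]
  have f2 : freeStart m j s l (j + 2) = l := by simp [freeStart]
  set S := MvPolynomial (ℕ × ℕ) K with hS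
  set u : S := MvPolynomial.X (j + 1, s) with hu
  set v : S := MvPolynomial.X (j + 2, l) with hv
  -- The universal jet of the locus lives over a polynomial ring with the two leading coefficients
  -- inverted. Its kernel is the generic point.
  set B := Localization.Away (u * v) with hB
  have hu0 : u ≠ 0 := MvPolynomial.X_ne_zero _
  have hv0 : v ≠ 0 := MvPolynomial.X_ne_zero _
  have hle : Submonoid.powers (u * v) ≤ nonZeroDivisors S :=
    powers_le_nonZeroDivisors_of_noZeroDivisors (mul_ne_zero hu0 hv0)
  have : IsDomain B := IsLocalization.isDomain_localization hle
  have hinj : Function.Injective (algebraMap S B) := IsLocalization.injective B hle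
  have huv : IsUnit (algebraMap S B (u * v)) := IsLocalization.Away.algebraMap_isUnit _
  rw [map_mul] at huv
  obtain ⟨ψ, h1, h2, h3⟩ := exists_generic_jet (K := K) (m := m) H V
    (fun k n => algebraMap S B (MvPolynomial.X (k, n)))
    (isUnit_of_mul_isUnit_left huv) (isUnit_of_mul_isUnit_right huv)
  have hne (k n : ℕ) : algebraMap S B (MvPolynomial.X (k, n)) ≠ 0 := by
    rw [Ne, ← map_zero (algebraMap S B)]
    exact fun h => MvPolynomial.X_ne_zero _ (hinj h)
  have hker : (kerPoint ψ).asIdeal = RingHom.ker ψ := rfl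
  refine ⟨kerPoint ψ, ?_, ⟨?_, ?_⟩, ?_, ?_⟩
  · rw [mem_centralFiber_iff H hker]
    exact fun k hk => (dvd_pow_self X (by omega)).trans (h1 k hk)
  · rw [H.coordFun_eq K (by omega), mem_contact_iff hker]
    refine ⟨h1 _ (by omega), ?_⟩
    rw [h3 _ (by omega) _ f1.le (by omega)]
    exact hne _ _
  · rw [H.coordFun_eq K (by omega), mem_contact_iff hker]
    refine ⟨h2, ?_⟩
    rw [h3 _ (by omega) _ f2.le (by omega)]
    exact hne _ _
  · rintro Q ⟨hQ1, hQ2⟩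
    set F := FractionRing (ResRing Q)
    set π : JetAlgebra K (CoordRing K p q) m →ₐ[K] F := fracHom Q
    have hQ : Q.asIdeal = RingHom.ker π := asIdeal_eq_ker_fracHom Q
    rw [H.coordFun_eq K (by omega), mem_contact_iff hQ] at hQ1 hQ2
    -- Sending the variables to the coefficients of the jet at Q specializes the universal jet to
    -- one with the same free coefficients; by `jet_unique` it is the jet at Q.
    set ev : S →ₐ[K] F := MvPolynomial.aeval fun x : ℕ × ℕ => coeff x.2 (genSeries c π x.1)
    have hev (k n : ℕ) : ev (MvPolynomial.X (k, n)) = coeff n (genSeries c π k) :=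
      MvPolynomial.aeval_X _ _
    have hunit : ∀ y : Submonoid.powers (u * v), IsUnit (ev y) := by
      rintro ⟨_, n, rfl⟩
      rw [map_pow, map_mul, hev, hev]
      exact (IsUnit.mk0 _ (mul_ne_zero hQ1.2 hQ2.2)).pow n
    set lam : B →ₐ[K] F := IsLocalization.liftAlgHom (M := Submonoid.powers (u * v)) (f := ev) hunit
    have hlam (y : S) : lam (algebraMap S B y) = ev y := IsLocalization.lift_eq _ _
    have hcoef : ∀ k ≤ c.length + 1, ∀ n, freeStart m j s l k ≤ n → n ≤ m →
        coeff n (genSeries c π k) = coeff n (genSeries c (lam.comp ψ) k) := by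
      intro k hk n hn hn'
      rw [genSeries, monSeries, coeff_jetSeries_comp, h3 k hk n hn hn', hlam, hev]
    have heq : π = lam.comp ψ := jet_unique H V hQ1.1 hQ1.2 hQ2.1 hQ2.2
      (X_pow_dvd_jetSeries_comp _ _ _ (h1 _ (by omega))) (X_pow_dvd_jetSeries_comp _ _ _ h2) hcoef
    intro z hz
    rw [hQ, RingHom.mem_ker, heq]
    change lam (ψ z) = 0
    rw [show ψ z = 0 from hz, map_zero]
  -- In B the free coefficients become distinct variables.
  · refine AlgebraicIndependent.of_comp (Ideal.kerLiftAlg ψ) ?_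
    have hX : AlgebraicIndependent K
        fun x : (Σ k : Fin (c.length + 2), Fin (m + 1 - freeStart m j s l k)) =>
          IsScalarTower.toAlgHom K S B
            (MvPolynomial.X ((x.1 : ℕ), freeStart m j s l x.1 + (x.2 : ℕ))) := by
      refine AlgebraicIndependent.map' (f := IsScalarTower.toAlgHom K S B) ?_ hinj
      refine (MvPolynomial.algebraicIndependent_X (ℕ × ℕ) K).comp
        (fun x : (Σ k : Fin (c.length + 2), Fin (m + 1 - freeStart m j s l k)) =>
          ((x.1 : ℕ), freeStart m j s l x.1 + (x.2 : ℕ))) ?_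
      rintro ⟨k, n⟩ ⟨k', n'⟩ h
      simp only [Prod.mk.injEq] at h
      obtain ⟨h1, h⟩ := h
      obtain rfl := Fin.ext h1
      obtain rfl := Fin.ext (Nat.add_left_cancel h)
      rfl
    convert hX using 1
    funext x
    have h := h3 x.1 (by omega) (freeStart m j s l x.1 + x.2) (by omega) (by omega)
    rw [genSeries, monSeries,
      coeff_jetSeries' ψ (k := freeStart m j s l x.1 + x.2) _ (by omega)] at h
    exact h

end Generic

end ToricJets

namespace ToricJets
open PowerSeries Cardinal

/-! ### Transcendence degrees and their bounds. -/

section Trdeg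

variable {K : Type*} [Field K] {B : Type*} [CommRing B] [Algebra K B]

/-- The transcendence degree of the residue field drops strictly under specialization. -/
theorem trdeg_quotient_lt {P Q : Ideal B} [P.IsPrime] [Q.IsPrime] (h : P < Q)
    (hfin : Algebra.trdeg K (B ⧸ P) < ℵ₀) : Algebra.trdeg K (B ⧸ Q) < Algebra.trdeg K (B ⧸ P) := by
  obtain ⟨hle, x, hxQ, hxP⟩ := SetLike.lt_iff_le_and_exists.1 h
  obtain ⟨ι, y, hy⟩ := exists_isTranscendenceBasis' K (B ⧸ Q)
  choose z hz using fun i => Ideal.Quotient.mk_surjective (y i)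
  set f : (B ⧸ P) →ₐ[K] (B ⧸ Q) := Ideal.Quotient.factorₐ K hle
  have hf (b : B) : f (Ideal.Quotient.mk P b) = Ideal.Quotient.mk Q b := rfl
  have hz' : (f ∘ fun i => Ideal.Quotient.mk P (z i)) = y := by
    funext i; rw [Function.comp, hf, hz]
  have hind : AlgebraicIndependent K fun i => Ideal.Quotient.mk P (z i) :=
    AlgebraicIndependent.of_comp f (by rw [hz']; exact hy.1)
  rw [← hy.cardinalMk_eq_trdeg]
  refine lt_of_le_of_ne hind.cardinalMk_le_trdeg fun heq => ?_
  have hbas := hind.isTranscendenceBasis_of_trdeg_le hfin heq.ge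
  have halg := hbas.isAlgebraic.isAlgebraic (Ideal.Quotient.mk P x)
  have hx0 : Ideal.Quotient.mk P x ≠ 0 := by rwa [Ne, Ideal.Quotient.eq_zero_iff_mem]
  -- If the degrees agreed, x would be algebraic over the lifted basis, so some nonzero polynomial
  -- in the lifts would be a multiple of x. Modulo Q this is an algebraic relation for y.
  obtain ⟨⟨r, hr⟩, hr0, w, hw⟩ := halg.exists_nonzero_dvd (mem_nonZeroDivisors_of_ne_zero hx0)
  rw [Algebra.adjoin_range_eq_range_aeval] at hr
  obtain ⟨g, rfl⟩ := hr
  have hg : MvPolynomial.aeval y g = 0 := by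
    have h1 := congrArg f hw
    rw [map_mul, hf, Ideal.Quotient.eq_zero_iff_mem.2 hxQ, zero_mul] at h1
    have h2 : f (MvPolynomial.aeval (fun i => Ideal.Quotient.mk P (z i)) g) = 0 := h1
    rw [← AlgHom.comp_apply, MvPolynomial.comp_aeval] at h2
    rw [← hz']; exact h2
  refine hr0 (Subtype.ext ?_)
  have : g = 0 := (injective_iff_map_eq_zero _).1 hy.1 g hg
  simp [this]

theorem trdeg_resRing_lt {A : Type*} [CommRing A] [Algebra K A] {m : ℕ} {P Q : JetScheme K A m}
    (h : P < Q) (hfin : Algebra.trdeg K (ResRing P) < ℵ₀) :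
    Algebra.trdeg K (ResRing Q) < Algebra.trdeg K (ResRing P) :=
  trdeg_quotient_lt (P := P.asIdeal) (Q := Q.asIdeal) h hfin

end Trdeg

section Bounds

variable {K : Type*} [Field K] {p q m : ℕ} {c : List ℕ} (H : HJData p q c)

include H

/-- Let L be the relative algebraic closure of the subalgebra generated by the coefficients with
index at least `st j`. In a domain L allows cancellation of its nonzero elements, so
`mem_of_coeffsIn_near` shows that R is algebraic over these coefficients, and it remains to count
them. -/
theorem trdeg_le_of_near {R : Type*} [CommRing R] [IsDomain R] [Algebra K R]
    {π : JetAlgebra K (CoordRing K p q) m →ₐ[K] R} (hsurj : Function.Surjective π) {i s : ℕ}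
    (hi : i ≤ c.length + 1) (hs : 2 * s ≤ m + 1)
    (hord : ∀ j ≤ c.length + 1, X ^ s ∣ genSeries c π j) (h0 : coeff s (genSeries c π i) ≠ 0)
    (st : ℕ → ℕ) (hst : ∀ j, j < i - 1 ∨ i + 1 < j → st j ≤ m + 1 - s)
    (near : ∀ L : Subalgebra K R, (∀ j ≤ c.length + 1, ∀ k, st j ≤ k → k ≤ m →
        coeff k (genSeries c π j) ∈ L) → (∀ x y, x ∈ L → x ≠ 0 → x * y ∈ L → y ∈ L) →
      ∀ j ≤ c.length + 1, j ≤ i + 1 → i ≤ j + 1 → CoeffsIn L (m + 1) (genSeries c π j)) :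
    Algebra.trdeg K R ≤ (∑ j ∈ Finset.range (c.length + 2), (m + 1 - st j) : ℕ) := by
  set T : Set R := Set.range fun x : (Σ k : Fin (c.length + 2), Fin (m + 1 - st k)) =>
    coeff (st x.1 + x.2) (genSeries c π x.1) with hT
  set L : Subalgebra K R :=
    (Subalgebra.algebraicClosure (Algebra.adjoin K T) R).restrictScalars K with hL
  have memL (x : R) : x ∈ L ↔ IsAlgebraic (Algebra.adjoin K T) x := Iff.rfl
  have hTL : ∀ j ≤ c.length + 1, ∀ k, st j ≤ k → k ≤ m → coeff k (genSeries c π j) ∈ L := by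
    intro j hj k hk hk'
    have : coeff k (genSeries c π j) ∈ Algebra.adjoin K T := by
      refine Algebra.subset_adjoin ⟨⟨⟨j, by omega⟩, ⟨k - st j, by dsimp only; omega⟩⟩, ?_⟩
      simp only [Nat.add_sub_cancel' hk]
    exact isAlgebraic_algebraMap (⟨_, this⟩ : Algebra.adjoin K T)
  have hcan (x y : R) (hx : x ∈ L) (hx0 : x ≠ 0) (hxy : x * y ∈ L) : y ∈ L := by
    rw [memL] at *
    exact IsAlgebraic.of_mul (mem_nonZeroDivisors_of_ne_zero hx0) hx hxy
  have key := mem_of_coeffsIn_near H π (L := L) hi hs hord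
    (fun x => hcan _ x (near L hTL hcan i hi (by omega) (by omega) s (by omega)) h0)
    (near L hTL hcan) (fun j hj k hk hk' => by
      by_cases hn : j < i - 1 ∨ i + 1 < j
      · exact hTL j hj k ((hst j hn).trans hk) hk'
      · exact near L hTL hcan j hj (by omega) (by omega) k (by omega))
  have : Algebra.IsAlgebraic (Algebra.adjoin K T) R := ⟨fun x => by
    obtain ⟨z, rfl⟩ := hsurj x
    exact key z⟩
  refine (Algebra.IsAlgebraic.trdeg_le_cardinalMk K T).trans ?_
  have h1 := mk_range_le_lift (f := fun x : (Σ k : Fin (c.length + 2), Fin (m + 1 - st k)) =>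
    coeff (st x.1 + x.2) (genSeries c π x.1))
  rw [← hT, mk_fintype (Σ k : Fin (c.length + 2), Fin (m + 1 - st k)), Fintype.card_sigma, lift_natCast] at h1
  simpa [Finset.sum_range] using h1


/-- The bound for a jet whose minimal order `s` is attained at an interior generator. -/
theorem trdeg_le_of_interior {R : Type*} [CommRing R] [IsDomain R] [Algebra K R]
    {π : JetAlgebra K (CoordRing K p q) m →ₐ[K] R} (hsurj : Function.Surjective π) {j s l e : ℕ}
    (hj : j < c.length) (hs1 : 1 ≤ s) (hs : 2 * s ≤ m + 1) (hl : l + s ≤ m + 1)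
    (hord : ∀ k ≤ c.length + 1, X ^ s ∣ genSeries c π k)
    (h0 : coeff s (genSeries c π (j + 1)) ≠ 0) (he : X ^ e ∣ genSeries c π (j + 2))
    (hle : l ≤ e) (h : coeff l (genSeries c π (j + 2)) ≠ 0 ∨ l = m + 1 - s) :
    Algebra.trdeg K R ≤ (∑ k ∈ Finset.range (c.length + 2),
      (m + 1 - if k = j + 2 then e else freeStart m j s l k) : ℕ) := by
  refine trdeg_le_of_near H hsurj (i := j + 1) (by omega) hs hord h0 _ ?_ ?_
  · intro k hk
    unfold freeStart
    split_ifs <;> omega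
  · intro L hL hcan k hk h1 h2
    have hlow (k n : ℕ) (hk : k ≤ c.length + 1) (hd : X ^ n ∣ genSeries c π k)
        (hn : (if k = j + 2 then e else freeStart m j s l k) ≤ n) :
        CoeffsIn L (m + 1) (genSeries c π k) := by
      intro i hi
      rcases lt_or_ge i n with h' | h'
      · rw [X_pow_dvd_iff.1 hd i h']; exact zero_mem L
      · exact hL k hk i (hn.trans h') (by omega)
    have n1 := hlow (j + 1) s (by omega) (hord _ (by omega)) (by simp [freeStart])
    have n2 := hlow (j + 2) e (by omega) he (by simp)
    have : k = j ∨ k = j + 1 ∨ k = j + 2 := by omega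
    rcases this with rfl | rfl | rfl
    · rcases h with h | rfl
      · have hlow : CoeffsIn L (m + 1 - l) (genSeries c π k) := by
          have e' : m + 1 - l + l = m + 1 := by omega
          refine CoeffsIn.of_mul (f := genSeries c π (k + 2)) (s := l) ?_ ?_
            ((pow_dvd_pow X hle).trans he) (fun x => hcan _ x (n2 l (by omega)) h)
          · rwa [e']
          · rw [e', mul_comm]
            exact (n1.pow _).congr (genSeries_mul_two H _ k hj).symm
        intro n hn
        rcases lt_or_ge n (m + 1 - l) with hns | hns
        · exact hlow n hns
        · exact hL k hk n (by simp [freeStart]; omega) (by omega)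
      -- Here m + 1 - l = s, so every coefficient of x_j that can be nonzero has been counted and
      -- the relation is not needed.
      · exact hlow k s hk (hord k hk) (by simp [freeStart]; omega)
    · exact n1
    · exact n2

/-- The bound for a jet whose minimal order `s` is attained at an extremal generator. -/
theorem trdeg_le_of_extremal {R : Type*} [CommRing R] [IsDomain R] [Algebra K R]
    {π : JetAlgebra K (CoordRing K p q) m →ₐ[K] R} (hsurj : Function.Surjective π) {i k s e : ℕ}
    (hik : i = 0 ∧ k = 1 ∨ i = c.length + 1 ∧ k = c.length) (hs : 2 * s ≤ m + 1)
    (hord : ∀ k ≤ c.length + 1, X ^ s ∣ genSeries c π k)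
    (h0 : coeff s (genSeries c π i) ≠ 0) (he : X ^ e ∣ genSeries c π k) :
    Algebra.trdeg K R ≤ (∑ n ∈ Finset.range (c.length + 2),
      (m + 1 - if n = i then s else if n = k then e else m + 1 - s) : ℕ) := by
  refine trdeg_le_of_near H hsurj (i := i) (by omega) hs hord h0 _ ?_ ?_
  · intro n hn
    rw [if_neg (by omega), if_neg (by omega)]
  · intro L hL hcan n hn h1 h2
    have hlow (k n : ℕ) (d : ℕ) (hk : k ≤ c.length + 1) (hd : X ^ n ∣ genSeries c π k)
        (hn : d ≤ n) (hL : ∀ i, d ≤ i → i ≤ m → coeff i (genSeries c π k) ∈ L) :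
        CoeffsIn L (m + 1) (genSeries c π k) := by
      intro i hi
      rcases lt_or_ge i n with h' | h'
      · rw [X_pow_dvd_iff.1 hd i h']; exact zero_mem L
      · exact hL i (hn.trans h') (by omega)
    have hpos := H.pos
    have : n = i ∨ n = k := by omega
    rcases this with rfl | rfl
    · exact hlow n s s hn (hord n hn) le_rfl
        fun i h => hL n hn i (by simpa using h)
    · exact hlow n e e hn he le_rfl fun i h => hL n hn i (by rw [if_neg (by omega)]; simpa using h)

end Bounds

/-- What x_(j+2) loses when l grows, x_j gains, so the number of free coefficients does not depend
on l. -/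
theorem sum_sub_freeStart {r m j s l : ℕ} (hj : j < r) (hs : 2 * s ≤ m + 1) (hsl : s ≤ l)
    (hl : l + s ≤ m + 1) :
    ∑ k ∈ Finset.range (r + 2), (m + 1 - freeStart m j s l k) + 2 * s = 2 * (m + 1) + r * s := by
  have : ∀ k ∈ Finset.range (r + 2), m + 1 - freeStart m j s l k =
      s + (if k = j then l - s else 0) + (if k = j + 1 then m + 1 - 2 * s else 0) +
        (if k = j + 2 then m + 1 - l - s else 0) := by
    intro k _
    unfold freeStart
    split_ifs <;> omega
  rw [Finset.sum_congr rfl this]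
  simp only [Finset.sum_add_distrib, Finset.sum_const, Finset.card_range, Finset.sum_ite_eq',
    Finset.mem_range, smul_eq_mul, if_pos (show j < r + 2 by omega),
    if_pos (show j + 1 < r + 2 by omega), if_pos (show j + 2 < r + 2 by omega), Nat.add_mul]
  omega

/-- For e = s this is the count of `sum_sub_freeStart`; each further order of the neighbour lowers
it by one. -/
theorem sum_sub_extremal {r m i k s e : ℕ} (hi : i < r + 2) (hk : k < r + 2) (hik : i ≠ k)
    (hs : 2 * s ≤ m + 1) (he : s ≤ e) (he' : e ≤ m + 1) :
    ∑ n ∈ Finset.range (r + 2), (m + 1 - if n = i then s else if n = k then e else m + 1 - s) +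
      s + e = 2 * (m + 1) + r * s := by
  have : ∀ n ∈ Finset.range (r + 2),
      (m + 1 - if n = i then s else if n = k then e else m + 1 - s) + (if n = k then s else 0) =
      s + (if n = i then m + 1 - 2 * s else 0) + (if n = k then m + 1 - e else 0) := by
    intro n _
    split_ifs <;> omega
  have h := Finset.sum_congr rfl this
  simp only [Finset.sum_add_distrib, Finset.sum_const, Finset.card_range, Finset.sum_ite_eq',
    Finset.mem_range, smul_eq_mul, if_pos hi, if_pos hk, Nat.add_mul] at h
  omega

end ToricJets

namespace ToricJets
open PowerSeries Cardinal

theorem exists_order {R : Type*} [CommRing R] (f : R⟦X⟧) (n : ℕ) :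
    ∃ l ≤ n, X ^ l ∣ f ∧ (coeff l f ≠ 0 ∨ l = n) := by
  induction n with
  | zero => exact ⟨0, le_rfl, by simp, Or.inr rfl⟩
  | succ n ih =>
    obtain ⟨l, hl, hd, h | rfl⟩ := ih
    · exact ⟨l, by omega, hd, Or.inl h⟩
    · by_cases h : coeff l f = 0
      · refine ⟨l + 1, le_rfl, X_pow_dvd_iff.2 fun k hk => ?_, Or.inr rfl⟩
        rcases Nat.lt_succ_iff_lt_or_eq.1 hk with hk | rfl
        · exact X_pow_dvd_iff.1 hd k hk
        · exact h
      · exact ⟨l, by omega, hd, Or.inl h⟩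

theorem le_of_X_pow_dvd {R : Type*} [CommRing R] {f : R⟦X⟧} {s l : ℕ} (hs : X ^ s ∣ f)
    (hl : coeff l f ≠ 0) : s ≤ l := by
  by_contra h
  exact hl (X_pow_dvd_iff.1 hs l (by omega))

section Bounds

variable {K : Type*} [Field K] {p q m : ℕ} {c : List ℕ} (H : HJData p q c)

/-- The smallest order of a generator. -/
theorem exists_min_order {R : Type*} [CommRing R] [Algebra K R]
    {π : JetAlgebra K (CoordRing K p q) m →ₐ[K] R} {k d : ℕ} (hk : k ≤ c.length + 1)
    (h : coeff d (genSeries c π k) ≠ 0) :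
    ∃ t ≤ d, (∀ i ≤ c.length + 1, X ^ t ∣ genSeries c π i) ∧
      ∃ i ≤ c.length + 1, coeff t (genSeries c π i) ≠ 0 := by
  classical
  have hex : ∃ t, ∃ i ≤ c.length + 1, coeff t (genSeries c π i) ≠ 0 := ⟨d, k, hk, h⟩
  refine ⟨Nat.find hex, Nat.find_min' hex ⟨k, hk, h⟩, fun i hi => ?_, Nat.find_spec hex⟩
  rw [X_pow_dvd_iff]
  intro n hn
  by_contra h0
  exact Nat.find_min hex hn ⟨i, hi, h0⟩

include H

/-- The bound is the dimension of a contact locus with the same s, whichever generator attains the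
minimal order. For r ≥ 2 it does not decrease with s, and this makes contact loci dense in
components. -/
theorem trdeg_le_of_min_order {R : Type*} [CommRing R] [IsDomain R] [Algebra K R]
    {π : JetAlgebra K (CoordRing K p q) m →ₐ[K] R} (hsurj : Function.Surjective π) {s i : ℕ}
    (hs1 : 1 ≤ s) (hs : 2 * s ≤ m + 1) (hord : ∀ k ≤ c.length + 1, X ^ s ∣ genSeries c π k)
    (hi : i ≤ c.length + 1) (h0 : coeff s (genSeries c π i) ≠ 0) :
    ∃ n : ℕ, n + 2 * s ≤ 2 * (m + 1) + c.length * s ∧ Algebra.trdeg K R ≤ n := by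
  have hpos := H.pos
  by_cases h : i = 0 ∨ i = c.length + 1
  · obtain ⟨k, hik⟩ : ∃ k, i = 0 ∧ k = 1 ∨ i = c.length + 1 ∧ k = c.length := by
      rcases h with h | h
      exacts [⟨1, by omega⟩, ⟨c.length, by omega⟩]
    refine ⟨_, ?_, trdeg_le_of_extremal H hsurj hik hs hord h0 (hord k (by omega))⟩
    have := sum_sub_extremal (r := c.length) (m := m) (i := i) (k := k) (s := s) (e := s)
      (by omega) (by omega) (by omega) hs le_rfl (by omega)
    omega
  · obtain ⟨j, rfl⟩ : ∃ j, i = j + 1 := ⟨i - 1, by omega⟩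
    obtain ⟨l, hl, hd, h⟩ := exists_order (genSeries c π (j + 2)) (m + 1 - s)
    have hsl : s ≤ l := by
      rcases h with h | h
      · exact le_of_X_pow_dvd (hord _ (by omega)) h
      · omega
    refine ⟨_, ?_, trdeg_le_of_interior H hsurj (by omega) hs1 hs (by omega) hord h0 hd le_rfl h⟩
    have := sum_sub_freeStart (r := c.length) (m := m) (j := j) (by omega) hs hsl (by omega)
    have h2 : ∀ k ∈ Finset.range (c.length + 2),
        (m + 1 - if k = j + 2 then l else freeStart m j s l k) = m + 1 - freeStart m j s l k := by
      intro k _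
      split_ifs with hk
      · subst hk; simp [freeStart]
      · rfl
    rw [Finset.sum_congr rfl h2]
    omega

/-- A jet of minimal order `1` lies in one of the contact loci, or its transcendence degree is
smaller than those of the generic points of these. -/
theorem exists_contact_or_trdeg_le {R : Type*} [CommRing R] [IsDomain R] [Algebra K R]
    {π : JetAlgebra K (CoordRing K p q) m →ₐ[K] R} (hsurj : Function.Surjective π) {i : ℕ}
    (hm : 1 ≤ m) (hord : ∀ k ≤ c.length + 1, X ∣ genSeries c π k)
    (hi : i ≤ c.length + 1) (h0 : coeff 1 (genSeries c π i) ≠ 0) :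
    (∃ j l, ValidContact c m j 1 l ∧ coeff 1 (genSeries c π (j + 1)) ≠ 0 ∧
      X ^ l ∣ genSeries c π (j + 2) ∧ coeff l (genSeries c π (j + 2)) ≠ 0) ∨
    ∃ n : ℕ, n + 3 ≤ 2 * (m + 1) + c.length ∧ Algebra.trdeg K R ≤ n := by
  have hpos := H.pos
  by_cases hint : ∃ j < c.length, coeff 1 (genSeries c π (j + 1)) ≠ 0
  · obtain ⟨j, hj, hj0⟩ := hint
    obtain ⟨l, hl, hd, h⟩ := exists_order (genSeries c π (j + 2)) (m + 1)
    have h1l : 1 ≤ l := by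
      rcases h with h | h
      · exact le_of_X_pow_dvd (by rw [pow_one]; exact hord _ (by omega)) h
      · omega
    have hc := two_le_hjCoeff H.two_le j
    rcases h with h | rfl
    · have hlm : l ≤ m := by
        by_contra hlm
        refine h ?_
        rw [genSeries, monSeries, jetSeries, coeff_mk, dif_neg (by omega)]
      by_cases hlc : l ≤ hjCoeff c j - 1
      · exact Or.inl ⟨j, l, ⟨hj, le_rfl, by omega, h1l, by omega, by omega⟩, hj0, hd, h⟩
      -- For c_j ≤ l ≤ m the product x_j x_(j+2) has order greater than c_j, but x_(j+1)^(c_j) has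
      -- order exactly c_j ≤ m.
      · exfalso
        have hrel := genSeries_mul_two H π j hj
        have e1 : coeff (hjCoeff c j) (genSeries c π j * genSeries c π (j + 2)) = 0 := by
          have : X ^ (1 + l) ∣ genSeries c π j * genSeries c π (j + 2) := by
            rw [pow_add, pow_one]
            exact mul_dvd_mul (hord _ (by omega)) hd
          exact X_pow_dvd_iff.1 this _ (by omega)
        rw [truncMk_eq_iff.1 hrel _ (by omega)] at e1
        obtain ⟨f, hf⟩ := hord (j + 1) (by omega)
        rw [hf, ← zero_add 1, coeff_succ_X_mul] at hj0
        rw [hf, mul_pow] at e1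
        have := coeff_X_pow_mul (f ^ hjCoeff c j) (hjCoeff c j) 0
        rw [zero_add, e1] at this
        rw [coeff_zero_eq_constantCoeff_apply] at hj0
        refine pow_ne_zero (hjCoeff c j) hj0 ?_
        rw [← map_pow, ← coeff_zero_eq_constantCoeff_apply, ← this]
    -- Here x_(j+2) vanishes modulo t^(m+1). Compared with the locus for l = m, its only free
    -- coefficient is lost, whence e = m + 1.
    · right
      refine ⟨_, ?_, trdeg_le_of_interior H hsurj (s := 1) (l := m) hj le_rfl (by omega) le_rfl
        (by simpa using hord) hj0 hd (by omega) (Or.inr rfl)⟩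
      have hsum := sum_sub_freeStart (r := c.length) (m := m) (j := j) (s := 1) (l := m)
        (by omega) (by omega) (by omega) (by omega)
      have h2 : ∀ k ∈ Finset.range (c.length + 2), m + 1 - freeStart m j 1 m k =
          (m + 1 - if k = j + 2 then m + 1 else freeStart m j 1 m k) +
            if k = j + 2 then 1 else 0 := by
        intro k _
        unfold freeStart
        split_ifs <;> omega
      rw [Finset.sum_congr rfl h2, Finset.sum_add_distrib] at hsum
      simp only [Finset.sum_ite_eq', Finset.mem_range, if_pos (show j + 2 < c.length + 2 by omega)]
        at hsum
      omega
  · push Not at hint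
    right
    have : i = 0 ∨ i = c.length + 1 := by
      by_contra h
      refine h0 ?_
      have := hint (i - 1) (by omega)
      rwa [Nat.sub_add_cancel (by omega)] at this
    obtain ⟨k, hik⟩ : ∃ k, i = 0 ∧ k = 1 ∨ i = c.length + 1 ∧ k = c.length := by
      rcases this with h | h
      exacts [⟨1, by omega⟩, ⟨c.length, by omega⟩]
    -- All interior generators have order at least 2, so the neighbour of x_i contributes one
    -- coefficient less than in the generic count.
    have he : X ^ 2 ∣ genSeries c π k := by
      rw [X_pow_dvd_iff]
      intro n hn
      interval_cases n
      · rw [coeff_zero_eq_constantCoeff_apply, ← X_dvd_iff]; exact hord _ (by omega)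
      · have := hint (k - 1) (by omega)
        rwa [Nat.sub_add_cancel (by omega)] at this
    refine ⟨_, ?_, trdeg_le_of_extremal H hsurj (s := 1) hik (by omega) (by simpa using hord) h0 he⟩
    have := sum_sub_extremal (r := c.length) (m := m) (i := i) (k := k) (s := 1) (e := 2)
      (by omega) (by omega) (by omega) (by omega) (by omega) (by omega)
    omega

end Bounds

/-! ### Contact loci as components of the central fibre. -/

section ContactPoints

variable {K : Type*} [Field K] {p q m : ℕ} {c : List ℕ} (H : HJData p q c) {j s l : ℕ}

variable (K) in
/-- The generic point of a contact locus with valid parameters. -/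
noncomputable def contactPoint (V : ValidContact c m j s l) : JetScheme K (CoordRing K p q) m :=
  (exists_generic_point H K V).choose

theorem contactPoint_mem_centralFiber (V : ValidContact c m j s l) :
    contactPoint K H V ∈ centralFiber K p q m := (exists_generic_point H K V).choose_spec.1

theorem contactPoint_mem (V : ValidContact c m j s l) : contactPoint K H V ∈
    contact K m s (coordFun K p q (j + 1)) ∩ contact K m l (coordFun K p q (j + 2)) :=
  (exists_generic_point H K V).choose_spec.2.1

theorem contactPoint_le (V : ValidContact c m j s l) {Q : JetScheme K (CoordRing K p q) m}
    (hQ : Q ∈ contact K m s (coordFun K p q (j + 1)) ∩ contact K m l (coordFun K p q (j + 2))) :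
    contactPoint K H V ≤ Q :=
  (exists_generic_point H K V).choose_spec.2.2.1 Q hQ

theorem le_trdeg_contactPoint (V : ValidContact c m j s l) :
    ∃ n : ℕ, n + 2 * s = 2 * (m + 1) + c.length * s ∧
      (n : Cardinal) ≤ Algebra.trdeg K (ResRing (contactPoint K H V)) := by
  refine ⟨_, sum_sub_freeStart V.lt V.two_mul_le V.le V.add_le, ?_⟩
  have h := (exists_generic_point H K V).choose_spec.2.2.2.lift_cardinalMk_le_trdeg
  rw [mk_fintype, Fintype.card_sigma, lift_natCast] at h
  simp only [Fintype.card_fin, lift_uzero] at h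
  rw [Finset.sum_range]
  exact h

theorem coeff_contactPoint_ne_zero (V : ValidContact c m j s l) {k n : ℕ} (hk : k ≤ c.length + 1)
    (hn : freeStart m j s l k ≤ n) (hnm : n ≤ m) :
    coeff n (genSeries c (resHom (contactPoint K H V)) k) ≠ 0 := by
  have h := (exists_generic_point H K V).choose_spec.2.2.2.ne_zero
    ⟨⟨k, by omega⟩, ⟨n - freeStart m j s l k, by dsimp only; omega⟩⟩
  rw [genSeries, monSeries, coeff_jetSeries' _ _ hnm]
  simp only [Nat.add_sub_cancel' hn] at h
  exact h

include H in
theorem contactPoint_mem_iff (V : ValidContact c m j s l) {R : Type*} [CommRing R] [Algebra K R]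
    {Q : JetScheme K (CoordRing K p q) m} {π : JetAlgebra K (CoordRing K p q) m →ₐ[K] R}
    (h : Q.asIdeal = RingHom.ker π) :
    Q ∈ contact K m s (coordFun K p q (j + 1)) ∩ contact K m l (coordFun K p q (j + 2)) ↔
      (X ^ s ∣ genSeries c π (j + 1) ∧ coeff s (genSeries c π (j + 1)) ≠ 0) ∧
      (X ^ l ∣ genSeries c π (j + 2) ∧ coeff l (genSeries c π (j + 2)) ≠ 0) := by
  have := V.lt
  rw [Set.mem_inter_iff, H.coordFun_eq K (by omega), H.coordFun_eq K (by omega),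
    mem_contact_iff h, mem_contact_iff h]

theorem contactClosure_eq (V : ValidContact c m j s l) :
    contactClosure K p q m j s l = closure {contactPoint K H V} := by
  refine subset_antisymm ?_ (closure_mono (Set.singleton_subset_iff.2 (contactPoint_mem H V)))
  refine closure_minimal (fun Q hQ => ?_) isClosed_closure
  exact (PrimeSpectrum.le_iff_mem_closure _ _).1 (contactPoint_le H V hQ)

attribute [irreducible] contactPoint

theorem coeff_jetSeries_eq_zero_of_le {A : Type*} [CommRing A] [Algebra K A]
    {P Q : JetScheme K A m} (hle : P ≤ Q) {n : ℕ} {a : A}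
    (h : coeff n (jetSeries (resHom P) a) = 0) : coeff n (jetSeries (resHom Q) a) = 0 := by
  by_cases hn : n < m + 1
  · have h1 := jetCoeff_mem_iff (asIdeal_eq_ker_resHom P) ⟨n, hn⟩ a
    have h2 := jetCoeff_mem_iff (asIdeal_eq_ker_resHom Q) ⟨n, hn⟩ a
    exact h2.1 (hle (h1.2 h))
  · rw [jetSeries, coeff_mk, dif_neg hn]

/-- Generic points of contact loci are generic points of components, except possibly for cyclic
quotients of type `A` and `s ≥ 2`. -/
theorem contactPoint_minimal (V : ValidContact c m j s l) (h : 2 ≤ c.length ∨ s = 1) :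
    Minimal (· ∈ centralFiber K p q m) (contactPoint K H V) := by
  refine ⟨contactPoint_mem_centralFiber H V, fun Q hQ hle => ?_⟩
  by_contra hne
  have hlt : Q < contactPoint K H V := lt_of_le_not_ge hle hne
  have hj := V.lt
  have hs := V.one_le
  have hs2 := V.two_mul_le
  have h2 : coeff s (genSeries c (resHom Q) (j + 1)) ≠ 0 := fun h0 =>
    ((contactPoint_mem_iff H V (asIdeal_eq_ker_resHom (contactPoint K H V))).1
      (contactPoint_mem H V)).1.2 (coeff_jetSeries_eq_zero_of_le hle h0)
  -- A generization has minimal order t ≤ s. Its transcendence degree is at most 2(m+1) + (r-2)t,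
  -- which does not exceed that of the contact point if r ≥ 2 or s = t = 1, whereas a proper
  -- generization needs a greater one.
  obtain ⟨t, hts, hord, i, hi, hi0⟩ := exists_min_order (by omega) h2
  have hc := (mem_centralFiber_iff H (asIdeal_eq_ker_resHom Q)).1 hQ
  have ht1 : 1 ≤ t := le_of_X_pow_dvd (by simpa using hc i hi) hi0
  obtain ⟨n, hn, htr⟩ := trdeg_le_of_min_order H (resHom_surjective Q) ht1 (by omega) hord hi hi0
  obtain ⟨n', hn', htr'⟩ := le_trdeg_contactPoint (K := K) H V
  have := trdeg_resRing_lt hlt (htr.trans_lt (natCast_lt_aleph0))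
  have hnn : n' < n := by exact_mod_cast (htr'.trans_lt this).trans_le htr
  rcases h with h | rfl
  · obtain ⟨r, hr⟩ := Nat.exists_eq_add_of_le h
    rw [hr] at hn hn'
    nlinarith
  · obtain rfl : t = 1 := by omega
    omega

end ContactPoints

section Components

/-- The spectrum is sober: components of a closed set are the closures of its minimal primes. -/
theorem maximal_irreducible_iff {B : Type*} [CommRing B] {Z : Set (PrimeSpectrum B)}
    (hZ : IsClosed Z) {S : Set (PrimeSpectrum B)} :
    Maximal (fun s => IsIrreducible s ∧ s ⊆ Z) S ↔
      ∃ P, S = closure {P} ∧ Minimal (· ∈ Z) P := by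
  have hcl {P : PrimeSpectrum B} (hP : P ∈ Z) : closure {P} ⊆ Z :=
    closure_minimal (Set.singleton_subset_iff.2 hP) hZ
  constructor
  · rintro ⟨⟨h1, h2⟩, h3⟩
    have hS : closure S ⊆ Z := closure_minimal h2 hZ
    have hSc : closure S = S := subset_antisymm (h3 ⟨h1.closure, hS⟩ subset_closure) subset_closure
    obtain ⟨P, hP⟩ := QuasiSober.sober h1.closure isClosed_closure
    have hP' : closure {P} = S := hP.def.trans hSc
    have hPZ : P ∈ Z := h2 (hP' ▸ subset_closure rfl)
    refine ⟨P, hP'.symm, hPZ, fun Q hQ hle => ?_⟩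
    have : S ⊆ closure {Q} := by
      rw [← hP']
      exact closure_minimal (Set.singleton_subset_iff.2
        ((PrimeSpectrum.le_iff_mem_closure _ _).1 hle)) isClosed_closure
    have h4 := h3 ⟨isIrreducible_singleton.closure, hcl hQ⟩ this
    rw [← hP'] at h4
    exact (PrimeSpectrum.le_iff_mem_closure _ _).2 (h4 (subset_closure rfl))
  · rintro ⟨P, rfl, hP⟩
    refine ⟨⟨isIrreducible_singleton.closure, hcl hP.1⟩, fun S' hS' hle => ?_⟩
    have hS : closure S' ⊆ Z := closure_minimal hS'.2 hZ
    obtain ⟨Q, hQ⟩ := QuasiSober.sober hS'.1.closure isClosed_closure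
    have hQZ : Q ∈ Z := hS hQ.mem
    have hQP : Q ≤ P := by
      rw [PrimeSpectrum.le_iff_mem_closure, hQ.def]
      exact subset_closure (hle (subset_closure rfl))
    have := hP.2 hQZ hQP
    refine subset_closure.trans ?_
    rw [← hQ.def]
    exact closure_minimal (Set.singleton_subset_iff.2
      ((PrimeSpectrum.le_iff_mem_closure _ _).1 this)) isClosed_closure

theorem isClosed_centralFiber (K : Type*) [Field K] (p q m : ℕ) :
    IsClosed (centralFiber K p q m) := by
  have : centralFiber K p q m = PrimeSpectrum.zeroLocus
      {z | ∃ w : dualSemigroup p q, w ≠ 0 ∧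
        z = jetCoeff K m 0 (AddMonoidAlgebra.single w 1 : CoordRing K p q)} := by
    ext P
    rw [mem_centralFiber_iff_monomials, PrimeSpectrum.mem_zeroLocus]
    constructor
    · rintro h _ ⟨w, hw, rfl⟩
      exact h w hw
    · exact fun h w hw => h ⟨w, hw, rfl⟩
  rw [this]
  exact PrimeSpectrum.isClosed_zeroLocus _

theorem closure_singleton_eq_iff {B : Type*} [CommRing B] {P Q : PrimeSpectrum B} :
    closure {P} = closure {Q} ↔ P = Q :=
  ⟨fun h => Specializes.antisymm (specializes_iff_closure_subset.2 h.ge)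
    (specializes_iff_closure_subset.2 h.le) |>.eq, fun h => h ▸ rfl⟩

end Components

end ToricJets

namespace ToricJets
open PowerSeries Cardinal

section Leading

variable {R : Type*} [CommRing R]

theorem coeff_add_mul_of_dvd {f g : R⟦X⟧} {a b : ℕ} (hf : X ^ a ∣ f) (hg : X ^ b ∣ g) :
    coeff (a + b) (f * g) = coeff a f * coeff b g := by
  obtain ⟨f, rfl⟩ := hf
  obtain ⟨g, rfl⟩ := hg
  have h (n : ℕ) (f : R⟦X⟧) : coeff n (X ^ n * f) = constantCoeff f := by
    have := coeff_X_pow_mul f n 0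
    rwa [zero_add, coeff_zero_eq_constantCoeff_apply] at this
  rw [h, h, show X ^ a * f * (X ^ b * g) = X ^ (a + b) * (f * g) by rw [pow_add]; ring, h, map_mul]

theorem coeff_mul_pow_of_dvd {f : R⟦X⟧} {a : ℕ} (hf : X ^ a ∣ f) (n : ℕ) :
    coeff (a * n) (f ^ n) = coeff a f ^ n := by
  induction n with
  | zero => simp
  | succ n ih =>
    have h : X ^ (a * n) ∣ f ^ n := by rw [pow_mul]; exact pow_dvd_pow_of_dvd hf n
    rw [mul_add, mul_one, pow_succ, coeff_add_mul_of_dvd h hf, ih, pow_succ]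

end Leading

/-! ### The neighbour on the other side. -/

section Swap

variable {K : Type*} [Field K] {p q m : ℕ} {c : List ℕ} (H : HJData p q c) {j s l : ℕ}

/-- The order of the neighbour on the other side on a contact locus. -/
def swapOrder (c : List ℕ) (m j s l : ℕ) : ℕ := min (hjCoeff c j * s) (m + 1) - l

include H in
theorem ValidContact.le_swapOrder (V : ValidContact c m j s l) :
    s ≤ swapOrder c m j s l ∧ swapOrder c m j s l + l = min (hjCoeff c j * s) (m + 1) := by
  have hc := two_le_hjCoeff H.two_le j
  have h1 := V.le_mul
  have h2 := V.add_le
  have h3 := V.le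
  obtain ⟨κ, hκ⟩ := Nat.exists_eq_add_of_le hc
  rw [hκ, show 2 + κ - 1 = κ + 1 by omega] at h1
  have h4 : l + s ≤ hjCoeff c j * s := by rw [hκ]; nlinarith
  unfold swapOrder
  omega

include H in
-- The relation gives x_j the order c_j s - l as long as c_j s ≤ m; otherwise it only shows that the
-- order is at least m + 1 - l.
theorem contact_swap {R : Type*} [CommRing R] [IsDomain R] [Algebra K R]
    (V : ValidContact c m j s l) (π : JetAlgebra K (CoordRing K p q) m →ₐ[K] R)
    (h1 : X ^ s ∣ genSeries c π (j + 1)) (h1' : coeff s (genSeries c π (j + 1)) ≠ 0)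
    (h2 : X ^ l ∣ genSeries c π (j + 2)) (h2' : coeff l (genSeries c π (j + 2)) ≠ 0) :
    X ^ swapOrder c m j s l ∣ genSeries c π j ∧
      (hjCoeff c j * s ≤ m → coeff (swapOrder c m j s l) (genSeries c π j) ≠ 0) := by
  have hrel := genSeries_mul_two H π j V.lt
  have hsw := V.le_swapOrder H
  have hpow : X ^ (hjCoeff c j * s) ∣ genSeries c π (j + 1) ^ hjCoeff c j := by
    rw [mul_comm, pow_mul]; exact pow_dvd_pow_of_dvd h1 _
  have hd : X ^ swapOrder c m j s l ∣ genSeries c π j := by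
    refine X_pow_dvd_of_mul h2 h2' ?_
    rw [mul_comm (genSeries c π (j + 2))]
    refine X_pow_dvd_of_truncMk_eq hrel.symm (by omega) ?_
    exact (pow_dvd_pow X (by omega)).trans hpow
  refine ⟨hd, fun hcs h0 => ?_⟩
  have e1 := coeff_add_mul_of_dvd hd h2
  rw [h0, zero_mul, hsw.2, min_eq_left (by omega), truncMk_eq_iff.1 hrel _ (by omega), mul_comm,
    coeff_mul_pow_of_dvd h1] at e1
  exact pow_ne_zero _ h1' e1

/-- For c_j s > m the coefficient in question is the first free one of x_j, which is nonzero at the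
generic point. The orders of both neighbours are thus known, as the reversal and the study of linear
parts require. -/
theorem contactPoint_swap (V : ValidContact c m j s l) :
    X ^ swapOrder c m j s l ∣ genSeries c (resHom (contactPoint K H V)) j ∧
      coeff (swapOrder c m j s l) (genSeries c (resHom (contactPoint K H V)) j) ≠ 0 := by
  have hV := V.lt
  have h1 := V.one_le
  have h2 := V.le
  obtain ⟨⟨a1, a2⟩, a3, a4⟩ := (contactPoint_mem_iff H V (asIdeal_eq_ker_resHom _)).1
    (contactPoint_mem (K := K) H V)
  obtain ⟨h3, h4⟩ := contact_swap H V _ a1 a2 a3 a4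
  refine ⟨h3, ?_⟩
  by_cases hcs : hjCoeff c j * s ≤ m
  · exact h4 hcs
  · refine coeff_contactPoint_ne_zero H V (by omega) ?_ ?_
    · rw [freeStart, if_pos rfl, swapOrder]; omega
    · rw [swapOrder]; omega

end Swap

/-! ### The generators with nonzero linear part. -/

section LinearParts

/-- The index of the chain of consecutive generators to which the `e`-th edge belongs. -/
def chainIndex (c : List ℕ) (e : ℕ) : ℕ := ∑ k ∈ Finset.range e, if hjCoeff c k = 2 then 0 else 1

theorem chainIndex_succ (c : List ℕ) (e : ℕ) :
    chainIndex c (e + 1) = chainIndex c e + if hjCoeff c e = 2 then 0 else 1 :=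
  Finset.sum_range_succ _ _

theorem chainIndex_mono (c : List ℕ) : Monotone (chainIndex c) :=
  monotone_nat_of_le_succ fun n => by rw [chainIndex_succ]; exact Nat.le_add_right _ _

theorem chainIndex_eq_of_forall {c : List ℕ} {e f : ℕ} (hef : e ≤ f)
    (h : ∀ t, e ≤ t → t < f → hjCoeff c t = 2) : chainIndex c f = chainIndex c e := by
  induction f, hef using Nat.le_induction with
  | base => rfl
  | succ f hef ih =>
    rw [chainIndex_succ, if_pos (h f hef (by omega)), add_zero,
      ih fun t h1 h2 => h t h1 (by omega)]

variable {K : Type*} [Field K] {p q m : ℕ} {c : List ℕ} (H : HJData p q c)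
  {R : Type*} [CommRing R] [IsDomain R] [Algebra K R]
  {π : JetAlgebra K (CoordRing K p q) m →ₐ[K] R} (hm : 2 ≤ m)
  (hord : ∀ k ≤ c.length + 1, X ∣ genSeries c π k)

include H hm hord

omit [IsDomain R] in
-- This is the coefficient of t^2 in the relation, whence m ≥ 2. A coefficient greater than 2 in
-- between adds a factor of positive order, which makes the right side vanish.
theorem linear_part_mul {i n : ℕ} (hn : 1 ≤ n) (hin : i + n ≤ c.length) :
    coeff 1 (genSeries c π i) * coeff 1 (genSeries c π (i + n + 1)) =
      if ∀ k < n, hjCoeff c (i + k) = 2 then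
        coeff 1 (genSeries c π (i + 1)) * coeff 1 (genSeries c π (i + n)) else 0 := by
  have hord' : ∀ k ≤ c.length + 1, X ^ 1 ∣ genSeries c π k := by simpa using hord
  rw [← coeff_add_mul_of_dvd (hord' _ (by omega)) (hord' _ (by omega)),
    truncMk_eq_iff.1 (genSeries_mul H π i n hin) _ (by omega)]
  split_ifs with h
  · rw [Finset.prod_eq_one, mul_one,
      coeff_add_mul_of_dvd (hord' _ (by omega)) (hord' _ (by omega))]
    intro k hk
    rw [h k (Finset.mem_range.1 hk), Nat.sub_self, pow_zero]
  · push Not at h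
    obtain ⟨k, hk, hk2⟩ := h
    have hc := two_le_hjCoeff H.two_le (i + k)
    have h0 : X ∣ genSeries c π (i + k + 1) ^ (hjCoeff c (i + k) - 2) :=
      dvd_pow (hord _ (by omega)) (by omega)
    have h1 := h0.trans (Finset.dvd_prod_of_mem
      (fun k => genSeries c π (i + k + 1) ^ (hjCoeff c (i + k) - 2)) (Finset.mem_range.2 hk))
    have h3 : X ^ 3 ∣ genSeries c π (i + 1) * genSeries c π (i + n) *
        ∏ k ∈ Finset.range n, genSeries c π (i + k + 1) ^ (hjCoeff c (i + k) - 2) := by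
      rw [show (X : R⟦X⟧) ^ 3 = X * X * X by ring]
      exact mul_dvd_mul (mul_dvd_mul (hord _ (by omega)) (hord _ (by omega))) h1
    exact X_pow_dvd_iff.1 h3 (1 + 1) (by norm_num)

/-- If the product of two linear parts is nonzero, all coefficients strictly between are 2 and the
product of the inner pair is nonzero as well, so the argument repeats inwards. -/
theorem linear_part_between {i k : ℕ} (hi : coeff 1 (genSeries c π i) ≠ 0)
    {j : ℕ} (hj : j ≤ c.length + 1) (hj' : coeff 1 (genSeries c π j) ≠ 0) (hik : i < k + 1)
    (hkj : k + 1 < j) : hjCoeff c k = 2 ∧ coeff 1 (genSeries c π (k + 1)) ≠ 0 := by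
  induction hd : j - i using Nat.strong_induction_on generalizing i j with
  | _ d ih =>
    obtain ⟨n, rfl⟩ : ∃ n, j = i + n + 1 := ⟨j - i - 1, by omega⟩
    have h := linear_part_mul H hm hord (i := i) (n := n) (by omega) (by omega)
    split_ifs at h with hc
    · have hne := mul_ne_zero hi hj'
      rw [h] at hne
      obtain ⟨h1, h2⟩ := mul_ne_zero_iff.1 hne
      refine ⟨?_, ?_⟩
      · have := hc (k - i) (by omega)
        rwa [Nat.add_sub_cancel' (by omega)] at this
      · rcases (show k = i ∨ k + 1 = i + n ∨ i + 1 < k + 1 ∧ k + 1 < i + n by omega)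
          with rfl | hk | ⟨h3, h4⟩
        · exact h1
        · rwa [hk]
        · exact (ih _ (by omega) h1 (by omega) h2 h3 h4 rfl).2
    · exact absurd h (mul_ne_zero hi hj')

theorem linear_part_neighbours {k : ℕ} (hk : k < c.length) (hc : hjCoeff c k = 2)
    (h : coeff 1 (genSeries c π (k + 1)) ≠ 0) :
    coeff 1 (genSeries c π k) ≠ 0 ∧ coeff 1 (genSeries c π (k + 2)) ≠ 0 := by
  have h1 := linear_part_mul H hm hord (i := k) (n := 1) le_rfl (by omega)
  rw [if_pos (by intro t ht; obtain rfl : t = 0 := by omega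
                 simpa using hc)] at h1
  exact mul_ne_zero_iff.1 (h1 ▸ mul_ne_zero h h)

/-- The generators with nonzero linear part form a whole chain if two consecutive ones have
nonzero linear part. -/
theorem linear_part_ne_zero_iff_of_edge {e : ℕ} (he : e ≤ c.length)
    (h1 : coeff 1 (genSeries c π e) ≠ 0) (h2 : coeff 1 (genSeries c π (e + 1)) ≠ 0)
    {k : ℕ} (hk : k ≤ c.length + 1) : coeff 1 (genSeries c π k) ≠ 0 ↔
      ∃ f ≤ c.length, chainIndex c f = chainIndex c e ∧ (k = f ∨ k = f + 1) := by
  constructor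
  · intro h
    rcases (show k = e ∨ k = e + 1 ∨ e + 1 < k ∨ k < e by omega) with rfl | rfl | hke | hke
    · exact ⟨k, he, rfl, Or.inl rfl⟩
    · exact ⟨e, he, rfl, Or.inr rfl⟩
    · refine ⟨k - 1, by omega, chainIndex_eq_of_forall (by omega) fun t h3 h4 => ?_, by omega⟩
      exact (linear_part_between H hm hord h1 hk h (k := t) (by omega) (by omega)).1
    · refine ⟨k, by omega, (chainIndex_eq_of_forall (by omega) fun t h3 h4 => ?_).symm, by omega⟩
      exact (linear_part_between H hm hord h (by omega) h2 (k := t) (by omega) (by omega)).1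
  · rintro ⟨f, hf, hfe, hkf⟩
    suffices h : coeff 1 (genSeries c π f) ≠ 0 ∧ coeff 1 (genSeries c π (f + 1)) ≠ 0 by
      rcases hkf with rfl | rfl
      exacts [h.1, h.2]
    clear hkf
    rcases le_total e f with hef | hef
    · induction f, hef using Nat.le_induction with
      | base => exact ⟨h1, h2⟩
      | succ f hef ih =>
        have h3 := chainIndex_mono c hef
        rw [chainIndex_succ] at hfe
        have h4 : hjCoeff c f = 2 := by
          by_contra h
          rw [if_neg h] at hfe
          omega
        rw [if_pos h4, add_zero] at hfe
        have h5 := (ih (by omega) hfe).2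
        exact ⟨h5, (linear_part_neighbours H hm hord (by omega) h4 h5).2⟩
    · induction hd : e - f generalizing f with
      | zero => obtain rfl : e = f := by omega
                exact ⟨h1, h2⟩
      | succ d ih =>
        have h3 := chainIndex_mono c (show f + 1 ≤ e by omega)
        have h3' := chainIndex_succ c f
        have h4 : hjCoeff c f = 2 := by
          by_contra h
          rw [if_neg h] at h3'
          omega
        rw [if_pos h4, add_zero] at h3'
        have h5 := (ih (f + 1) (by omega) (by omega) (by omega) (by omega)).1
        exact ⟨(linear_part_neighbours H hm hord (by omega) h4 h5).1, h5⟩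

/-- An isolated generator with nonzero linear part is the only one. -/
theorem linear_part_ne_zero_iff_of_isolated {i : ℕ} (hi : i < c.length)
    (h1 : coeff 1 (genSeries c π (i + 1)) ≠ 0) (h0 : coeff 1 (genSeries c π i) = 0)
    (h2 : coeff 1 (genSeries c π (i + 2)) = 0) {k : ℕ} (hk : k ≤ c.length + 1) :
    coeff 1 (genSeries c π k) ≠ 0 ↔ k = i + 1 := by
  constructor
  · intro h
    by_contra hne
    rcases (show k = i ∨ k = i + 2 ∨ i + 2 < k ∨ k < i by omega) with rfl | rfl | hki | hki
    · exact h h0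
    · exact h h2
    · exact (linear_part_between H hm hord h1 hk h (k := i + 1) (by omega) (by omega)).2 h2
    · obtain ⟨i, rfl⟩ : ∃ i', i = i' + 1 := ⟨i - 1, by omega⟩
      exact (linear_part_between H hm hord h (by omega) h1 (k := i) (by omega) (by omega)).2 h0
  · rintro rfl
    exact h1

end LinearParts

/-! ### Torus invariance of the generic points. -/

section Torus

variable {K : Type*} [Field K] {p q m : ℕ} {c : List ℕ} (H : HJData p q c) {j s l : ℕ}
  {R : Type*} [CommRing R] [Algebra K R]

/-- This is the translate of the jet by the universal point of the torus. The grading by ℤ × ℤ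
separates the contributions of the monomials of a function. -/
theorem exists_twist (π : JetAlgebra K (CoordRing K p q) m →ₐ[K] R) :
    ∃ ψ : JetAlgebra K (CoordRing K p q) m →ₐ[K] AddMonoidAlgebra R (ℤ × ℤ),
      (∀ k (w : dualSemigroup p q), ψ (jetCoeff K m k (AddMonoidAlgebra.single w 1)) =
        AddMonoidAlgebra.single (w : ℤ × ℤ)
          (π (jetCoeff K m k (AddMonoidAlgebra.single w 1)))) ∧
      ∀ k a (w : dualSemigroup p q), (ψ (jetCoeff K m k a)).coeff (w : ℤ × ℤ) =
        a.coeff w • π (jetCoeff K m k (AddMonoidAlgebra.single w 1)) := by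
  set φ : dualSemigroup p q → (AddMonoidAlgebra R (ℤ × ℤ))⟦X⟧ := fun w =>
    PowerSeries.mk fun n => AddMonoidAlgebra.single (w : ℤ × ℤ) (coeff n (monSeries π w)) with hφ
  have h0 : truncMk m (φ 0) = 1 := by
    rw [← map_one (truncMk m), truncMk_eq_iff]
    intro n hn
    rw [coeff_mk, truncMk_eq_iff.1 (monSeries_zero π) n hn, coeff_one, coeff_one]
    split_ifs
    · rfl
    · exact AddMonoidAlgebra.single_zero _
  have hadd (v w : dualSemigroup p q) : truncMk m (φ (v + w)) = truncMk m (φ v * φ w) := by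
    rw [truncMk_eq_iff]
    intro n hn
    rw [coeff_mk, truncMk_eq_iff.1 (monSeries_add π v w) n hn, coeff_mul, coeff_mul]
    simp only [hφ, coeff_mk, AddMonoidAlgebra.single_mul_single]
    exact map_sum (AddMonoidAlgebra.singleAddHom ((v + w : dualSemigroup p q) : ℤ × ℤ)) _ _
  have h1 (k) (v : dualSemigroup p q) :
      jetLift (monomialJet φ h0 hadd) (jetCoeff K m k (AddMonoidAlgebra.single v 1)) =
        AddMonoidAlgebra.single (v : ℤ × ℤ)
          (π (jetCoeff K m k (AddMonoidAlgebra.single v 1))) := by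
    rw [jetLift_jetCoeff, monomialJet_single, truncCoeff_mk (Nat.lt_succ_iff.1 k.2), hφ,
      coeff_mk, coeff_jetSeries]
  refine ⟨jetLift (monomialJet φ h0 hadd), h1, fun k a w => ?_⟩
  induction a using AddMonoidAlgebra.induction_linear with
  | zero =>
    have : jetCoeff K m k (0 : CoordRing K p q) = 0 := by
      have := jetCoeff_smul (m := m) k (0 : K) (0 : CoordRing K p q)
      rwa [zero_smul, zero_smul] at this
    rw [this, map_zero]; simp
  | add a b ha hb =>
    rw [jetCoeff_add, map_add, AddMonoidAlgebra.coeff_add, Finsupp.add_apply, ha, hb,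
      AddMonoidAlgebra.coeff_add, Finsupp.add_apply, add_smul]
  | single v r =>
    have hr : (AddMonoidAlgebra.single v r : CoordRing K p q) =
        r • AddMonoidAlgebra.single v 1 := by simp
    rw [hr, jetCoeff_smul, map_smul, h1]
    by_cases hvw : v = w
    · subst hvw; simp
    · have : (v : ℤ × ℤ) ≠ w := fun h => hvw (Subtype.ext h)
      simp [hvw, this]

/-- The generic points of the contact loci are invariant under the torus: a coefficient of a function
vanishes there if and only if this holds for all of its monomials. -/
theorem resHom_contactPoint_eq_zero (V : ValidContact c m j s l) {k : Fin (m + 1)}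
    {a : CoordRing K p q} (h : resHom (contactPoint K H V) (jetCoeff K m k a) = 0)
    {w : dualSemigroup p q} (hw : a.coeff w ≠ 0) :
    resHom (contactPoint K H V) (jetCoeff K m k (AddMonoidAlgebra.single w 1)) = 0 := by
  set π := resHom (contactPoint K H V)
  obtain ⟨ψ, hψ1, hψ⟩ := exists_twist π
  have hmon (k n : ℕ) : coeff n (genSeries c ψ k) = 0 ↔ coeff n (genSeries c π k) = 0 := by
    by_cases hn : n ≤ m
    · rw [genSeries, monSeries, coeff_jetSeries' _ _ hn, genSeries, monSeries,
        coeff_jetSeries' _ _ hn, hψ1, AddMonoidAlgebra.single_eq_zero]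
    · rw [genSeries, monSeries, genSeries, monSeries, jetSeries, jetSeries, coeff_mk, coeff_mk,
        dif_neg (by omega), dif_neg (by omega)]
      exact iff_of_true rfl rfl
  have hdvd (k n : ℕ) (h : X ^ n ∣ genSeries c π k) : X ^ n ∣ genSeries c ψ k := by
    rw [X_pow_dvd_iff] at h ⊢
    exact fun i hi => (hmon k i).2 (h i hi)
  obtain ⟨⟨a1, a2⟩, a3, a4⟩ := (contactPoint_mem_iff H V (asIdeal_eq_ker_resHom _)).1
    (contactPoint_mem (K := K) H V)
  -- Twisting does not change the orders of the monomials, so the twisted jet lies in the same locus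
  -- and satisfies every equation that holds at its generic point.
  have hle : contactPoint K H V ≤ kerPoint ψ :=
    contactPoint_le H V ((contactPoint_mem_iff H V (π := ψ) rfl).2
      ⟨⟨hdvd _ _ a1, mt (hmon _ _).1 a2⟩, hdvd _ _ a3, mt (hmon _ _).1 a4⟩)
  have h1 : ψ (jetCoeff K m k a) = 0 := hle (resHom_eq_zero_iff.1 h)
  have h2 := hψ k a w
  rw [h1, AddMonoidAlgebra.coeff_zero, Finsupp.zero_apply] at h2
  exact (smul_eq_zero.1 h2.symm).resolve_left hw

end Torus

end ToricJets

namespace ToricJets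
open PowerSeries Cardinal

/-! ### The exceptional case of a single coefficient. -/

section TypeA

/-- As x has order at least 2, (x + ε t)^n is ε^n t^n modulo t^(n+1). The term added to z produces
exactly this when multiplied by the leading term of y, while y z itself vanishes. -/
theorem deformed_relation {F S : Type*} [Field F] [CommRing S] (i : F →+* S) (ε : S) {n s l : ℕ}
    (hs : 2 ≤ s) (hl : l ≤ n) {x y z : F⟦X⟧} (hx : X ^ s ∣ x) (hy : X ^ l ∣ y)
    (hy' : coeff l y ≠ 0) (hyz : X ^ (n + 1) ∣ y * z) :
    truncMk n (PowerSeries.map i y *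
      (PowerSeries.map i z + C (ε ^ n * i (coeff l y)⁻¹) * X ^ (n - l))) =
    truncMk n ((PowerSeries.map i x + C ε * X) ^ n) := by
  obtain ⟨g, hg⟩ := (pow_dvd_pow X hs).trans hx
  obtain ⟨v, hv⟩ := hy
  obtain ⟨w, hw⟩ := hyz
  have hv0 : constantCoeff v = coeff l y := by
    have := coeff_X_pow_mul v l 0
    rw [zero_add, coeff_zero_eq_constantCoeff_apply] at this
    rw [← this, ← hv]
  set v0 := coeff l y
  have h2 : X ∣ PowerSeries.map i v * C (ε ^ n * i v0⁻¹) - C (ε ^ n) := by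
    rw [X_dvd_iff, map_sub, map_mul, constantCoeff_C, constantCoeff_C]
    have : constantCoeff (PowerSeries.map i v) = i v0 := by
      rw [← coeff_zero_eq_constantCoeff_apply, PowerSeries.coeff_map,
        coeff_zero_eq_constantCoeff_apply, hv0]
    rw [this, mul_left_comm, ← map_mul, mul_inv_cancel₀ hy', map_one, mul_one, sub_self]
  have h3 : X ∣ (X * PowerSeries.map i g + C ε) ^ n - C ε ^ n := by
    refine dvd_trans ?_ (sub_dvd_pow_sub_pow _ _ n)
    rw [add_sub_cancel_right]
    exact dvd_mul_right _ _
  obtain ⟨b, hb⟩ := h2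
  obtain ⟨d, hd⟩ := h3
  rw [truncMk_eq_iff_dvd]
  refine ⟨PowerSeries.map i w + b - d, ?_⟩
  have e1 : PowerSeries.map i y * (PowerSeries.map i z + C (ε ^ n * i v0⁻¹) * X ^ (n - l)) =
      PowerSeries.map i (y * z) + X ^ n * (PowerSeries.map i v * C (ε ^ n * i v0⁻¹)) := by
    rw [mul_add, ← map_mul]
    congr 1
    conv_lhs => rw [hv]
    rw [map_mul, map_pow, PowerSeries.map_X]
    calc _ = X ^ (l + (n - l)) * (PowerSeries.map i v * C (ε ^ n * i v0⁻¹)) := by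
          rw [pow_add]; ring
      _ = _ := by rw [Nat.add_sub_cancel' hl]
  have e2 : (PowerSeries.map i x + C ε * X) ^ n = X ^ n * (X * PowerSeries.map i g + C ε) ^ n := by
    rw [← mul_pow, hg, map_mul, map_pow, PowerSeries.map_X]
    ring
  rw [e1, e2, hw, map_mul, map_pow, PowerSeries.map_X, sub_eq_iff_eq_add.1 hb,
    sub_eq_iff_eq_add.1 hd, map_pow]
  ring

variable {K : Type*} [Field K] {p q : ℕ} {c : List ℕ} (H : HJData p q c) {s l : ℕ}

set_option maxHeartbeats 1000000 in
/-- For a cyclic quotient singularity of type `A`, the contact loci with `s ≥ 2` are not dense in a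
component at the first level at which the equation is not homogeneous. -/
theorem contactPoint_not_minimal (hr : c.length = 1) (V : ValidContact c (hjCoeff c 0) 0 s l)
    (hs : 2 ≤ s) : ¬ Minimal (· ∈ centralFiber K p q (hjCoeff c 0)) (contactPoint K H V) := by
  set n := hjCoeff c 0 with hn
  set P := contactPoint K H V with hP
  set F := FractionRing (ResRing P)
  set π := fracHom P with hπ
  have hadd := V.add_le
  have hls := V.le
  obtain ⟨⟨a1, a2⟩, a3, a4⟩ := (contactPoint_mem_iff H V (asIdeal_eq_ker_fracHom P)).1
    (contactPoint_mem (K := K) H V)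
  rw [← hπ] at a1 a2 a3 a4
  have hord := X_pow_dvd_of_contact H V π a1 a2 a3 a4
  set ι : F⟦X⟧ →+* (Polynomial F)⟦X⟧ := PowerSeries.map Polynomial.C
  set ε : Polynomial F := Polynomial.X
  have hιX : ι X = X := PowerSeries.map_X _
  set v0 := coeff l (genSeries c π 2) with hv0'
  set x := ι (genSeries c π 1) + C ε * X with hx
  set y := ι (genSeries c π 2) with hy
  set z := ι (genSeries c π 0) + C (ε ^ n * Polynomial.C v0⁻¹) * X ^ (n - l) with hz
  have hrel : truncMk n (y * z) = truncMk n (x ^ n) := by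
    have h1 : X ^ (n + 1) ∣ genSeries c π 2 * genSeries c π 0 := by
      rw [mul_comm]
      refine X_pow_dvd_of_truncMk_eq (genSeries_mul_two H π 0 V.lt).symm le_rfl ?_
      refine (pow_dvd_pow X ?_).trans ((pow_mul (X : F⟦X⟧) s n).symm ▸ pow_dvd_pow_of_dvd a1 n)
      nlinarith [two_le_hjCoeff H.two_le 0]
    exact deformed_relation Polynomial.C ε hs (by omega) a1 a3 a4 h1
  obtain ⟨ψ, e1, e2, e0⟩ := exists_jet_of_length_eq_one (K := K) (m := n) H hr hrel
  have hC (k : ℕ) (f : F⟦X⟧) : Polynomial.aeval (0 : F) (coeff k (ι f)) = coeff k f := by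
    rw [PowerSeries.coeff_map, Polynomial.aeval_C]; rfl
  -- At ε = 0 the deformed jet becomes the jet at the contact point, so it defines a generization of
  -- that point.
  set ev : Polynomial F →ₐ[K] F := (Polynomial.aeval (0 : F)).restrictScalars K with hev
  have hev' (k : ℕ) (f : F⟦X⟧) : ev (coeff k (ι f)) = coeff k f := hC k f
  have hev0 : ev ε = 0 := Polynomial.aeval_X (0 : F)
  have h0 : ∀ k ≤ n, coeff k (genSeries c (ev.comp ψ) 0) = coeff k (genSeries c π 0) := by
    intro k hk
    rw [genSeries, monSeries, coeff_jetSeries_comp, truncMk_eq_iff.1 e0 k hk, hz, map_add, map_add,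
      hev', coeff_C_mul, map_mul, map_mul, map_pow, hev0,
      zero_pow (by have := two_le_hjCoeff H.two_le 0; omega), zero_mul, zero_mul, add_zero]
  have h1 : ∀ k ≤ n, coeff k (genSeries c (ev.comp ψ) 1) = coeff k (genSeries c π 1) := by
    intro k hk
    rw [genSeries, monSeries, coeff_jetSeries_comp, truncMk_eq_iff.1 e1 k hk, hx, map_add, map_add,
      hev', coeff_C_mul, map_mul, hev0, zero_mul, add_zero]
  have h2 : ∀ k ≤ n, coeff k (genSeries c (ev.comp ψ) 2) = coeff k (genSeries c π 2) := by
    intro k hk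
    rw [genSeries, monSeries, coeff_jetSeries_comp, truncMk_eq_iff.1 e2 k hk, hy, hev']
  have hall : ∀ k ≤ c.length + 1, ∀ i ≤ n,
      coeff i (genSeries c (ev.comp ψ) k) = coeff i (genSeries c π k) := by
    intro k hk i hi
    rcases (show k = 0 ∨ k = 1 ∨ k = 2 by omega) with rfl | rfl | rfl
    exacts [h0 i hi, h1 i hi, h2 i hi]
  have hdvd (k d : ℕ) (hk : k ≤ c.length + 1) (hd : d ≤ n + 1) (h : X ^ d ∣ genSeries c π k) :
      X ^ d ∣ genSeries c (ev.comp ψ) k := by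
    rw [X_pow_dvd_iff] at h ⊢
    intro i hi
    rw [hall k hk i (by omega), h i hi]
  have heq : π = ev.comp ψ := jet_unique H V a1 a2 a3 a4
    (hdvd 1 s (by omega) (by omega) a1) (hdvd 2 l (by omega) (by omega) a3)
    fun k hk i _ hi => (hall k hk i hi).symm
  intro hmin
  have hQ : kerPoint ψ ∈ centralFiber K p q n := by
    rw [mem_centralFiber_iff H (π := ψ) rfl]
    intro k hk
    have hn2 := two_le_hjCoeff H.two_le 0
    have hX (f : F⟦X⟧) (h : X ^ s ∣ f) : X ∣ ι f := by
      obtain ⟨f', rfl⟩ := (dvd_pow_self X (by omega : s ≠ 0)).trans h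
      rw [map_mul, hιX]; exact dvd_mul_right _ _
    have htr {f g : (Polynomial F)⟦X⟧} (h : truncMk n f = truncMk n g) (hg : X ∣ g) : X ∣ f := by
      have := X_pow_dvd_of_truncMk_eq (s := 1) h.symm (by omega) (by simpa using hg)
      simpa using this
    rcases (show k = 0 ∨ k = 1 ∨ k = 2 by omega) with rfl | rfl | rfl
    · exact htr e0 (dvd_add (hX _ (hord _ (by omega)))
        ((dvd_pow_self X (by omega)).mul_left _))
    · exact htr e1 (dvd_add (hX _ (hord _ (by omega))) (dvd_mul_left _ _))
    · exact htr e2 (hX _ (hord _ (by omega)))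
  have hle : kerPoint ψ ≤ P := by
    intro u hu
    rw [asIdeal_eq_ker_fracHom P, RingHom.mem_ker, ← hπ, heq]
    change ev (ψ u) = 0
    rw [show ψ u = 0 from hu, map_zero]
  have hge := hmin.2 hQ hle
  -- The linear coefficient of x_1 is 0 at the contact point and ε for the deformed jet, so the
  -- generization is strict.
  have hc1 : coeff 1 (genSeries c π 1) = 0 := X_pow_dvd_iff.1 a1 1 (by omega)
  have hc2 := hge ((jetCoeff_mem_iff (asIdeal_eq_ker_fracHom P) ⟨1, by omega⟩ _).2 hc1)
  have hc3 := (jetCoeff_mem_iff (P := kerPoint ψ) (π := ψ) rfl ⟨1, by omega⟩ _).1 hc2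
  have hc4 : coeff 1 (genSeries c ψ 1) = 0 := hc3
  rw [truncMk_eq_iff.1 e1 1 (by omega), hx, map_add, PowerSeries.coeff_map, hc1, map_zero, zero_add,
    coeff_C_mul, coeff_one_X, mul_one] at hc4
  exact Polynomial.X_ne_zero hc4

end TypeA

end ToricJets

namespace ToricJets

/-! ### Reconstruction of c from the path of chains. -/

section Combinatorics

/-- An injective map that takes neighbours to neighbours cannot turn back, so its direction is fixed
by the first step. -/
theorem path_rigidity {N : ℕ} {g : ℕ → ℕ} (hg : ∀ u ≤ N, g u ≤ N)
    (hinj : ∀ u ≤ N, ∀ v ≤ N, g u = g v → u = v)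
    (hadj : ∀ u < N, g (u + 1) = g u + 1 ∨ g u = g (u + 1) + 1) :
    (∀ u ≤ N, g u = u) ∨ ∀ u ≤ N, g u = N - u := by
  rcases Nat.eq_zero_or_pos N with rfl | hN
  · left
    intro u hu
    have := hg u hu
    omega
  · rcases hadj 0 hN with h0 | h0
    · have hup : ∀ u < N, g u = g 0 + u ∧ g (u + 1) = g 0 + (u + 1) := by
        intro u hu
        induction u with
        | zero => exact ⟨rfl, h0⟩
        | succ u ih =>
          obtain ⟨h1, h2⟩ := ih (by omega)
          refine ⟨h2, ?_⟩
          rcases hadj (u + 1) hu with h | h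
          · omega
          · have := hinj u (by omega) (u + 1 + 1) (by omega) (by omega)
            omega
      have h1 := (hup (N - 1) (by omega)).2
      have h2 := hg N le_rfl
      rw [Nat.sub_add_cancel hN] at h1
      left
      intro u hu
      rcases hu.lt_or_eq with hu | rfl
      · have := (hup u hu).1
        omega
      · omega
    · have hup : ∀ u < N, g u + u = g 0 ∧ g (u + 1) + (u + 1) = g 0 := by
        intro u hu
        induction u with
        | zero => exact ⟨rfl, h0.symm⟩
        | succ u ih =>
          obtain ⟨h1, h2⟩ := ih (by omega)
          refine ⟨h2, ?_⟩
          rcases hadj (u + 1) hu with h | h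
          · have := hinj u (by omega) (u + 1 + 1) (by omega) (by omega)
            omega
          · omega
      have h1 := (hup (N - 1) (by omega)).2
      have h2 := hg 0 (by omega)
      rw [Nat.sub_add_cancel hN] at h1
      right
      intro u hu
      rcases hu.lt_or_eq with hu | rfl
      · have := (hup u hu).1
        omega
      · omega

/-- The sum of the indices of the two chains that meet in the interior generator with index
`j + 1`. -/
def chainKey (c : List ℕ) (j : ℕ) : ℕ := chainIndex c j + chainIndex c (j + 1)

/-- The coefficients together with the position of their generators in the chains. -/
def keyedCoeffs (c : List ℕ) : List (ℕ × ℕ) :=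
  (List.range c.length).map fun j => (chainKey c j, hjCoeff c j)

theorem map_snd_keyedCoeffs (c : List ℕ) : (keyedCoeffs c).map Prod.snd = c := by
  refine List.ext_getElem (by simp [keyedCoeffs]) fun i h1 h2 => ?_
  simp only [keyedCoeffs, List.map_map, List.getElem_map, List.getElem_range, Function.comp,
    hjCoeff, List.getD_eq_getElem _ _ h2]

/-- Keys never decrease, and two of them agree only for generators inside the same chain, where both
coefficients are 2. Hence the sorted list of pairs depends only on its multiset. -/
theorem chainKey_lt_or_eq (c : List ℕ) {i j : ℕ} (hij : i < j) : chainKey c i < chainKey c j ∨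
    chainKey c i = chainKey c j ∧ hjCoeff c i = hjCoeff c j := by
  have h1 := chainIndex_mono c (show i ≤ i + 1 by omega)
  have h2 := chainIndex_mono c (show i + 1 ≤ j by omega)
  have h3 := chainIndex_mono c (show j ≤ j + 1 by omega)
  have h4 := chainIndex_succ c i
  have h5 := chainIndex_succ c j
  unfold chainKey
  split_ifs at h4 h5 <;> omega

theorem pairwise_keyedCoeffs (c : List ℕ) : (keyedCoeffs c).Pairwise
    fun x y => x.1 < y.1 ∨ x.1 = y.1 ∧ x.2 = y.2 := by
  rw [keyedCoeffs, List.pairwise_map]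
  exact List.pairwise_lt_range.imp fun h => chainKey_lt_or_eq c h

theorem eq_of_perm_keyedCoeffs {c c' : List ℕ} (h : (keyedCoeffs c').Perm (keyedCoeffs c)) :
    c' = c := by
  have := h.eq_of_pairwise (fun x y _ _ h1 h2 => by ext <;> omega)
    (pairwise_keyedCoeffs c') (pairwise_keyedCoeffs c)
  rw [← map_snd_keyedCoeffs c', this, map_snd_keyedCoeffs]

theorem chainKey_le (c : List ℕ) {j : ℕ} (hj : j < c.length) :
    chainKey c j ≤ 2 * chainIndex c c.length := by
  have h1 := chainIndex_mono c (show j ≤ c.length by omega)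
  have h2 := chainIndex_mono c (show j + 1 ≤ c.length by omega)
  unfold chainKey
  omega

theorem eq_reverse_of_perm_keyedCoeffs {c c' : List ℕ} (h : (keyedCoeffs c').Perm
    ((keyedCoeffs c).map fun x => (2 * chainIndex c c.length - x.1, x.2))) : c' = c.reverse := by
  have hp : ((keyedCoeffs c).map fun x => (2 * chainIndex c c.length - x.1, x.2)).reverse.Pairwise
      fun x y => x.1 < y.1 ∨ x.1 = y.1 ∧ x.2 = y.2 := by
    rw [List.pairwise_reverse, keyedCoeffs, List.map_map, List.pairwise_map]
    refine (List.pairwise_lt_range (n := c.length)).imp_of_mem fun {i j} hi hj hij => ?_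
    rw [List.mem_range] at hi hj
    have := chainKey_le c hi
    have := chainKey_le c hj
    have := chainKey_lt_or_eq c hij
    simp only [Function.comp]
    omega
  have := (h.trans (List.reverse_perm _).symm).eq_of_pairwise
    (fun x y _ _ h1 h2 => by ext <;> omega) (pairwise_keyedCoeffs c') hp
  rw [← map_snd_keyedCoeffs c', this, List.map_reverse, List.map_map]
  exact congrArg List.reverse (map_snd_keyedCoeffs c)

theorem exists_edge_of_le (c : List ℕ) {n u : ℕ} (hu : u ≤ chainIndex c n) :
    ∃ e ≤ n, chainIndex c e = u := by
  induction n with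
  | zero =>
    have : chainIndex c 0 = 0 := rfl
    exact ⟨0, le_rfl, by omega⟩
  | succ n ih =>
    rcases Nat.lt_or_ge (chainIndex c n) u with h | h
    · refine ⟨n + 1, le_rfl, ?_⟩
      rw [chainIndex_succ] at hu ⊢
      split_ifs at hu ⊢ <;> omega
    · obtain ⟨e, he, h⟩ := ih h
      exact ⟨e, by omega, h⟩

theorem exists_step_of_lt (c : List ℕ) {n u : ℕ} (hu : u < chainIndex c n) :
    ∃ e < n, chainIndex c e = u ∧ chainIndex c (e + 1) = u + 1 := by
  induction n with
  | zero => exact absurd hu (Nat.not_lt_zero _)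
  | succ n ih =>
    rcases Nat.lt_or_ge u (chainIndex c n) with h | h
    · obtain ⟨e, he, h⟩ := ih h
      exact ⟨e, by omega, h⟩
    · refine ⟨n, by omega, ?_⟩
      rw [chainIndex_succ] at hu ⊢
      split_ifs at hu ⊢ <;> omega

/-- A generator with coefficient other than 2 joins two consecutive chains, so g preserves adjacency
and is the identity or the reflection. Accordingly τ carries the multiset of keyed coefficients to
itself or to its reflection, and sorting restores the list. -/
theorem eq_or_eq_reverse_of_chains {c c' : List ℕ} {g : ℕ → ℕ} (τ : Fin c.length ≃ Fin c'.length)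
    (hτ : ∀ j, hjCoeff c' (τ j) = hjCoeff c j)
    (hg : ∀ j : Fin c.length, g '' {chainIndex c j, chainIndex c (j + 1)} =
      {chainIndex c' (τ j), chainIndex c' (τ j + 1)})
    (hinj : ∀ u ≤ chainIndex c c.length, ∀ v ≤ chainIndex c c.length, g u = g v → u = v)
    (hpos : 0 < c.length) : c' = c ∨ c' = c.reverse := by
  have hlen : c'.length = c.length := (Fin.equiv_iff_eq.1 ⟨τ⟩).symm
  -- The last chain index counts the coefficients other than 2, and τ preserves coefficients.
  have hN : chainIndex c' c'.length = chainIndex c c.length := by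
    unfold chainIndex
    rw [Finset.sum_range, Finset.sum_range, ← τ.sum_comp]
    simp only [hτ]
  set N := chainIndex c c.length with hNdef
  have hg' (j : ℕ) (hj : j < c.length) := hg ⟨j, hj⟩
  simp only [Set.image_pair, Set.pair_eq_pair_iff] at hg'
  have hle : ∀ u ≤ N, g u ≤ N := by
    intro u hu
    have hle' (j : Fin c.length) : chainIndex c' (τ j) ≤ N ∧ chainIndex c' (τ j + 1) ≤ N := by
      have := (τ j).isLt
      rw [← hN]
      exact ⟨chainIndex_mono c' (by omega), chainIndex_mono c' (by omega)⟩
    obtain ⟨e, he, rfl⟩ := exists_edge_of_le c hu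
    rcases Nat.eq_zero_or_pos e with rfl | he0
    · have h1 := hg' 0 hpos
      have h2 := hle' ⟨0, hpos⟩
      rcases h1 with h1 | h1 <;> omega
    · obtain ⟨e, rfl⟩ : ∃ e', e = e' + 1 := ⟨e - 1, by omega⟩
      have h1 := hg' e (by omega)
      have h2 := hle' ⟨e, by omega⟩
      rcases h1 with h1 | h1 <;> omega
  have hadj : ∀ u < N, g (u + 1) = g u + 1 ∨ g u = g (u + 1) + 1 := by
    intro u hu
    obtain ⟨e, he, h1, h2⟩ := exists_step_of_lt c hu
    have h3 := hg' e he
    have h4 := chainIndex_succ c' (τ ⟨e, he⟩)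
    rw [h1, h2] at h3
    have h5 := hinj u (by omega) (u + 1) (by omega)
    split_ifs at h4 <;> omega
  have hkey (j : Fin c.length) : chainKey c' (τ j) =
      g (chainIndex c j) + g (chainIndex c (j + 1)) := by
    have := hg' j j.isLt
    unfold chainKey
    rcases this with h | h
    · rw [h.1, h.2]
    · rw [h.1, h.2, add_comm]
  have hperm : (keyedCoeffs c').Perm ((List.finRange c.length).map
      fun j : Fin c.length => (g (chainIndex c j) + g (chainIndex c (j + 1)), hjCoeff c j)) := by
    have h1 : keyedCoeffs c' = (List.finRange c'.length).map
        fun j : Fin c'.length => (chainKey c' j, hjCoeff c' j) := by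
      rw [keyedCoeffs, ← List.map_coe_finRange_eq_range, List.map_map]; rfl
    have h2 : (List.finRange c.length).map
        (fun j : Fin c.length => (g (chainIndex c j) + g (chainIndex c (j + 1)), hjCoeff c j)) =
        ((List.finRange c.length).map τ).map fun j : Fin c'.length => (chainKey c' j, hjCoeff c' j) := by
      rw [List.map_map]
      refine List.map_congr_left fun j _ => ?_
      simp only [Function.comp, hkey, hτ]
    rw [h1, h2]
    refine List.Perm.map _ ((List.perm_ext_iff_of_nodup (List.nodup_finRange _)
      ((List.nodup_finRange _).map τ.injective)).2 fun j => ?_)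
    simp only [List.mem_finRange, List.mem_map, true_and, true_iff]
    exact ⟨τ.symm j, τ.apply_symm_apply j⟩
  have hc : keyedCoeffs c = (List.finRange c.length).map
      fun j : Fin c.length => (chainKey c j, hjCoeff c j) := by
    rw [keyedCoeffs, ← List.map_coe_finRange_eq_range, List.map_map]; rfl
  have hb (j : Fin c.length) : chainIndex c j ≤ N ∧ chainIndex c (j + 1) ≤ N :=
    ⟨chainIndex_mono c (by omega), chainIndex_mono c (by omega)⟩
  rcases path_rigidity hle hinj hadj with h | h
  · left
    refine eq_of_perm_keyedCoeffs (hperm.trans (List.Perm.of_eq ?_))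
    rw [hc]
    refine List.map_congr_left fun j _ => ?_
    rw [h _ (hb j).1, h _ (hb j).2]; rfl
  · right
    refine eq_reverse_of_perm_keyedCoeffs (hperm.trans (List.Perm.of_eq ?_))
    rw [hc, List.map_map]
    refine List.map_congr_left fun j _ => ?_
    have := hb j
    simp only [Function.comp, h _ (hb j).1, h _ (hb j).2, chainKey, Prod.mk.injEq, and_true]
    omega

end Combinatorics

end ToricJets

namespace ToricJets
open PowerSeries Cardinal

/-! ### Vertices of the subgraphs and the chains at level 2. -/

section Vertices

variable {K : Type*} [Field K] {p q m : ℕ} {c : List ℕ} (H : HJData p q c) {j s l : ℕ}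

theorem get_eq_hjCoeff (c : List ℕ) (j : Fin c.length) : c.get j = hjCoeff c j := by
  rw [hjCoeff, List.getD_eq_getElem _ _ j.isLt]; rfl

theorem mem_subgraphVertices_iff {v : Vertex K p q} {j : Fin c.length} :
    v ∈ subgraphVertices K p q c j ↔ ∃ s l, ∃ V : ValidContact c v.level j s l,
      v.carrier = closure {contactPoint K H V} := by
  constructor
  · rintro ⟨s, l, h1, h2, h3, h4, h5⟩
    rw [get_eq_hjCoeff, le_min_iff] at h4
    have V : ValidContact c v.level j s l := ⟨j.isLt, h1, h2, h3, h4.1, by omega⟩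
    exact ⟨s, l, V, by rw [h5, contactClosure_eq H V]⟩
  · rintro ⟨s, l, V, h⟩
    refine ⟨s, l, V.one_le, V.two_mul_le, V.le, le_min ?_ ?_, by rw [h, contactClosure_eq H V]⟩
    · rw [get_eq_hjCoeff]; exact V.le_mul
    · have := V.add_le; omega

theorem Vertex.exists_minimal (v : Vertex K p q) : ∃ P, v.carrier = closure {P} ∧
    Minimal (· ∈ centralFiber K p q v.level) P :=
  (maximal_irreducible_iff (isClosed_centralFiber K p q v.level)).1 v.isComponent

theorem Vertex.minimal_of_carrier_eq {v : Vertex K p q} {P} (h : v.carrier = closure {P}) :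
    Minimal (· ∈ centralFiber K p q v.level) P := by
  obtain ⟨Q, hQ, hmin⟩ := v.exists_minimal
  rw [h, closure_singleton_eq_iff] at hQ
  rwa [hQ]

/-- The vertex with a given generic point. -/
def vertexOfMinimal (hm : 1 ≤ m) {P : JetScheme K (CoordRing K p q) m}
    (hP : Minimal (· ∈ centralFiber K p q m) P) : Vertex K p q :=
  ⟨m, hm, closure {P}, (maximal_irreducible_iff (isClosed_centralFiber K p q m)).2 ⟨P, rfl, hP⟩⟩

theorem vertexOfMinimal_mem (hm : 1 ≤ m) (V : ValidContact c m j s l)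
    (hP : Minimal (· ∈ centralFiber K p q m) (contactPoint K H V)) :
    vertexOfMinimal hm hP ∈ subgraphVertices K p q c ⟨j, V.lt⟩ :=
  (mem_subgraphVertices_iff H).2 ⟨s, l, V, rfl⟩

theorem contactPoint_params {s' l' : ℕ} (V : ValidContact c m j s l)
    (V' : ValidContact c m j s' l') (h : contactPoint K H V = contactPoint K H V') :
    s = s' ∧ l = l' := by
  obtain ⟨⟨a1, a2⟩, a3, a4⟩ := (contactPoint_mem_iff H V (asIdeal_eq_ker_resHom _)).1
    (contactPoint_mem (K := K) H V)
  obtain ⟨⟨b1, b2⟩, b3, b4⟩ := (contactPoint_mem_iff H V' (asIdeal_eq_ker_resHom _)).1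
    (contactPoint_mem (K := K) H V')
  rw [h] at a1 a2 a3 a4
  exact ⟨le_antisymm (le_of_X_pow_dvd a1 b2) (le_of_X_pow_dvd b1 a2),
    le_antisymm (le_of_X_pow_dvd a3 b4) (le_of_X_pow_dvd b3 a4)⟩

end Vertices

section Chains

variable {K : Type*} [Field K] {p q m : ℕ} {c : List ℕ}

/-- The generators with nonzero linear part at the point `P` form the chain with index `u`. -/
def HasChain (c : List ℕ) (P : JetScheme K (CoordRing K p q) m) (u : ℕ) : Prop :=
  ∀ k ≤ c.length + 1, coeff 1 (genSeries c (resHom P) k) ≠ 0 ↔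
    ∃ f ≤ c.length, chainIndex c f = u ∧ (k = f ∨ k = f + 1)

/-- Both ends of an edge of chain u lie in chain u', which by monotonicity of `chainIndex` forces
the edge to belong to u'. -/
theorem HasChain.unique {P : JetScheme K (CoordRing K p q) m} {u u' : ℕ} (h : HasChain c P u)
    (h' : HasChain c P u') (hu : u ≤ chainIndex c c.length) : u = u' := by
  obtain ⟨e, he, rfl⟩ := exists_edge_of_le c hu
  obtain ⟨f, hf, rfl, hef⟩ := (h' e (by omega)).1 ((h e (by omega)).2 ⟨e, he, rfl, Or.inl rfl⟩)
  obtain ⟨f', hf', hff, hef'⟩ :=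
    (h' (e + 1) (by omega)).1 ((h (e + 1) (by omega)).2 ⟨e, he, rfl, Or.inr rfl⟩)
  have := chainIndex_mono c (show f ≤ e by omega)
  have := chainIndex_mono c (show e ≤ f' by omega)
  omega

variable (H : HJData p q c) {j l : ℕ}

theorem linear_part_contactPoint (V : ValidContact c m j 1 l) :
    coeff 1 (genSeries c (resHom (contactPoint K H V)) (j + 1)) ≠ 0 ∧
    (coeff 1 (genSeries c (resHom (contactPoint K H V)) (j + 2)) ≠ 0 ↔ l = 1) ∧
    (coeff 1 (genSeries c (resHom (contactPoint K H V)) j) ≠ 0 ↔ swapOrder c m j 1 l = 1) := by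
  obtain ⟨⟨a1, a2⟩, a3, a4⟩ := (contactPoint_mem_iff H V (asIdeal_eq_ker_resHom _)).1
    (contactPoint_mem (K := K) H V)
  obtain ⟨b1, b2⟩ := contactPoint_swap (K := K) H V
  have h1 := (V.le_swapOrder H).1
  have h2 := V.le
  refine ⟨a2, ⟨fun h => ?_, ?_⟩, ⟨fun h => ?_, fun h => ?_⟩⟩
  · have := le_of_X_pow_dvd a3 h; omega
  · rintro rfl; exact a4
  · have := le_of_X_pow_dvd b1 h; omega
  · rwa [h] at b2

theorem contactPoint_order (V : ValidContact c m j 1 l) :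
    ∀ k ≤ c.length + 1, X ∣ genSeries c (resHom (contactPoint K H V)) k :=
  (mem_centralFiber_iff H (asIdeal_eq_ker_resHom _)).1 (contactPoint_mem_centralFiber H V)

theorem hasChain_of_eq_one (hm : 2 ≤ m) (V : ValidContact c m j 1 1) :
    HasChain c (contactPoint K H V) (chainIndex c (j + 1)) := fun k hk =>
  have h := linear_part_contactPoint (K := K) H V
  have hj := V.lt
  linear_part_ne_zero_iff_of_edge H hm (contactPoint_order H V) (by omega) h.1 (h.2.1.2 rfl) hk

theorem hasChain_of_swapOrder_eq_one (hm : 2 ≤ m) (V : ValidContact c m j 1 l)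
    (hl : swapOrder c m j 1 l = 1) : HasChain c (contactPoint K H V) (chainIndex c j) :=
  fun k hk =>
  have h := linear_part_contactPoint (K := K) H V
  have hj := V.lt
  linear_part_ne_zero_iff_of_edge H hm (contactPoint_order H V) (by omega) (h.2.2.2 hl) h.1 hk

/-- The generic points of the contact loci with `s = 1` are determined by the set of generators with
nonzero linear part, if this set has at least two elements. -/
theorem contactPoint_eq_of_linear_part (hm : 2 ≤ m) {j' l' e : ℕ} (V : ValidContact c m j 1 l)
    (V' : ValidContact c m j' 1 l')
    (h : ∀ k ≤ c.length + 1, coeff 1 (genSeries c (resHom (contactPoint K H V)) k) ≠ 0 ↔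
      coeff 1 (genSeries c (resHom (contactPoint K H V')) k) ≠ 0) (he : e ≤ c.length)
    (h1 : coeff 1 (genSeries c (resHom (contactPoint K H V)) e) ≠ 0)
    (h2 : coeff 1 (genSeries c (resHom (contactPoint K H V)) (e + 1)) ≠ 0) :
    contactPoint K H V = contactPoint K H V' := by
  by_cases hk : ∃ k < c.length, coeff 1 (genSeries c (resHom (contactPoint K H V)) (k + 1)) ≠ 0 ∧
      coeff 1 (genSeries c (resHom (contactPoint K H V)) (k + 2)) ≠ 0
  · obtain ⟨k, hk, h3, h4⟩ := hk
    have hc := two_le_hjCoeff H.two_le k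
    -- Both points lie in the locus with s = l = 1 at k, and being minimal both are its generic
    -- point.
    have W : ValidContact c m k 1 1 := ⟨hk, le_rfl, by omega, le_rfl, by omega, by omega⟩
    have key {j l : ℕ} (V : ValidContact c m j 1 l)
        (h3 : coeff 1 (genSeries c (resHom (contactPoint K H V)) (k + 1)) ≠ 0)
        (h4 : coeff 1 (genSeries c (resHom (contactPoint K H V)) (k + 2)) ≠ 0) :
        contactPoint K H V = contactPoint K H W := by
      have hle : contactPoint K H W ≤ contactPoint K H V := by
        refine contactPoint_le H W ((contactPoint_mem_iff H W (asIdeal_eq_ker_resHom _)).2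
          ⟨⟨?_, h3⟩, ?_, h4⟩) <;> rw [pow_one] <;> exact contactPoint_order H V _ (by omega)
      exact ((contactPoint_minimal H V (Or.inr rfl)).eq_of_le
        (contactPoint_mem_centralFiber H W) hle).symm
    rw [key V h3 h4, key V' ((h _ (by omega)).1 h3) ((h _ (by omega)).1 h4)]
  -- Otherwise the only edge of the support is the first one. Then j = j' = 0, and the order 1 of
  -- x_0 determines l.
  · push Not at hk
    have hpos := H.pos
    have he0 : e = 0 := by
      by_contra h0
      obtain ⟨k, rfl⟩ : ∃ k, e = k + 1 := ⟨e - 1, by omega⟩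
      exact h2 (hk k (by omega) h1)
    subst he0
    have hc2 : coeff 1 (genSeries c (resHom (contactPoint K H V)) 2) = 0 := hk 0 hpos h2
    have hj0 {j l : ℕ} (V' : ValidContact c m j 1 l)
        (h : ∀ k ≤ c.length + 1, coeff 1 (genSeries c (resHom (contactPoint K H V)) k) ≠ 0 ↔
          coeff 1 (genSeries c (resHom (contactPoint K H V')) k) ≠ 0) : j = 0 := by
      by_contra h0
      have hj := V'.lt
      have h3 := (linear_part_contactPoint (K := K) H V').1
      rcases (show j = 1 ∨ 1 < j by omega) with rfl | hj1
      · exact (h 2 (by omega)).2 h3 hc2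
      · exact (linear_part_between H hm (contactPoint_order H V') ((h 1 (by omega)).1 h2)
          (by omega) h3 (k := 1) (by omega) (by omega)).2
          (by by_contra h4; exact (h 2 (by omega)).2 h4 hc2)
    obtain rfl := hj0 V fun _ _ => Iff.rfl
    obtain rfl := hj0 V' h
    have e1 := (linear_part_contactPoint (K := K) H V).2.2.1 h1
    have e2 := (linear_part_contactPoint (K := K) H V').2.2.1 ((h 0 (by omega)).1 h1)
    have e3 := (V.le_swapOrder H).2
    have e4 := (V'.le_swapOrder H).2
    obtain rfl : l = l' := by omega
    rfl

end Chains

/-! ### Recovering the coefficients by counting vertices. -/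

section Counting

variable {K : Type*} [Field K] {p q : ℕ} {c : List ℕ} (H : HJData p q c)
  {p' q' : ℕ} {c' : List ℕ} (H' : HJData p' q' c')

/-- The parameters of the vertices of a subgraph at a given level. -/
def vertexParams (K : Type*) [Field K] (H : HJData p q c) (m j : ℕ) : Set (ℕ × ℕ) :=
  {x | ∃ V : ValidContact c m j x.1 x.2, Minimal (· ∈ centralFiber K p q m) (contactPoint K H V)}

theorem finite_vertexParams (m j : ℕ) : (vertexParams K H m j).Finite := by
  refine ((Set.finite_Iic (m + 1)).prod (Set.finite_Iic (m + 1))).subset ?_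
  rintro ⟨s, l⟩ ⟨V, -⟩
  have := V.add_le
  exact ⟨Set.mem_Iic.2 (by omega), Set.mem_Iic.2 (by omega)⟩

theorem ncard_vertexParams {m : ℕ} (hm : 1 ≤ m) (j : Fin c.length) :
    (vertexParams K H m j).ncard =
      {v | v ∈ subgraphVertices K p q c j ∧ v.level = m}.ncard := by
  refine Set.ncard_congr (fun x hx => vertexOfMinimal hm hx.choose_spec) ?_ ?_ ?_
  · intro x hx
    exact ⟨vertexOfMinimal_mem H hm hx.choose hx.choose_spec, rfl⟩
  · intro x y hx hy h
    have h2 : closure {contactPoint K H hx.choose} = closure {contactPoint K H hy.choose} := by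
      simpa [vertexOfMinimal] using h
    obtain ⟨h3, h4⟩ := contactPoint_params H _ _ (closure_singleton_eq_iff.1 h2)
    exact Prod.ext h3 h4
  · rintro v ⟨hv, rfl⟩
    obtain ⟨s, l, V, hV⟩ := (mem_subgraphVertices_iff H).1 hv
    have hx : (s, l) ∈ vertexParams K H v.level j := ⟨V, Vertex.minimal_of_carrier_eq hV⟩
    refine ⟨(s, l), hx, ?_⟩
    obtain ⟨m, hm, S, hS⟩ := v
    simp only [vertexOfMinimal, Vertex.mk.injEq, heq_eq_eq, true_and]
    exact hV.symm

theorem JetGraphIso.ncard_eq (φ : JetGraphIso K p q c p' q' c') (m : ℕ) (j : Fin c.length) :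
    {v | v ∈ subgraphVertices K p q c j ∧ v.level = m}.ncard =
      {v | v ∈ subgraphVertices K p' q' c' (φ.indexEquiv j) ∧ v.level = m}.ncard := by
  refine Set.ncard_congr (fun v _ => φ.graphIso v) ?_ ?_ ?_
  · rintro v ⟨h1, h2⟩
    exact ⟨φ.map_subgraph j ▸ Set.mem_image_of_mem _ h1, by rw [φ.level_eq, h2]⟩
  · intro v w _ _ h
    exact φ.graphIso.injective h
  · rintro w ⟨h1, h2⟩
    rw [← φ.map_subgraph j] at h1
    obtain ⟨v, hv, rfl⟩ := h1
    exact ⟨v, ⟨hv, by rw [← φ.level_eq, h2]⟩, rfl⟩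

/-- At the level of the smaller coefficient c_j, all parameters of vertices on the left also occur
on the right, and (1, c_j) occurs only on the right. A parameter could only be lost for r = 1 and s
≥ 2, but there `contactPoint_not_minimal` excludes it on the left at this very level. -/
theorem ncard_vertexParams_lt {j j' : ℕ} (hj : j < c.length) (hj' : j' < c'.length)
    (hlen : c'.length = c.length) (hlt : hjCoeff c j < hjCoeff c' j') :
    (vertexParams K H (hjCoeff c j) j).ncard < (vertexParams K H' (hjCoeff c j) j').ncard := by
  have hc := two_le_hjCoeff H.two_le j
  refine Set.ncard_lt_ncard ⟨?_, fun hsub => ?_⟩ (finite_vertexParams H' _ _)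
  · rintro ⟨s, l⟩ ⟨V, hV⟩
    have V' : ValidContact c' (hjCoeff c j) j' s l :=
      ⟨hj', V.one_le, V.two_mul_le, V.le, V.le_mul.trans (Nat.mul_le_mul_right _ (by omega)),
        V.add_le⟩
    refine ⟨V', contactPoint_minimal H' V' ?_⟩
    by_contra h
    have h1 := V.one_le
    simp only at h h1
    have hr : c.length = 1 := by omega
    obtain rfl : j = 0 := by omega
    exact contactPoint_not_minimal H hr V (by omega) hV
  · have V' : ValidContact c' (hjCoeff c j) j' 1 (hjCoeff c j) :=
      ⟨hj', le_rfl, by omega, by omega, by omega, by omega⟩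
    obtain ⟨V, -⟩ := hsub (show (1, hjCoeff c j) ∈ vertexParams K H' (hjCoeff c j) j' from
      ⟨V', contactPoint_minimal H' V' (Or.inr rfl)⟩)
    have := V.le_mul
    simp only at this
    omega

include H H' in
theorem JetGraphIso.hjCoeff_eq (φ : JetGraphIso K p q c p' q' c') (j : Fin c.length) :
    hjCoeff c' (φ.indexEquiv j) = hjCoeff c j := by
  have hlen : c'.length = c.length := (Fin.equiv_iff_eq.1 ⟨φ.indexEquiv⟩).symm
  have h (m : ℕ) (hm : 1 ≤ m) :
      (vertexParams K H m j).ncard = (vertexParams K H' m (φ.indexEquiv j)).ncard := by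
    rw [ncard_vertexParams H hm, ncard_vertexParams H' hm, φ.ncard_eq]
  have h2 := two_le_hjCoeff H.two_le j
  have h2' := two_le_hjCoeff H'.two_le (φ.indexEquiv j)
  rcases lt_trichotomy (hjCoeff c' (φ.indexEquiv j)) (hjCoeff c j) with hlt | heq | hlt
  · have := ncard_vertexParams_lt (K := K) H' H (φ.indexEquiv j).isLt j.isLt hlen.symm hlt
    rw [h _ (by omega)] at this
    exact absurd this (lt_irrefl _)
  · exact heq
  · have := ncard_vertexParams_lt (K := K) H H' j.isLt (φ.indexEquiv j).isLt hlen hlt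
    rw [h _ (by omega)] at this
    exact absurd this (lt_irrefl _)

end Counting

section GraphIso

variable {K : Type*} [Field K] {p q : ℕ} {c : List ℕ} (H : HJData p q c)
  {p' q' : ℕ} {c' : List ℕ} (H' : HJData p' q' c')

/-- The chains of generators which belong to the vertices of level `2` in one of the subgraphs. -/
def VertexHasChain (c : List ℕ) (v : Vertex K p q) (u : ℕ) : Prop :=
  v.level = 2 ∧ (∃ j, v ∈ subgraphVertices K p q c j) ∧ u ≤ chainIndex c c.length ∧
    ∃ P, v.carrier = closure {P} ∧ HasChain c P u

theorem VertexHasChain.unique {v : Vertex K p q} {u u' : ℕ} (h : VertexHasChain c v u)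
    (h' : VertexHasChain c v u') : u = u' := by
  obtain ⟨-, -, hu, P, hP, hc⟩ := h
  obtain ⟨-, -, hu', P', hP', hc'⟩ := h'
  rw [hP, closure_singleton_eq_iff] at hP'
  subst hP'
  exact hc.unique hc' hu

include H

/-- At level 2 only s = 1 is possible, and a chain contains an edge, so
`contactPoint_eq_of_linear_part` applies. -/
theorem VertexHasChain.eq {v v' : Vertex K p q} {u : ℕ} (h : VertexHasChain c v u)
    (h' : VertexHasChain c v' u) : v = v' := by
  obtain ⟨h2, ⟨j, hj⟩, hu, P, hP, hc⟩ := h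
  obtain ⟨h2', ⟨j', hj'⟩, -, P', hP', hc'⟩ := h'
  obtain ⟨s, l, V, hV⟩ := (mem_subgraphVertices_iff H).1 hj
  obtain ⟨s', l', V', hV'⟩ := (mem_subgraphVertices_iff H).1 hj'
  obtain ⟨m, hm, S, hS⟩ := v
  obtain ⟨m', hm', S', hS'⟩ := v'
  dsimp only at *
  subst h2 h2'
  have : 2 * s ≤ 3 := V.two_mul_le
  have := V.one_le
  have : 2 * s' ≤ 3 := V'.two_mul_le
  have := V'.one_le
  obtain rfl : s = 1 := by omega
  obtain rfl : s' = 1 := by omega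
  obtain rfl := closure_singleton_eq_iff.1 (hV.symm.trans hP)
  obtain rfl := closure_singleton_eq_iff.1 (hV'.symm.trans hP')
  obtain ⟨e, he, rfl⟩ := exists_edge_of_le c hu
  have := contactPoint_eq_of_linear_part H le_rfl V V'
    (fun k hk => (hc k hk).trans (hc' k hk).symm) he
    ((hc e (by omega)).2 ⟨e, he, rfl, Or.inl rfl⟩)
    ((hc (e + 1) (by omega)).2 ⟨e, he, rfl, Or.inr rfl⟩)
  rw [← this] at hP'
  congr
  rw [hP, hP']

/-- The chains of the vertices of level `2` of a subgraph are the two chains that meet in the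
corresponding generator. -/
theorem chains_of_subgraph (j : Fin c.length) (u : ℕ) :
    (∃ v ∈ subgraphVertices K p q c j, VertexHasChain c v u) ↔
      u = chainIndex c j ∨ u = chainIndex c (j + 1) := by
  have hj := j.isLt
  have hc := two_le_hjCoeff H.two_le j
  have hle1 := chainIndex_mono c (show (j : ℕ) ≤ c.length by omega)
  have hle2 := chainIndex_mono c (show (j : ℕ) + 1 ≤ c.length by omega)
  have V1 : ValidContact c 2 j 1 1 := ⟨hj, le_rfl, by omega, le_rfl, by omega, by omega⟩
  constructor
  · rintro ⟨v, hv, h2, -, hu, P, hP, hch⟩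
    obtain ⟨s, l, V, hV⟩ := (mem_subgraphVertices_iff H).1 hv
    obtain ⟨m, hm, S, hS⟩ := v
    dsimp only at *
    subst h2
    have : 2 * s ≤ 3 := V.two_mul_le
    have := V.one_le
    have h3 : l + s ≤ 3 := V.add_le
    have h4 := V.le
    have h5 := V.le_mul
    obtain rfl : s = 1 := by omega
    obtain rfl := closure_singleton_eq_iff.1 (hV.symm.trans hP)
    -- For l = 1 the next generator also has order 1. For l = 2 one has c_j ≥ 3, and the previous
    -- generator has order min(c_j, 3) - 2 = 1.
    rcases (show l = 1 ∨ l = 2 by omega) with rfl | rfl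
    · right
      exact hch.unique (hasChain_of_eq_one H le_rfl V) hu
    · left
      refine hch.unique (hasChain_of_swapOrder_eq_one H le_rfl V ?_) hu
      unfold swapOrder
      omega
  · have hv1 : ∃ v ∈ subgraphVertices K p q c j, VertexHasChain c v (chainIndex c (j + 1)) := by
      have hmem := vertexOfMinimal_mem (K := K) H (by omega) V1
        (contactPoint_minimal H V1 (Or.inr rfl))
      exact ⟨_, hmem, rfl, ⟨_, hmem⟩, hle2, _, rfl, hasChain_of_eq_one H le_rfl V1⟩
    rintro (rfl | rfl)
    · by_cases h : hjCoeff c j = 2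
      · have := chainIndex_succ c j
        rw [if_pos h, add_zero] at this
        rwa [← this]
      · have V2 : ValidContact c 2 j 1 2 :=
          ⟨hj, le_rfl, by omega, by omega, by omega, by omega⟩
        have hmem := vertexOfMinimal_mem (K := K) H (by omega) V2
          (contactPoint_minimal H V2 (Or.inr rfl))
        refine ⟨_, hmem, rfl, ⟨_, hmem⟩, hle1, _, rfl,
          hasChain_of_swapOrder_eq_one H le_rfl V2 ?_⟩
        unfold swapOrder
        omega
    · exact hv1

theorem exists_chain_of_mem {j : Fin c.length} {v : Vertex K p q}
    (hv : v ∈ subgraphVertices K p q c j) (h2 : v.level = 2) : ∃ u, VertexHasChain c v u := by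
  obtain ⟨s, l, V, hV⟩ := (mem_subgraphVertices_iff H).1 hv
  have hj := j.isLt
  have hle1 := chainIndex_mono c (show (j : ℕ) ≤ c.length by omega)
  have hle2 := chainIndex_mono c (show (j : ℕ) + 1 ≤ c.length by omega)
  have := V.two_mul_le
  have := V.one_le
  have h3 := V.add_le
  have h4 := V.le
  have h5 := V.le_mul
  obtain rfl : s = 1 := by omega
  rcases (show l = 1 ∨ l = 2 by omega) with rfl | rfl
  · exact ⟨_, h2, ⟨j, hv⟩, hle2, _, hV, hasChain_of_eq_one H (by omega) V⟩
  · refine ⟨_, h2, ⟨j, hv⟩, hle1, _, hV, hasChain_of_swapOrder_eq_one H (by omega) V ?_⟩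
    unfold swapOrder
    omega

include H'

/-- Each chain is represented by exactly one vertex of level 2 in the subgraphs, so φ induces a map
g of chain indices. It takes the chains through a generator to those through the generator matched
by `φ.indexEquiv`. -/
theorem JetGraphIso.eq_or_eq_reverse (φ : JetGraphIso K p q c p' q' c') :
    c' = c ∨ c' = c.reverse := by
  have hmap {j : Fin c.length} {v : Vertex K p q} (hv : v ∈ subgraphVertices K p q c j) :
      φ.graphIso v ∈ subgraphVertices K p' q' c' (φ.indexEquiv j) :=
    φ.map_subgraph j ▸ Set.mem_image_of_mem _ hv
  have hex (u : ℕ) (hu : u ≤ chainIndex c c.length) : ∃ v, VertexHasChain (K := K) (p := p)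
      (q := q) c v u := by
    obtain ⟨e, he, rfl⟩ := exists_edge_of_le c hu
    have hpos := H.pos
    rcases Nat.eq_zero_or_pos e with rfl | he0
    · obtain ⟨v, -, hv⟩ := (chains_of_subgraph (K := K) H ⟨0, hpos⟩ _).2 (Or.inl rfl)
      exact ⟨v, hv⟩
    · obtain ⟨e, rfl⟩ : ∃ e', e = e' + 1 := ⟨e - 1, by omega⟩
      obtain ⟨v, -, hv⟩ := (chains_of_subgraph (K := K) H ⟨e, by omega⟩ _).2 (Or.inr rfl)
      exact ⟨v, hv⟩
  have hex' (u : ℕ) (hu : u ≤ chainIndex c c.length) : ∃ u', ∃ v, VertexHasChain (K := K) (p := p)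
      (q := q) c v u ∧ VertexHasChain c' (φ.graphIso v) u' := by
    obtain ⟨v, hv⟩ := hex u hu
    obtain ⟨j, hj⟩ := hv.2.1
    obtain ⟨u', hu'⟩ := exists_chain_of_mem H' (hmap hj) (by rw [φ.level_eq]; exact hv.1)
    exact ⟨u', v, hv, hu'⟩
  choose! g hg using hex'
  refine eq_or_eq_reverse_of_chains (g := g) φ.indexEquiv (φ.hjCoeff_eq H H') (fun j => ?_) ?_ H.pos
  · have hj := j.isLt
    have hle1 := chainIndex_mono c (show (j : ℕ) ≤ c.length by omega)
    have hle2 := chainIndex_mono c (show (j : ℕ) + 1 ≤ c.length by omega)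
    ext u'
    simp only [Set.mem_image, Set.mem_insert_iff, Set.mem_singleton_iff]
    rw [← chains_of_subgraph (K := K) H' (φ.indexEquiv j)]
    constructor
    · rintro ⟨u, hu, rfl⟩
      obtain ⟨v, hv, hvu⟩ := (chains_of_subgraph (K := K) H j u).2 hu
      obtain ⟨w, hwu, hwg⟩ := hg u hvu.2.2.1
      obtain rfl := hvu.eq H hwu
      exact ⟨_, hmap hv, hwg⟩
    · rintro ⟨v', hv', hvu'⟩
      rw [← φ.map_subgraph j] at hv'
      obtain ⟨v, hv, rfl⟩ := hv'
      obtain ⟨u, hu⟩ := exists_chain_of_mem H hv (by rw [← φ.level_eq]; exact hvu'.1)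
      refine ⟨u, (chains_of_subgraph (K := K) H j u).1 ⟨v, hv, hu⟩, ?_⟩
      obtain ⟨w, hwu, hwg⟩ := hg u hu.2.2.1
      obtain rfl := hu.eq H hwu
      exact hwg.unique hvu'
  · intro u hu v hv huv
    obtain ⟨w, hw, hw'⟩ := hg u hu
    obtain ⟨x, hx, hx'⟩ := hg v hv
    rw [← huv] at hx'
    obtain rfl := φ.graphIso.injective (hw'.eq H' hx')
    exact hw.unique hx

end GraphIso

end ToricJets

namespace ToricJets
open PowerSeries Cardinal

/-! ### Isomorphisms of coordinate rings act on jet schemes and graphs. -/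

section Functoriality

variable {K : Type*} [Field K] {A B : Type*} [CommRing A] [Algebra K A] [CommRing B] [Algebra K B]

/-- The homomorphism of the coordinate rings of the jet schemes induced by a homomorphism of
`K`-algebras. -/
noncomputable def jetMap (f : A →ₐ[K] B) (m : ℕ) : JetAlgebra K A m →ₐ[K] JetAlgebra K B m :=
  jetLift ((jetHom (AlgHom.id K _)).comp f)

theorem jetMap_jetCoeff (f : A →ₐ[K] B) (m : ℕ) (k : Fin (m + 1)) (a : A) :
    jetMap f m (jetCoeff K m k a) = jetCoeff K m k (f a) := by
  rw [jetMap, jetLift_jetCoeff, AlgHom.comp_apply, truncCoeff_jetHom _ _ (Nat.lt_succ_iff.1 k.2)]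
  rfl

/-- The isomorphism of the coordinate rings of the jet schemes induced by an isomorphism of
`K`-algebras. -/
noncomputable def jetEquiv (e : A ≃ₐ[K] B) (m : ℕ) : JetAlgebra K A m ≃ₐ[K] JetAlgebra K B m :=
  AlgEquiv.ofAlgHom (jetMap e.toAlgHom m) (jetMap e.symm.toAlgHom m)
    (jetAlgebra_hom_ext fun k a => by simp [jetMap_jetCoeff])
    (jetAlgebra_hom_ext fun k a => by simp [jetMap_jetCoeff])

theorem jetEquiv_symm_jetCoeff (e : A ≃ₐ[K] B) (m : ℕ) (k : Fin (m + 1)) (a : A) :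
    (jetEquiv e m).symm (jetCoeff K m k (e a)) = jetCoeff K m k a := by
  refine (jetMap_jetCoeff e.symm.toAlgHom m k (e a)).trans ?_
  exact congrArg _ (e.symm_apply_apply a)

/-- The homeomorphism of the jet schemes induced by an isomorphism of `K`-algebras. -/
noncomputable def jetHomeo (e : A ≃ₐ[K] B) (m : ℕ) : JetScheme K A m ≃ₜ JetScheme K B m :=
  PrimeSpectrum.homeomorphOfRingEquiv (jetEquiv e m).toRingEquiv

theorem jetHomeo_symm (e : A ≃ₐ[K] B) (m : ℕ) : (jetHomeo e m).symm = jetHomeo e.symm m := rfl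

theorem mem_jetHomeo (e : A ≃ₐ[K] B) {m : ℕ} (P : JetScheme K A m) (z : JetAlgebra K B m) :
    z ∈ (jetHomeo e m P).asIdeal ↔ (jetEquiv e m).symm z ∈ P.asIdeal := Iff.rfl

theorem jetCoeff_mem_jetHomeo (e : A ≃ₐ[K] B) {m : ℕ} (P : JetScheme K A m) (k : Fin (m + 1))
    (a : A) : jetCoeff K m k (e a) ∈ (jetHomeo e m P).asIdeal ↔ jetCoeff K m k a ∈ P.asIdeal := by
  rw [mem_jetHomeo, jetEquiv_symm_jetCoeff]

theorem jetInclusion_jetCoeff {n m : ℕ} (h : n ≤ m) (k : Fin (n + 1)) (a : A) :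
    jetInclusion K A h (jetCoeff K n k a) = jetCoeff K m (Fin.castLE (Nat.succ_le_succ h) k) a :=
  MvPolynomial.aeval_X _ _

theorem truncation_jetHomeo (e : A ≃ₐ[K] B) {n m : ℕ} (h : n ≤ m) (P : JetScheme K A m) :
    truncation K B h (jetHomeo e m P) = jetHomeo e n (truncation K A h P) := by
  have hc : ((jetEquiv e m).symm.toAlgHom).comp (jetInclusion K B h) =
      (jetInclusion K A h).comp (jetEquiv e n).symm.toAlgHom := by
    refine jetAlgebra_hom_ext fun k b => ?_
    obtain ⟨a, rfl⟩ := e.surjective b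
    change (jetEquiv e m).symm (jetInclusion K B h (jetCoeff K n k (e a))) =
      jetInclusion K A h ((jetEquiv e n).symm (jetCoeff K n k (e a)))
    rw [jetInclusion_jetCoeff, jetEquiv_symm_jetCoeff, jetEquiv_symm_jetCoeff,
      jetInclusion_jetCoeff]
  ext z
  exact iff_of_eq (congrArg (· ∈ P.asIdeal) (DFunLike.congr_fun hc z))

end Functoriality

section GraphIso

variable {K : Type*} [Field K] {p q p' q' : ℕ} (e : CoordRing K p q ≃ₐ[K] CoordRing K p' q')
  (he : ∀ a, e a ∈ originIdeal K p' q' ↔ a ∈ originIdeal K p q)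

include he

theorem mem_originIdeal_symm (a : CoordRing K p' q') :
    e.symm a ∈ originIdeal K p q ↔ a ∈ originIdeal K p' q' := by
  rw [← he, e.apply_symm_apply]

theorem jetHomeo_mem_centralFiber {m : ℕ} (P : JetScheme K (CoordRing K p q) m) :
    jetHomeo e m P ∈ centralFiber K p' q' m ↔ P ∈ centralFiber K p q m := by
  have h0 {p q : ℕ} (P : JetScheme K (CoordRing K p q) m) : P ∈ centralFiber K p q m ↔
    ∀ a, jetCoeff K m 0 a ∈ P.asIdeal ↔ a ∈ originIdeal K p q := SetLike.ext_iff
  rw [h0, h0, e.surjective.forall]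
  simp only [he, jetCoeff_mem_jetHomeo]

/-- The component that corresponds to `v` under an isomorphism of the coordinate rings. -/
noncomputable def Vertex.map (v : Vertex K p q) : Vertex K p' q' where
  level := v.level
  one_le_level := v.one_le_level
  carrier := jetHomeo e v.level '' v.carrier
  isComponent := by
    obtain ⟨⟨h1, h2⟩, h3⟩ := v.isComponent
    refine ⟨⟨h1.image _ (jetHomeo e _).continuous.continuousOn, ?_⟩, fun s hs hle => ?_⟩
    · rintro _ ⟨P, hP, rfl⟩
      exact (jetHomeo_mem_centralFiber e he P).2 (h2 hP)
    · obtain ⟨s, rfl⟩ := (jetHomeo e v.level).surjective.image_surjective s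
      refine Set.image_mono (h3 ⟨?_, fun P hP => ?_⟩ ?_)
      · have := hs.1.image (jetHomeo e v.level).symm (jetHomeo e _).symm.continuous.continuousOn
        rwa [← Set.image_comp, (jetHomeo e v.level).symm_comp_self, Set.image_id] at this
      · exact (jetHomeo_mem_centralFiber e he P).1 (hs.2 ⟨P, hP, rfl⟩)
      · exact (Set.image_subset_image_iff (jetHomeo e v.level).injective).1 hle

theorem Vertex.map_map (v : Vertex K p q) :
    (v.map e he).map e.symm (mem_originIdeal_symm e he) = v := by
  obtain ⟨m, hm, C, hC⟩ := v
  have h : jetHomeo e.symm m '' (jetHomeo e m '' C) = C := by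
    rw [← Set.image_comp, ← jetHomeo_symm, (jetHomeo e m).symm_comp_self, Set.image_id]
  have key (D : Set (JetScheme K (CoordRing K p q) m)) (hDC : D = C) (hD) :
      (⟨m, hm, D, hD⟩ : Vertex K p q) = ⟨m, hm, C, hC⟩ := by subst hDC; rfl
  exact key _ h _

theorem Vertex.map_mapsTo {v w : Vertex K p q} (h : v.MapsTo w) :
    (v.map e he).MapsTo (w.map e he) := by
  obtain ⟨n, hn, C, hC⟩ := w
  obtain ⟨m, hm, D, hD⟩ := v
  obtain ⟨rfl : m = n + 1, h2⟩ := h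
  refine ⟨rfl, ?_⟩
  rintro _ ⟨_, ⟨P, hP, rfl⟩, rfl⟩
  exact ⟨_, h2 ⟨P, hP, rfl⟩, (truncation_jetHomeo e (Nat.le_succ n) P).symm⟩

/-- The isomorphism of the graphs of two toric surfaces induced by an isomorphism of their
coordinate rings. -/
noncomputable def graphIsoOfAlgEquiv : jetGraph K p q ≃g jetGraph K p' q' where
  toFun := Vertex.map e he
  invFun := Vertex.map e.symm (mem_originIdeal_symm e he)
  left_inv := Vertex.map_map e he
  right_inv := Vertex.map_map e.symm (mem_originIdeal_symm e he)
  map_rel_iff' {v w} := by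
    have key {v w : Vertex K p q} : (v.map e he).MapsTo (w.map e he) ↔ v.MapsTo w := by
      refine ⟨fun h => ?_, Vertex.map_mapsTo e he⟩
      have := Vertex.map_mapsTo e.symm (mem_originIdeal_symm e he) h
      rwa [Vertex.map_map, Vertex.map_map] at this
    exact or_congr key key

theorem Vertex.dim_map (v : Vertex K p q) : (v.map e he).dim = v.dim :=
  ((jetHomeo e v.level).image v.carrier).symm.isHomeomorph.topologicalKrullDim_eq

theorem Vertex.speciality_map (v : Vertex K p q) : (v.map e he).speciality = v.speciality := by
  unfold Vertex.speciality
  congr 1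
  ext d
  refine exists_congr fun k => and_congr_right fun _ => ?_
  constructor
  · rintro ⟨f, hf, _, ⟨P, hP, rfl⟩, h⟩
    obtain ⟨f, rfl⟩ := e.surjective f
    exact ⟨f, (he f).1 hf, P, hP, fun h' => h ((jetCoeff_mem_jetHomeo e P k f).2 h')⟩
  · rintro ⟨f, hf, P, hP, h⟩
    exact ⟨e f, (he f).2 hf, _, ⟨P, hP, rfl⟩, fun h' => h ((jetCoeff_mem_jetHomeo e P k f).1 h')⟩

end GraphIso

/-! ### The symmetry that reverses the generators. -/

section Reversal

variable {K : Type*} [Field K] {p q p' q' m : ℕ} {c c' : List ℕ}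

theorem ValidContact.reverse (H : HJData p q c) {j s l j' : ℕ} (V : ValidContact c m j s l)
    (hj : j' < c'.length) (hc : hjCoeff c' j' = hjCoeff c j) :
    ValidContact c' m j' s (swapOrder c m j s l) := by
  obtain ⟨h1, h2⟩ := V.le_swapOrder H
  have h3 := V.one_le
  have h4 := V.le
  have h5 : (hjCoeff c j - 1) * s + s = hjCoeff c j * s := by
    have := two_le_hjCoeff H.two_le j
    rw [← Nat.succ_mul]; congr 1; omega
  exact ⟨hj, h3, V.two_mul_le, h1, by rw [hc]; omega, by omega⟩

/-- The reversal exchanges the two neighbours of x_(j+1), so l is replaced by the order of the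
neighbour on the other side, given by `contactPoint_swap`. -/
theorem contactPoint_le_jetHomeo (H : HJData p q c) (H' : HJData p' q' c')
    (e : CoordRing K p q ≃ₐ[K] CoordRing K p' q')
    (he : ∀ k ≤ c.length + 1, e (AddMonoidAlgebra.single (hjGen p q c k) 1) =
      AddMonoidAlgebra.single (hjGen p' q' c' (c.length + 1 - k)) 1)
    {j s l j' : ℕ} (V : ValidContact c m j s l)
    (V' : ValidContact c' m j' s (swapOrder c m j s l)) (hj : j + j' + 1 = c.length) :
    contactPoint K H' V' ≤ jetHomeo e m (contactPoint K H V) := by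
  have hker : (jetHomeo e m (contactPoint K H V)).asIdeal = RingHom.ker
      ((resHom (contactPoint K H V)).comp (jetEquiv e m).symm.toAlgHom) := by
    ext z
    rw [mem_jetHomeo, RingHom.mem_ker, ← resHom_eq_zero_iff]; rfl
  have hgen (k : ℕ) (hk : k ≤ c.length + 1) :
      genSeries c' ((resHom (contactPoint K H V)).comp (jetEquiv e m).symm.toAlgHom)
        (p := p') (q := q') (c.length + 1 - k) = genSeries c (resHom (contactPoint K H V)) k := by
    ext n
    by_cases hn : n ≤ m
    · rw [coeff_jetSeries' _ _ hn, coeff_jetSeries' _ _ hn, ← he k hk]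
      exact congrArg _ (jetEquiv_symm_jetCoeff e m _ _)
    · simp [genSeries, monSeries, jetSeries, hn]
  have hV := V.lt
  have h1 := hgen (j + 1) (by omega)
  have h2 := hgen j (by omega)
  rw [show c.length + 1 - (j + 1) = j' + 1 by omega] at h1
  rw [show c.length + 1 - j = j' + 2 by omega] at h2
  refine contactPoint_le H' V' ((contactPoint_mem_iff H' V' hker).2 ?_)
  rw [h1, h2]
  exact ⟨((contactPoint_mem_iff H V (asIdeal_eq_ker_resHom _)).1 (contactPoint_mem H V)).1,
    contactPoint_swap H V⟩

/-- `swapOrder` is an involution here, so the inequality for the inverse isomorphism is the missing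
one. -/
theorem jetHomeo_contactPoint (H : HJData p q c) (H' : HJData p' q' c')
    (e : CoordRing K p q ≃ₐ[K] CoordRing K p' q') (hlen : c'.length = c.length)
    (he : ∀ k ≤ c.length + 1, e (AddMonoidAlgebra.single (hjGen p q c k) 1) =
      AddMonoidAlgebra.single (hjGen p' q' c' (c.length + 1 - k)) 1)
    {j s l j' : ℕ} (V : ValidContact c m j s l)
    (V' : ValidContact c' m j' s (swapOrder c m j s l)) (hj : j + j' + 1 = c.length)
    (hc : hjCoeff c' j' = hjCoeff c j) :
    jetHomeo e m (contactPoint K H V) = contactPoint K H' V' := by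
  refine le_antisymm ?_ (contactPoint_le_jetHomeo H H' e he V V' hj)
  have hl : swapOrder c' m j' s (swapOrder c m j s l) = l := by
    have h1 := (V.le_swapOrder H).2
    have h2 := (V'.le_swapOrder H').2
    rw [hc] at h2
    omega
  have he' : ∀ k ≤ c'.length + 1, e.symm (AddMonoidAlgebra.single (hjGen p' q' c' k) 1) =
      AddMonoidAlgebra.single (hjGen p q c (c'.length + 1 - k)) 1 := by
    intro k hk
    rw [AlgEquiv.symm_apply_eq, he _ (by omega)]
    congr 2
    omega
  have h := contactPoint_le_jetHomeo (K := K) H' H e.symm he' V' (hl.symm ▸ V) (by omega)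
  have h3 : contactPoint K H (hl.symm ▸ V : ValidContact c m j s
      (swapOrder c' m j' s (swapOrder c m j s l))) = contactPoint K H V := by congr 1
  rw [h3] at h
  have h4 : jetHomeo e m (contactPoint K H V) ≤
      jetHomeo e m (jetHomeo e.symm m (contactPoint K H' V')) := fun z hz => h hz
  rwa [← jetHomeo_symm, Homeomorph.apply_symm_apply] at h4

theorem map_mem_subgraphVertices (H : HJData p q c) (H' : HJData p' q' c')
    (e : CoordRing K p q ≃ₐ[K] CoordRing K p' q') (hlen : c'.length = c.length)
    (he : ∀ k ≤ c.length + 1, e (AddMonoidAlgebra.single (hjGen p q c k) 1) =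
      AddMonoidAlgebra.single (hjGen p' q' c' (c.length + 1 - k)) 1)
    (he' : ∀ a, e a ∈ originIdeal K p' q' ↔ a ∈ originIdeal K p q)
    {j : Fin c.length} {j' : Fin c'.length} (hj : (j : ℕ) + j' + 1 = c.length)
    (hc : hjCoeff c' j' = hjCoeff c j) {v : Vertex K p q}
    (hv : v ∈ subgraphVertices K p q c j) :
    v.map e he' ∈ subgraphVertices K p' q' c' j' := by
  obtain ⟨s, l, V, h⟩ := (mem_subgraphVertices_iff H).1 hv
  refine (mem_subgraphVertices_iff H').2 ⟨s, _, V.reverse H j'.2 hc, ?_⟩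
  change jetHomeo e v.level '' v.carrier = _
  rw [h, Homeomorph.image_closure, Set.image_singleton,
    jetHomeo_contactPoint H H' e hlen he V (V.reverse H j'.2 hc) hj hc]
  rfl

/-- The isomorphism of the coordinate rings that reverses the order of the generators. -/
noncomputable def reverseAlgEquiv (K : Type*) [Field K] (H : HJData p q c)
    (H' : HJData p' q' c.reverse) : CoordRing K p q ≃ₐ[K] CoordRing K p' q' :=
  AddMonoidAlgebra.domCongr K K (hjRevEquiv H H')

theorem reverseAlgEquiv_mem_originIdeal (H : HJData p q c) (H' : HJData p' q' c.reverse)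
    (a : CoordRing K p q) :
    reverseAlgEquiv K H H' a ∈ originIdeal K p' q' ↔ a ∈ originIdeal K p q := by
  have key : Ideal.map (reverseAlgEquiv K H H') (originIdeal K p q) = originIdeal K p' q' := by
    rw [originIdeal, Ideal.map_span, originIdeal]
    congr 1
    ext f
    constructor
    · rintro ⟨_, ⟨u, hu, rfl⟩, rfl⟩
      exact ⟨hjRevEquiv H H' u, by simpa using hu, AddMonoidAlgebra.domCongr_single ..⟩
    · rintro ⟨u, hu, rfl⟩
      refine ⟨_, ⟨(hjRevEquiv H H').symm u, by simpa using hu, rfl⟩, ?_⟩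
      refine (AddMonoidAlgebra.domCongr_single ..).trans ?_
      rw [AddEquiv.apply_symm_apply]
  rw [← key]
  constructor
  · intro h
    obtain ⟨b, hb, hab⟩ := (Ideal.mem_map_iff_of_surjective _ (reverseAlgEquiv K H H').surjective).1 h
    rwa [← (reverseAlgEquiv K H H').injective hab]
  · exact Ideal.mem_map_of_mem _

theorem exists_jetGraphIso_reverse (H : HJData p q c) (H' : HJData p' q' c.reverse) :
    ∃ φ : JetGraphIso K p q c p' q' c.reverse, φ.PreservesWeights := by
  let e := reverseAlgEquiv K H H'
  have he := reverseAlgEquiv_mem_originIdeal (K := K) H H'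
  have hgen : ∀ k ≤ c.length + 1, e (AddMonoidAlgebra.single (hjGen p q c k) 1) =
      AddMonoidAlgebra.single (hjGen p' q' c.reverse (c.length + 1 - k)) 1 := fun k hk => by
    refine (AddMonoidAlgebra.domCongr_single ..).trans ?_
    rw [hjRevEquiv_hjGen H H' hk]
  have hgen' : ∀ k ≤ c.reverse.length + 1,
      e.symm (AddMonoidAlgebra.single (hjGen p' q' c.reverse k) 1) =
        AddMonoidAlgebra.single (hjGen p q c (c.reverse.length + 1 - k)) 1 := fun k hk => by
    rw [List.length_reverse] at hk ⊢
    rw [AlgEquiv.symm_apply_eq, hgen _ (by omega)]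
    congr 2
    omega
  let τ : Fin c.length ≃ Fin c.reverse.length :=
    Fin.revPerm.trans (finCongr c.length_reverse.symm)
  have hτ (j : Fin c.length) : (j : ℕ) + τ j + 1 = c.length := by
    change (j : ℕ) + Fin.rev j + 1 = c.length
    rw [Fin.val_rev]; omega
  have hcτ (j : Fin c.length) : hjCoeff c.reverse (τ j) = hjCoeff c j := by
    rw [hjCoeff_reverse (by have := hτ j; omega)]
    congr 1
    have := hτ j
    omega
  refine ⟨⟨graphIsoOfAlgEquiv e he, fun v => rfl, τ, fun j => ?_⟩, fun v =>
    ⟨v.dim_map e he, v.speciality_map e he⟩⟩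
  ext w
  constructor
  · rintro ⟨v, hv, rfl⟩
    exact map_mem_subgraphVertices H H' e c.length_reverse hgen he (hτ j) (hcτ j) hv
  · intro hw
    refine ⟨_, ?_, (graphIsoOfAlgEquiv e he).apply_symm_apply w⟩
    refine map_mem_subgraphVertices H' H e.symm c.length_reverse.symm hgen'
      (mem_originIdeal_symm e he) ?_ (hcτ j).symm hw
    have := hτ j
    have := c.length_reverse
    omega

/-- The last vector depends on c only and is (q, -p). -/
theorem HJData.eq_of_eq (H : HJData p q c) (H' : HJData p' q' c) : p = p' ∧ q = q' := by
  have h := H.hjVec_last.symm.trans H'.hjVec_last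
  simp only [Prod.mk.injEq, neg_inj, Nat.cast_inj] at h
  exact h.symm

theorem exists_jetGraphIso_of_eq_or_eq_reverse (H : HJData p q c) (H' : HJData p' q' c')
    (h : c' = c ∨ c' = c.reverse) :
    ∃ φ : JetGraphIso K p q c p' q' c', φ.PreservesWeights := by
  rcases h with rfl | rfl
  · obtain ⟨rfl, rfl⟩ := H.eq_of_eq H'
    exact ⟨⟨SimpleGraph.Iso.refl, fun v => rfl, Equiv.refl _, fun j => Set.image_id _⟩,
      fun v => ⟨rfl, rfl⟩⟩
  · exact exists_jetGraphIso_reverse H H'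

end Reversal

/-! ### Functoriality of the completion. -/

section Completion

variable {K : Type*} [Field K] {A B : Type*} [CommRing A] [Algebra K A] [CommRing B] [Algebra K B]

/-- The homomorphisms from the completion to the quotients by powers of an ideal induced by a
homomorphism of `K`-algebras. -/
noncomputable def adicCompletionMapAux (I : Ideal A) (J : Ideal B) (f : A →ₐ[K] B)
    (h : I ≤ J.comap f) (n : ℕ) : AdicCompletion I A →ₐ[K] B ⧸ J ^ n :=
  (Ideal.quotientMapₐ (J ^ n) f ((Ideal.pow_right_mono h n).trans (Ideal.le_comap_pow f n))).comp
    ((AdicCompletion.evalₐ I n).restrictScalars K)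

theorem adicCompletionMapAux_mk (I : Ideal A) (J : Ideal B) (f : A →ₐ[K] B)
    (h : I ≤ J.comap f) (n : ℕ) (x : AdicCompletion.AdicCauchySequence I A) :
    adicCompletionMapAux I J f h n (AdicCompletion.mk I A x) =
      Ideal.Quotient.mk (J ^ n) (f (x.val n)) :=
  congrArg (Ideal.quotientMapₐ (J ^ n) f
    ((Ideal.pow_right_mono h n).trans (Ideal.le_comap_pow f n))) (AdicCompletion.evalₐ_mk I n x)

theorem factor_comp_adicCompletionMapAux (I : Ideal A) (J : Ideal B) (f : A →ₐ[K] B)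
    (h : I ≤ J.comap f) {m n : ℕ} (hle : m ≤ n) :
    (Ideal.Quotient.factorₐ K (Ideal.pow_le_pow_right hle)).comp (adicCompletionMapAux I J f h n) =
      adicCompletionMapAux I J f h m := by
  ext x
  obtain ⟨x, rfl⟩ := AdicCompletion.mk_surjective I A x
  refine (congrArg (Ideal.Quotient.factorₐ K (Ideal.pow_le_pow_right hle))
    (adicCompletionMapAux_mk I J f h n x)).trans
      (Eq.trans ?_ (adicCompletionMapAux_mk I J f h m x).symm)
  exact congrArg (Ideal.quotientMapₐ (J ^ m) f
    ((Ideal.pow_right_mono h m).trans (Ideal.le_comap_pow f m)))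
      (AdicCompletion.Ideal.mk_eq_mk I hle x)

/-- The homomorphism of the completions induced by a homomorphism of `K`-algebras. -/
noncomputable def adicCompletionMap (I : Ideal A) (J : Ideal B) (f : A →ₐ[K] B)
    (h : I ≤ J.comap f) : AdicCompletion I A →ₐ[K] AdicCompletion J B :=
  AdicCompletion.liftAlgHom J (adicCompletionMapAux I J f h)
    (factor_comp_adicCompletionMapAux I J f h)

theorem evalₐ_adicCompletionMap (I : Ideal A) (J : Ideal B) (f : A →ₐ[K] B)
    (h : I ≤ J.comap f) (n : ℕ) (x : AdicCompletion.AdicCauchySequence I A) :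
    AdicCompletion.evalₐ J n (adicCompletionMap I J f h (AdicCompletion.mk I A x)) =
      Ideal.Quotient.mk (J ^ n) (f (x.val n)) :=
  (AdicCompletion.evalₐ_liftAlgHom J _ (factor_comp_adicCompletionMapAux I J f h) n _).trans
    (adicCompletionMapAux_mk I J f h n x)

theorem adicCompletionMap_symm (I : Ideal A) (J : Ideal B) (e : A ≃ₐ[K] B)
    (h : I ≤ J.comap e.toAlgHom) (h' : J ≤ I.comap e.symm.toAlgHom) (x : AdicCompletion I A) :
    adicCompletionMap J I e.symm.toAlgHom h' (adicCompletionMap I J e.toAlgHom h x) = x := by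
  refine AdicCompletion.ext_evalₐ fun n => ?_
  obtain ⟨y, hy⟩ := AdicCompletion.mk_surjective J B (adicCompletionMap I J e.toAlgHom h x)
  obtain ⟨x, rfl⟩ := AdicCompletion.mk_surjective I A x
  rw [← hy, evalₐ_adicCompletionMap, AdicCompletion.evalₐ_mk, Ideal.Quotient.eq]
  have h1 := evalₐ_adicCompletionMap I J e.toAlgHom h n x
  rw [← hy, AdicCompletion.evalₐ_mk, Ideal.Quotient.eq] at h1
  have h2 := (Ideal.pow_right_mono h' n).trans (Ideal.le_comap_pow e.symm.toAlgHom n) h1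
  rw [Ideal.mem_comap, map_sub] at h2
  convert h2 using 2
  exact (e.symm_apply_apply _).symm

/-- An isomorphism of `K`-algebras which identifies two ideals induces an isomorphism of the
completions. -/
noncomputable def adicCompletionEquiv (I : Ideal A) (J : Ideal B) (e : A ≃ₐ[K] B)
    (h : I ≤ J.comap e.toAlgHom) (h' : J ≤ I.comap e.symm.toAlgHom) :
    AdicCompletion I A ≃ₐ[K] AdicCompletion J B :=
  AlgEquiv.ofAlgHom (adicCompletionMap I J e.toAlgHom h) (adicCompletionMap J I e.symm.toAlgHom h')
    (AlgHom.ext (adicCompletionMap_symm J I e.symm h' h))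
    (AlgHom.ext (adicCompletionMap_symm I J e h h'))

theorem sameAnalyticType_of_eq_or_eq_reverse {p q p' q' : ℕ} {c c' : List ℕ} (H : HJData p q c)
    (H' : HJData p' q' c') (h : c' = c ∨ c' = c.reverse) : SameAnalyticType K p q p' q' := by
  rcases h with rfl | rfl
  · obtain ⟨rfl, rfl⟩ := H.eq_of_eq H'
    exact ⟨AlgEquiv.refl⟩
  · have he := reverseAlgEquiv_mem_originIdeal (K := K) H H'
    exact ⟨adicCompletionEquiv _ _ (reverseAlgEquiv K H H') (fun a ha => (he a).2 ha)
      fun a ha => (mem_originIdeal_symm _ he a).2 ha⟩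

end Completion
end ToricJets

namespace ToricJets

/-! ### Families of supports that determine c up to reversal. -/

section ChainFamilies

/-- The first generator of the chain with index `u`. -/
def chainStart (c : List ℕ) (u : ℕ) : ℕ :=
  -- The first alternative stops the search at the last generator. The index after the last chain
  -- thus gets the end of that chain, and every chain is the interval from its own start to the next
  -- one.
  Nat.find (p := fun e => c.length + 1 ≤ e ∨ u ≤ chainIndex c e) ⟨_, Or.inl le_rfl⟩

theorem lt_chainStart_iff {c : List ℕ} {u e : ℕ} :
    e < chainStart c u ↔ e ≤ c.length ∧ chainIndex c e < u := by
  unfold chainStart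
  constructor
  · intro h
    have := Nat.find_min _ h
    omega
  · intro h
    by_contra hlt
    rw [not_lt] at hlt
    have h1 := chainIndex_mono c hlt
    have h2 := Nat.find_spec (p := fun e => c.length + 1 ≤ e ∨ u ≤ chainIndex c e)
      ⟨_, Or.inl le_rfl⟩
    omega

theorem chainStart_zero (c : List ℕ) : chainStart c 0 = 0 := by
  by_contra h
  have := (lt_chainStart_iff (c := c)).1 (Nat.pos_of_ne_zero h)
  omega

theorem chainStart_last (c : List ℕ) : chainStart c (chainIndex c c.length + 1) = c.length + 1 := by
  have h1 := (lt_chainStart_iff (c := c) (u := chainIndex c c.length + 1) (e := c.length)).2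
    ⟨le_rfl, Nat.lt_succ_self _⟩
  by_contra h
  have := (lt_chainStart_iff (c := c) (u := chainIndex c c.length + 1) (e := c.length + 1)).1
    (by omega)
  omega

theorem chainStart_lt_succ {c : List ℕ} {u : ℕ} (hu : u ≤ chainIndex c c.length) :
    chainStart c u < chainStart c (u + 1) := by
  obtain ⟨e, he, h⟩ := exists_edge_of_le c hu
  have h1 : e < chainStart c (u + 1) := lt_chainStart_iff.2 ⟨he, by omega⟩
  have h2 : ¬ e < chainStart c u := fun h' => by have := (lt_chainStart_iff.1 h').2; omega
  omega

theorem chainStart_lt {c : List ℕ} {u v : ℕ} (huv : u < v) (hv : v ≤ chainIndex c c.length + 1) :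
    chainStart c u < chainStart c v := by
  induction v, huv using Nat.le_induction with
  | base => exact chainStart_lt_succ (by omega)
  | succ v huv ih => exact (ih (by omega)).trans (chainStart_lt_succ (by omega))

theorem chainStart_le {c : List ℕ} {u v : ℕ} (huv : u ≤ v) (hv : v ≤ chainIndex c c.length + 1) :
    chainStart c u ≤ chainStart c v := by
  rcases huv.eq_or_lt with rfl | h
  · exact le_rfl
  · exact (chainStart_lt h hv).le

theorem chainStart_eq_of_ne_two {c : List ℕ} {j : ℕ} (hj : j < c.length) (h2 : hjCoeff c j ≠ 2) :
    chainStart c (chainIndex c (j + 1)) = j + 1 := by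
  have h := chainIndex_succ c j
  rw [if_neg h2] at h
  have h1 : j < chainStart c (chainIndex c (j + 1)) := lt_chainStart_iff.2 ⟨hj.le, by omega⟩
  have h3 : ¬ j + 1 < chainStart c (chainIndex c (j + 1)) := fun h' => by
    have := (lt_chainStart_iff.1 h').2; omega
  omega

theorem exists_chainStart {c : List ℕ} {u : ℕ} (h1 : 1 ≤ u) (hu : u ≤ chainIndex c c.length) :
    ∃ j < c.length, chainStart c u = j + 1 ∧ hjCoeff c j ≠ 2 := by
  obtain ⟨e, he, h3, h4⟩ := exists_step_of_lt c (n := c.length) (u := u - 1) (by omega)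
  have h5 : hjCoeff c e ≠ 2 := fun h => by
    have := chainIndex_succ c e
    rw [if_pos h] at this
    omega
  have := chainStart_eq_of_ne_two he h5
  rw [h4, Nat.sub_add_cancel h1] at this
  exact ⟨e, he, this, h5⟩

/-- A family of sets of generators consisting of the chains and, for the common generator of two
consecutive chains, of a number of sets that consist of this generator only. -/
structure IsChainFamily (c : List ℕ) {X : Type*} (L : X → Finset ℕ) : Prop where
  chain_or_singleton : ∀ x, (∃ u ≤ chainIndex c c.length,
    L x = Finset.Icc (chainStart c u) (chainStart c (u + 1))) ∨
      ∃ u, 1 ≤ u ∧ u ≤ chainIndex c c.length ∧ L x = {chainStart c u}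
  exists_chain : ∀ u ≤ chainIndex c c.length,
    ∃ x, L x = Finset.Icc (chainStart c u) (chainStart c (u + 1))
  eq_of_chain : ∀ u ≤ chainIndex c c.length, ∀ x y,
    L x = Finset.Icc (chainStart c u) (chainStart c (u + 1)) →
    L y = Finset.Icc (chainStart c u) (chainStart c (u + 1)) → x = y
  -- The shift by 1 is there because `hjCoeff c k` belongs to the generator with index k + 1.
  ncard_singleton : ∀ u, 1 ≤ u → u ≤ chainIndex c c.length →
    {x | L x = {chainStart c u}}.ncard + 3 = hjCoeff c (chainStart c u - 1)

variable {c c' : List ℕ} {X X' : Type*} {L : X → Finset ℕ} {L' : X' → Finset ℕ}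

theorem card_chain {u : ℕ} (hu : u ≤ chainIndex c c.length) :
    (Finset.Icc (chainStart c u) (chainStart c (u + 1))).card + chainStart c u =
      chainStart c (u + 1) + 1 := by
  have := chainStart_lt_succ hu
  rw [Nat.card_Icc]
  omega

theorem card_chain_inter {u : ℕ} (hu : u < chainIndex c c.length) :
    (Finset.Icc (chainStart c u) (chainStart c (u + 1)) ∩
      Finset.Icc (chainStart c (u + 1)) (chainStart c (u + 1 + 1))).card = 1 := by
  have h1 := chainStart_lt_succ (c := c) (u := u) (by omega)
  have h2 := chainStart_lt_succ (c := c) (u := u + 1) (by omega)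
  rw [Finset.card_eq_one]
  refine ⟨chainStart c (u + 1), ?_⟩
  ext k
  simp only [Finset.mem_inter, Finset.mem_Icc, Finset.mem_singleton]
  omega

theorem succ_eq_of_chain_inter {u v : ℕ} (huv : u < v) (hv : v ≤ chainIndex c c.length)
    (h : (Finset.Icc (chainStart c u) (chainStart c (u + 1)) ∩
      Finset.Icc (chainStart c v) (chainStart c (v + 1))).card = 1) : v = u + 1 := by
  by_contra hne
  have h1 := chainStart_lt (c := c) (u := u + 1) (v := v) (by omega) (by omega)
  obtain ⟨k, hk⟩ := Finset.card_eq_one.1 h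
  have hk := Finset.ext_iff.1 hk k
  simp only [Finset.mem_inter, Finset.mem_Icc, Finset.mem_singleton, iff_true] at hk
  omega

namespace IsChainFamily

theorem exists_chain_of_two_le (F : IsChainFamily c L) {x : X} (h : 2 ≤ (L x).card) :
    ∃ u ≤ chainIndex c c.length, L x = Finset.Icc (chainStart c u) (chainStart c (u + 1)) := by
  rcases F.chain_or_singleton x with h1 | ⟨u, -, -, h1⟩
  · exact h1
  · rw [h1, Finset.card_singleton] at h
    omega

/-- Two consecutive chains meet only in their junction. This expresses the singletons there by
cardinalities of intersections alone, which the bijection preserves. -/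
theorem singleton_iff {u : ℕ} (hu : u < chainIndex c c.length) (x : X) :
    L x = {chainStart c (u + 1)} ↔ (L x).card = 1 ∧
      (L x ∩ Finset.Icc (chainStart c u) (chainStart c (u + 1))).card = 1 ∧
      (L x ∩ Finset.Icc (chainStart c (u + 1)) (chainStart c (u + 1 + 1))).card = 1 := by
  have h1 := chainStart_lt_succ (c := c) (u := u) (by omega)
  have h2 := chainStart_lt_succ (c := c) (u := u + 1) (by omega)
  constructor
  · intro h
    have h3 : ({chainStart c (u + 1)} : Finset ℕ) ∩
        Finset.Icc (chainStart c u) (chainStart c (u + 1)) = {chainStart c (u + 1)} :=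
      Finset.inter_eq_left.2 (by simp; omega)
    have h4 : ({chainStart c (u + 1)} : Finset ℕ) ∩
        Finset.Icc (chainStart c (u + 1)) (chainStart c (u + 1 + 1)) = {chainStart c (u + 1)} :=
      Finset.inter_eq_left.2 (by simp; omega)
    rw [h, h3, h4]
    simp
  · rintro ⟨h3, h4, h5⟩
    obtain ⟨k, hk⟩ := Finset.card_eq_one.1 h3
    rw [hk] at h4 h5 ⊢
    obtain ⟨i, hi⟩ := Finset.card_pos.1 (by omega : 0 < (({k} : Finset ℕ) ∩
      Finset.Icc (chainStart c u) (chainStart c (u + 1))).card)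
    obtain ⟨i', hi'⟩ := Finset.card_pos.1 (by omega : 0 < (({k} : Finset ℕ) ∩
      Finset.Icc (chainStart c (u + 1)) (chainStart c (u + 1 + 1))).card)
    simp only [Finset.mem_inter, Finset.mem_singleton, Finset.mem_Icc] at hi hi'
    congr 1
    omega

/-- The map between the indices of the chains induced by a bijection. -/
theorem exists_chainMap (F : IsChainFamily c L) (F' : IsChainFamily c' L') (φ : X ≃ X')
    (hφ : ∀ x y, (L' (φ x) ∩ L' (φ y)).card = (L x ∩ L y).card) :
    ∃ g : ℕ → ℕ, (∀ u ≤ chainIndex c c.length, g u ≤ chainIndex c' c'.length ∧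
      ∃ x, L x = Finset.Icc (chainStart c u) (chainStart c (u + 1)) ∧
        L' (φ x) = Finset.Icc (chainStart c' (g u)) (chainStart c' (g u + 1))) ∧
      ∀ u ≤ chainIndex c c.length, ∀ v ≤ chainIndex c c.length, g u = g v → u = v := by
  have h (u : ℕ) (hu : u ≤ chainIndex c c.length) : ∃ v, v ≤ chainIndex c' c'.length ∧
      ∃ x, L x = Finset.Icc (chainStart c u) (chainStart c (u + 1)) ∧
        L' (φ x) = Finset.Icc (chainStart c' v) (chainStart c' (v + 1)) := by
    obtain ⟨x, hx⟩ := F.exists_chain u hu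
    have h1 := hφ x x
    have h2 := card_chain hu
    have h3 := chainStart_lt_succ hu
    rw [Finset.inter_self, Finset.inter_self, hx] at h1
    -- A chain has at least two elements and φ preserves cardinalities, so the image is no
    -- singleton.
    obtain ⟨v, hv, h4⟩ := F'.exists_chain_of_two_le (x := φ x) (by omega)
    exact ⟨v, hv, x, hx, h4⟩
  choose! g hg using h
  refine ⟨g, hg, fun u hu v hv huv => ?_⟩
  obtain ⟨h1, x, hx, hx'⟩ := hg u hu
  obtain ⟨-, y, hy, hy'⟩ := hg v hv
  rw [← huv] at hy'
  obtain rfl := φ.injective (F'.eq_of_chain _ h1 _ _ hx' hy')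
  rw [hx] at hy
  have h3 := chainStart_lt_succ hu
  have h4 := chainStart_lt_succ hv
  have h5 := Finset.ext_iff.1 hy
  simp only [Finset.mem_Icc] at h5
  have h6 := (h5 (chainStart c u)).1 (by omega)
  have h7 := (h5 (chainStart c v)).2 (by omega)
  rcases lt_trichotomy u v with h | h | h
  · have := chainStart_lt (c := c) h (by omega); omega
  · exact h
  · have := chainStart_lt (c := c) h (by omega); omega

theorem chainIndex_le (F : IsChainFamily c L) (F' : IsChainFamily c' L') (φ : X ≃ X')
    (hφ : ∀ x y, (L' (φ x) ∩ L' (φ y)).card = (L x ∩ L y).card) :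
    chainIndex c c.length ≤ chainIndex c' c'.length := by
  obtain ⟨g, hg, hinj⟩ := F.exists_chainMap F' φ hφ
  have := Finset.card_le_card_of_injOn (s := Finset.range (chainIndex c c.length + 1))
    (t := Finset.range (chainIndex c' c'.length + 1)) g
    (fun u hu => by
      have h1 := Finset.mem_range.1 hu
      exact Finset.mem_coe.2 (Finset.mem_range.2 (Nat.lt_succ_of_le (hg u (by omega)).1)))
    (fun u hu v hv h => by
      have h1 := Finset.mem_range.1 hu
      have h2 := Finset.mem_range.1 hv
      exact hinj u (by omega) v (by omega) h)
  simpa using this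

/-- The coefficient at a junction is 3 plus the number of singletons there. Both orders of the image
chains are allowed, so that reflections are covered. -/
theorem hjCoeff_eq (F : IsChainFamily c L) (F' : IsChainFamily c' L') (φ : X ≃ X')
    (hφ : ∀ x y, (L' (φ x) ∩ L' (φ y)).card = (L x ∩ L y).card) {u v : ℕ}
    (hu : u < chainIndex c c.length) (hv : v < chainIndex c' c'.length) {x y : X}
    (hx : L x = Finset.Icc (chainStart c u) (chainStart c (u + 1)))
    (hy : L y = Finset.Icc (chainStart c (u + 1)) (chainStart c (u + 1 + 1)))
    (h : L' (φ x) = Finset.Icc (chainStart c' v) (chainStart c' (v + 1)) ∧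
        L' (φ y) = Finset.Icc (chainStart c' (v + 1)) (chainStart c' (v + 1 + 1)) ∨
      L' (φ y) = Finset.Icc (chainStart c' v) (chainStart c' (v + 1)) ∧
        L' (φ x) = Finset.Icc (chainStart c' (v + 1)) (chainStart c' (v + 1 + 1))) :
    hjCoeff c' (chainStart c' (v + 1) - 1) = hjCoeff c (chainStart c (u + 1) - 1) := by
  rw [← F'.ncard_singleton (v + 1) (by omega) (by omega),
    ← F.ncard_singleton (u + 1) (by omega) (by omega)]
  congr 1
  have key (z : X) : L z = {chainStart c (u + 1)} ↔ L' (φ z) = {chainStart c' (v + 1)} := by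
    have h0 := hφ z z
    rw [Finset.inter_self, Finset.inter_self] at h0
    rw [singleton_iff hu, singleton_iff hv, ← hx, ← hy, ← hφ, ← hφ, ← h0]
    rcases h with ⟨h1, h2⟩ | ⟨h1, h2⟩
    · rw [h1, h2]
    · rw [h1, h2, and_comm (a := (L' (φ z) ∩ _).card = 1)]
  have himg : {x | L' x = {chainStart c' (v + 1)}} = φ '' {x | L x = {chainStart c (u + 1)}} := by
    ext w
    obtain ⟨z, rfl⟩ := φ.surjective w
    rw [φ.injective.mem_set_image]
    exact (key z).symm
  rw [himg, Set.ncard_image_of_injective _ φ.injective]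

theorem hjCoeff_eq_two {j : ℕ} (hj : j < c.length)
    (h : ∀ u, 1 ≤ u → u ≤ chainIndex c c.length → j + 1 ≠ chainStart c u) : hjCoeff c j = 2 := by
  by_contra h2
  have h3 := chainIndex_succ c j
  rw [if_neg h2] at h3
  exact h _ (by omega) (chainIndex_mono c (by omega)) (chainStart_eq_of_ne_two hj h2).symm

/-- Distinct chains are consecutive exactly if they meet in one element, so the induced map of
chains is rigid. Lengths of chains are cardinalities, and summing them locates all junctions. There
the coefficients are counted by singletons; everywhere else they are 2. -/
theorem eq_or_eq_reverse (F : IsChainFamily c L) (F' : IsChainFamily c' L') (φ : X ≃ X')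
    (hφ : ∀ x y, (L' (φ x) ∩ L' (φ y)).card = (L x ∩ L y).card) : c' = c ∨ c' = c.reverse := by
  have hN : chainIndex c' c'.length = chainIndex c c.length :=
    le_antisymm (F'.chainIndex_le F φ.symm fun x y => by rw [← hφ]; simp)
      (F.chainIndex_le F' φ hφ)
  obtain ⟨g, hg, hinj⟩ := F.exists_chainMap F' φ hφ
  set N := chainIndex c c.length with hNdef
  have hadj : ∀ u < N, g (u + 1) = g u + 1 ∨ g u = g (u + 1) + 1 := by
    intro u hu
    obtain ⟨h1, x, hx, hx'⟩ := hg u hu.le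
    obtain ⟨h2, y, hy, hy'⟩ := hg (u + 1) hu
    have h3 := hφ x y
    rw [hx', hy', hx, hy, card_chain_inter hu] at h3
    have h4 := hinj u hu.le (u + 1) hu
    rcases lt_trichotomy (g u) (g (u + 1)) with h | h | h
    · exact Or.inl (succ_eq_of_chain_inter h h2 h3)
    · omega
    · rw [Finset.inter_comm] at h3
      exact Or.inr (succ_eq_of_chain_inter h h1 h3)
  have hlen (u : ℕ) (hu : u ≤ N) : chainStart c' (g u + 1) + chainStart c u =
      chainStart c (u + 1) + chainStart c' (g u) := by
    obtain ⟨h1, x, hx, hx'⟩ := hg u hu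
    have h2 := hφ x x
    rw [Finset.inter_self, Finset.inter_self, hx, hx'] at h2
    have h3 := card_chain hu
    have h4 := card_chain h1
    omega
  have hl := chainStart_last c
  have hl' := chainStart_last c'
  rw [hN] at hl'
  rw [← hNdef] at hl
  have hz := chainStart_zero c
  have hz' := chainStart_zero c'
  rcases path_rigidity (fun u hu => hN ▸ (hg u hu).1) hinj hadj with h | h
  · left
    have hst : ∀ u ≤ N + 1, chainStart c' u = chainStart c u := by
      intro u hu
      induction u with
      | zero => rw [hz, hz']
      | succ u ih =>
        have h1 := hlen u (by omega)
        rw [h u (by omega)] at h1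
        have := ih (by omega)
        omega
    have hlen' : c'.length = c.length := by
      have := hst (N + 1) le_rfl
      omega
    refine List.ext_get hlen' fun j hj' hj => ?_
    rw [get_eq_hjCoeff, get_eq_hjCoeff]
    change hjCoeff c' j = hjCoeff c j
    by_cases hj2 : ∃ u, 1 ≤ u ∧ u ≤ N ∧ j + 1 = chainStart c u
    · obtain ⟨u, hu1, hu, hju⟩ := hj2
      obtain ⟨u, rfl⟩ : ∃ v, u = v + 1 := ⟨u - 1, by omega⟩
      obtain ⟨-, x, hx, hx'⟩ := hg u (by omega)
      obtain ⟨-, y, hy, hy'⟩ := hg (u + 1) hu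
      rw [h _ (by omega)] at hx' hy'
      have := F.hjCoeff_eq F' φ hφ (u := u) (v := u) (by omega) (by omega) hx hy
        (Or.inl ⟨hx', hy'⟩)
      rwa [hst _ (by omega), ← hju, Nat.add_sub_cancel] at this
    · push Not at hj2
      rw [hjCoeff_eq_two hj hj2, hjCoeff_eq_two hj' fun u h1 h2 => ?_]
      rw [hst u (by omega)]
      exact hj2 u h1 (by omega)
  · right
    have hst : ∀ u ≤ N + 1, chainStart c' (N + 1 - u) + chainStart c u = c'.length + 1 := by
      intro u hu
      induction u with
      | zero => rw [Nat.sub_zero, hl', hz]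
      | succ u ih =>
        have h1 := hlen u (by omega)
        rw [h u (by omega)] at h1
        have := ih (by omega)
        rw [show N + 1 - (u + 1) = N - u by omega]
        rw [show N + 1 - u = N - u + 1 by omega] at this
        omega
    have hlen' : c'.length = c.length := by
      have := hst (N + 1) le_rfl
      rw [Nat.sub_self] at this
      omega
    refine List.ext_get (by rw [hlen', List.length_reverse]) fun j hj' hj => ?_
    rw [get_eq_hjCoeff, get_eq_hjCoeff]
    change hjCoeff c' j = hjCoeff c.reverse j
    rw [hjCoeff_reverse (by omega)]
    by_cases hj2 : ∃ u, 1 ≤ u ∧ u ≤ N ∧ j + 1 = chainStart c' u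
    · obtain ⟨v, hv1, hv, hjv⟩ := hj2
      obtain ⟨v, rfl⟩ : ∃ w, v = w + 1 := ⟨v - 1, by omega⟩
      obtain ⟨u, hu⟩ : ∃ u, u + 1 + v = N := ⟨N - (v + 1), by omega⟩
      obtain ⟨-, x, hx, hx'⟩ := hg u (by omega)
      obtain ⟨-, y, hy, hy'⟩ := hg (u + 1) (by omega)
      rw [h _ (by omega), show N - u = v + 1 by omega] at hx'
      rw [h _ (by omega), show N - (u + 1) = v by omega] at hy'
      have h1 := F.hjCoeff_eq F' φ hφ (u := u) (v := v) (by omega) (by omega) hx hy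
        (Or.inr ⟨hy', hx'⟩)
      have h2 := hst (u + 1) (by omega)
      rw [show N + 1 - (u + 1) = v + 1 by omega, ← hjv] at h2
      rw [← hjv, Nat.add_sub_cancel] at h1
      rw [h1]
      congr 1
      omega
    · push Not at hj2
      rw [hjCoeff_eq_two hj' fun u h1 h2 => hj2 u h1 (by omega),
        hjCoeff_eq_two (by omega) fun u h1 h2 => ?_]
      intro h3
      have h4 := hst u (by omega)
      exact hj2 (N + 1 - u) (by omega) (by omega) (by omega)

end IsChainFamily

end ChainFamilies
end ToricJets

namespace ToricJets
open PowerSeries Cardinal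

/-! ### An intrinsic description of the generic points with s = 1. -/

section TopPoints

variable {K : Type*} [Field K] {p q m : ℕ} {c : List ℕ} (H : HJData p q c) {j l : ℕ}

/-- The elements of the coordinate ring with zero linear part at a point of the jet scheme. -/
noncomputable def linearKernel {A : Type*} [CommRing A] [Algebra K A] {m : ℕ}
    (P : JetScheme K A m) : Submodule K A where
  carrier := {a | coeff 1 (jetSeries (resHom P) a) = 0}
  zero_mem' := by
    by_cases h : 1 < m + 1
    · have := jetCoeff_smul (m := m) ⟨1, h⟩ (0 : K) (0 : A)
      rw [zero_smul, zero_smul] at this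
      simp [jetSeries, this]
    · simp [jetSeries, show ¬ 1 ≤ m by omega]
  add_mem' {a b} ha hb := by
    by_cases h : 1 < m + 1
    · simp only [Set.mem_ofPred_eq, jetSeries, coeff_mk, h, dif_pos] at ha hb ⊢
      rw [jetCoeff_add, map_add, ha, hb, add_zero]
    · simp [jetSeries, show ¬ 1 ≤ m by omega]
  smul_mem' r a ha := by
    by_cases h : 1 < m + 1
    · simp only [Set.mem_ofPred_eq, jetSeries, coeff_mk, h, dif_pos] at ha ⊢
      rw [jetCoeff_smul, map_smul, ha, smul_zero]
    · simp [jetSeries, show ¬ 1 ≤ m by omega]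

theorem mem_linearKernel {A : Type*} [CommRing A] [Algebra K A] {m : ℕ}
    {P : JetScheme K A m} {a : A} :
    a ∈ linearKernel P ↔ coeff 1 (jetSeries (resHom P) a) = 0 := Iff.rfl

open Classical in
/-- The generators with nonzero linear part at a point. -/
noncomputable def linearSupport (c : List ℕ) (P : JetScheme K (CoordRing K p q) m) : Finset ℕ :=
  (Finset.range (c.length + 2)).filter fun k => coeff 1 (genSeries c (resHom P) k) ≠ 0

open Classical in
theorem mem_linearSupport {P : JetScheme K (CoordRing K p q) m} {k : ℕ} :
    k ∈ linearSupport c P ↔ k ≤ c.length + 1 ∧ coeff 1 (genSeries c (resHom P) k) ≠ 0 := by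
  rw [linearSupport, Finset.mem_filter, Finset.mem_range, Nat.lt_succ_iff]

include H

/-- A monomial that is not a generator has zero linear part. -/
theorem exists_eq_hjGen_of_linear_part (hm : 1 ≤ m) {P : JetScheme K (CoordRing K p q) m}
    (hP : P ∈ centralFiber K p q m) {w : dualSemigroup p q}
    (hw : coeff 1 (monSeries (resHom P) w) ≠ 0) : ∃ k ≤ c.length + 1, w = hjGen p q c k := by
  have h0 (v : dualSemigroup p q) (hv : v ≠ 0) : X ∣ monSeries (resHom P) v := by
    rw [X_dvd_iff, ← coeff_zero_eq_constantCoeff_apply, coeff_jetSeries' _ _ (Nat.zero_le m)]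
    exact resHom_eq_zero_iff.2 (mem_centralFiber_iff_monomials.1 hP v hv)
  have hne : w ≠ 0 := by
    rintro rfl
    rw [truncMk_eq_iff.1 (monSeries_zero _) 1 hm, coeff_one] at hw
    simp at hw
  rcases H.eq_hjGen_or_add hne with h | ⟨u, v, hu, hv, rfl⟩
  · exact h
  · rw [truncMk_eq_iff.1 (monSeries_add _ u v) 1 hm] at hw
    have h2 : X ^ 2 ∣ monSeries (resHom P) u * monSeries (resHom P) v := by
      rw [sq]; exact mul_dvd_mul (h0 u hu) (h0 v hv)
    exact absurd (X_pow_dvd_iff.1 h2 1 (by norm_num)) hw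

/-- The codimension of the sum of the kernels of the linear parts at two points. -/
theorem finrank_quotient_linearKernel (hm : 1 ≤ m) {j' l' : ℕ} (V : ValidContact c m j 1 l)
    (V' : ValidContact c m j' 1 l') :
    Module.finrank K (CoordRing K p q ⧸
      (linearKernel (contactPoint K H V) ⊔ linearKernel (contactPoint K H V'))) =
    (linearSupport c (contactPoint K H V) ∩ linearSupport c (contactPoint K H V')).card := by
  classical
  set T := linearSupport c (contactPoint K H V) ∩ linearSupport c (contactPoint K H V') with hT
  let φ : CoordRing K p q →ₗ[K] (T → K) :=
    LinearMap.pi fun k => (Finsupp.lapply (hjGen p q c k)) ∘ₗ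
      (AddMonoidAlgebra.coeffLinearEquiv K).toLinearMap
  have hφ (a : CoordRing K p q) (k : T) : φ a k = a.coeff (hjGen p q c k) := rfl
  have hTle (k : T) : (k : ℕ) ≤ c.length + 1 :=
    (mem_linearSupport.1 (Finset.mem_inter.1 k.2).1).1
  have hmono {j l : ℕ} (V : ValidContact c m j 1 l) {a : CoordRing K p q}
      (ha : a ∈ linearKernel (contactPoint K H V)) {w : dualSemigroup p q} (hw : a.coeff w ≠ 0) :
      coeff 1 (monSeries (resHom (contactPoint K H V)) w) = 0 := by
    rw [mem_linearKernel, coeff_jetSeries' _ _ hm] at ha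
    rw [coeff_jetSeries' _ _ hm]
    exact resHom_contactPoint_eq_zero H V ha hw
  -- By torus invariance both kernels are spanned by monomials. A monomial outside their sum must be
  -- a generator in both supports.
  have hker : LinearMap.ker φ =
      linearKernel (contactPoint K H V) ⊔ linearKernel (contactPoint K H V') := by
    refine le_antisymm (fun a ha => ?_) (sup_le (fun a ha => ?_) (fun a ha => ?_))
    · have hsum : a = ∑ w ∈ a.coeff.support, AddMonoidAlgebra.single w (a.coeff w) :=
        (AddMonoidAlgebra.sum_coeff_single a).symm
      rw [hsum]
      refine Submodule.sum_mem _ fun w hw => ?_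
      have hr : (AddMonoidAlgebra.single w (a.coeff w) : CoordRing K p q) =
        a.coeff w • AddMonoidAlgebra.single w 1 := by simp
      rw [hr]
      refine Submodule.smul_mem _ _ ?_
      by_cases h1 : coeff 1 (monSeries (resHom (contactPoint K H V)) w) = 0
      · exact Submodule.mem_sup_left h1
      · refine Submodule.mem_sup_right ?_
        by_contra h2
        obtain ⟨k, hk, rfl⟩ :=
          exists_eq_hjGen_of_linear_part H hm (contactPoint_mem_centralFiber H V) h1
        have hkT : k ∈ T :=
          Finset.mem_inter.2 ⟨mem_linearSupport.2 ⟨hk, h1⟩, mem_linearSupport.2 ⟨hk, h2⟩⟩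
        exact (Finsupp.mem_support_iff.1 hw) (congrFun (LinearMap.mem_ker.1 ha) ⟨k, hkT⟩)
    · refine LinearMap.mem_ker.2 (funext fun k => ?_)
      by_contra h
      exact (mem_linearSupport.1 (Finset.mem_inter.1 k.2).1).2 (hmono V ha h)
    · refine LinearMap.mem_ker.2 (funext fun k => ?_)
      by_contra h
      exact (mem_linearSupport.1 (Finset.mem_inter.1 k.2).2).2 (hmono V' ha h)
  have hsurj : Function.Surjective φ := by
    intro x
    refine ⟨∑ k : T, AddMonoidAlgebra.single (hjGen p q c k) (x k), funext fun i => ?_⟩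
    rw [map_sum, Finset.sum_apply, Finset.sum_eq_single i]
    · rw [hφ]; simp
    · intro k _ hki
      rw [hφ]
      have : hjGen p q c k ≠ hjGen p q c i := fun h =>
        hki (Subtype.ext (H.hjGen_injOn (hTle k) (hTle i) h))
      simp [this]
    · simp
  rw [← hker, (φ.quotKerEquivOfSurjective hsurj).finrank_eq, Module.finrank_fintype_fun_eq_card,
    Fintype.card_coe]

omit H

/-- The points of the central fiber with nonzero linear part that have the greatest transcendence
degree among these. -/
def IsTopPoint (P : JetScheme K (CoordRing K p q) m) : Prop :=
  (P ∈ centralFiber K p q m ∧ linearKernel P ≠ ⊤) ∧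
    ∀ Q ∈ centralFiber K p q m, linearKernel Q ≠ ⊤ →
      Algebra.trdeg K (ResRing Q) ≤ Algebra.trdeg K (ResRing P)

include H

theorem exists_linear_part_ne_zero (hm : 1 ≤ m) {P : JetScheme K (CoordRing K p q) m}
    (hP : P ∈ centralFiber K p q m) (h : linearKernel P ≠ ⊤) :
    ∃ k ≤ c.length + 1, coeff 1 (genSeries c (resHom P) k) ≠ 0 := by
  by_contra hk
  push Not at hk
  refine h (eq_top_iff.2 fun a _ => ?_)
  induction a using AddMonoidAlgebra.induction_linear with
  | zero => exact zero_mem _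
  | add a b ha hb => exact add_mem (ha trivial) (hb trivial)
  | single w r =>
    have hr : (AddMonoidAlgebra.single w r : CoordRing K p q) =
      r • AddMonoidAlgebra.single w 1 := by simp
    rw [hr]
    refine Submodule.smul_mem _ _ ?_
    by_contra h1
    obtain ⟨k, hk', rfl⟩ := exists_eq_hjGen_of_linear_part H hm hP h1
    exact h1 (hk k hk')

theorem trdeg_le_of_linearKernel_ne_top (hm : 1 ≤ m) {P : JetScheme K (CoordRing K p q) m}
    (hP : P ∈ centralFiber K p q m) (h : linearKernel P ≠ ⊤) :
    Algebra.trdeg K (ResRing P) ≤ (2 * m + c.length : ℕ) := by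
  obtain ⟨k, hk, hk1⟩ := exists_linear_part_ne_zero H hm hP h
  obtain ⟨n, hn, hle⟩ := trdeg_le_of_min_order H (resHom_surjective P) (s := 1) le_rfl (by omega)
    (by simpa using (mem_centralFiber_iff H (asIdeal_eq_ker_resHom P)).1 hP) hk hk1
  exact hle.trans (by exact_mod_cast (by omega : n ≤ 2 * m + c.length))

theorem linearKernel_contactPoint_ne_top (V : ValidContact c m j 1 l) :
    linearKernel (contactPoint K H V) ≠ ⊤ := fun h =>
  (linear_part_contactPoint (K := K) H V).1 (mem_linearKernel.1 (h ▸ Submodule.mem_top))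

theorem trdeg_contactPoint (V : ValidContact c m j 1 l) :
    Algebra.trdeg K (ResRing (contactPoint K H V)) = (2 * m + c.length : ℕ) := by
  have hm := V.two_mul_le
  refine le_antisymm (trdeg_le_of_linearKernel_ne_top H (by omega)
    (contactPoint_mem_centralFiber H V) (linearKernel_contactPoint_ne_top H V)) ?_
  obtain ⟨n, hn, hle⟩ := le_trdeg_contactPoint (K := K) H V
  rwa [show n = 2 * m + c.length by omega] at hle

theorem isTopPoint_contactPoint (V : ValidContact c m j 1 l) :
    IsTopPoint (contactPoint K H V) := by
  have hm := V.two_mul_le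
  refine ⟨⟨contactPoint_mem_centralFiber H V, linearKernel_contactPoint_ne_top H V⟩,
    fun Q hQ hQ1 => ?_⟩
  rw [trdeg_contactPoint]
  exact trdeg_le_of_linearKernel_ne_top H (by omega) hQ hQ1

/-- A top point has at least the transcendence degree 2m + r of a contact point. This excludes the
smaller bound in `exists_contact_or_trdeg_le`, so it lies in a contact locus, and as a proper
specialization it would have a smaller degree. -/
theorem IsTopPoint.exists_eq_contactPoint (hm : 1 ≤ m) {P : JetScheme K (CoordRing K p q) m}
    (hP : IsTopPoint P) : ∃ j l, ∃ V : ValidContact c m j 1 l, P = contactPoint K H V := by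
  obtain ⟨⟨h1, h2⟩, h3⟩ := hP
  have hpos := H.pos
  have hc0 := two_le_hjCoeff H.two_le 0
  have V0 : ValidContact c m 0 1 1 := ⟨hpos, le_rfl, by omega, le_rfl, by omega, by omega⟩
  have h4 := h3 _ (contactPoint_mem_centralFiber H V0) (linearKernel_contactPoint_ne_top H V0)
  rw [trdeg_contactPoint] at h4
  obtain ⟨k, hk, hk1⟩ := exists_linear_part_ne_zero H hm h1 h2
  have hord := (mem_centralFiber_iff H (asIdeal_eq_ker_resHom P)).1 h1
  rcases exists_contact_or_trdeg_le H (resHom_surjective P) hm hord hk hk1 with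
    ⟨j, l, V, h5, h6, h7⟩ | ⟨n, hn, hle⟩
  · refine ⟨j, l, V, ?_⟩
    have hj := V.lt
    have hle := contactPoint_le H V ((contactPoint_mem_iff H V (asIdeal_eq_ker_resHom P)).2
      ⟨⟨by simpa using hord (j + 1) (by omega), h5⟩, h6, h7⟩)
    by_contra hne
    have hlt := trdeg_resRing_lt (lt_of_le_of_ne hle (Ne.symm hne))
      (by rw [trdeg_contactPoint]; exact natCast_lt_aleph0)
    rw [trdeg_contactPoint] at hlt
    exact absurd h4 (not_le_of_gt hlt)
  · have := h4.trans hle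
    have : 2 * m + c.length ≤ n := by exact_mod_cast this
    omega

omit H in
theorem linearSupport_eq_iff_hasChain {P : JetScheme K (CoordRing K p q) m} {u : ℕ}
    (hu : u ≤ chainIndex c c.length) :
    linearSupport c P = Finset.Icc (chainStart c u) (chainStart c (u + 1)) ↔ HasChain c P u := by
  have h1 := chainStart_lt_succ hu
  have h2 : chainStart c (u + 1) ≤ c.length + 1 := by
    rw [← chainStart_last]; exact chainStart_le (by omega) le_rfl
  have h3 (f : ℕ) : (f ≤ c.length ∧ chainIndex c f = u) ↔
      chainStart c u ≤ f ∧ f < chainStart c (u + 1) := by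
    have h5 := lt_chainStart_iff (c := c) (u := u) (e := f)
    have h6 := lt_chainStart_iff (c := c) (u := u + 1) (e := f)
    omega
  have h4 (k : ℕ) : (∃ f ≤ c.length, chainIndex c f = u ∧ (k = f ∨ k = f + 1)) ↔
      k ∈ Finset.Icc (chainStart c u) (chainStart c (u + 1)) := by
    rw [Finset.mem_Icc]
    constructor
    · rintro ⟨f, hf, hfu, hk⟩
      have := (h3 f).1 ⟨hf, hfu⟩
      omega
    · intro hk
      by_cases hk1 : k < chainStart c (u + 1)
      · obtain ⟨h5, h6⟩ := (h3 k).2 ⟨hk.1, hk1⟩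
        exact ⟨k, h5, h6, Or.inl rfl⟩
      · obtain ⟨h5, h6⟩ := (h3 (k - 1)).2 (by omega)
        exact ⟨k - 1, h5, h6, by omega⟩
  simp only [HasChain, h4]
  constructor
  · intro h k hk
    rw [← h, mem_linearSupport, and_iff_right hk]
  · intro h
    ext k
    rw [mem_linearSupport]
    constructor
    · rintro ⟨hk, h5⟩
      exact (h k hk).1 h5
    · intro hk
      have := (Finset.mem_Icc.1 hk).2
      exact ⟨by omega, (h k (by omega)).2 hk⟩

/-- The top points of level `m` are a chain family, if `m` is large enough. -/
theorem isChainFamily_topPoints (hm : 2 ≤ m) (hcm : ∀ j < c.length, hjCoeff c j ≤ m + 1) :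
    IsChainFamily c fun P : {P : JetScheme K (CoordRing K p q) m // IsTopPoint P} =>
      linearSupport c P.1 := by
  have hidx (j : ℕ) (hj : j ≤ c.length) : chainIndex c j ≤ chainIndex c c.length :=
    chainIndex_mono c hj
  have hsingle {j l : ℕ} (V : ValidContact c m j 1 l) (h1 : l ≠ 1)
      (h2 : swapOrder c m j 1 l ≠ 1) : linearSupport c (contactPoint K H V) = {j + 1} := by
    have hl := linear_part_contactPoint (K := K) H V
    have hj := V.lt
    ext k
    rw [mem_linearSupport, Finset.mem_singleton]
    have h3 (hk : k ≤ c.length + 1) := linear_part_ne_zero_iff_of_isolated H hm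
      (contactPoint_order H V) hj hl.1 (not_not.1 fun h => h2 (hl.2.2.1 h))
      (not_not.1 fun h => h1 (hl.2.1.1 h)) hk
    constructor
    · rintro ⟨hk, h⟩
      exact (h3 hk).1 h
    · intro h
      exact ⟨by omega, (h3 (by omega)).2 h⟩
  refine ⟨?_, ?_, ?_, ?_⟩
  · rintro ⟨P, hP⟩
    obtain ⟨j, l, V, rfl⟩ := hP.exists_eq_contactPoint H (by omega)
    have hj := V.lt
    by_cases h1 : l = 1
    · subst h1
      exact Or.inl ⟨_, hidx (j + 1) (by omega),
        (linearSupport_eq_iff_hasChain (hidx _ (by omega))).2 (hasChain_of_eq_one H hm V)⟩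
    by_cases h2 : swapOrder c m j 1 l = 1
    · exact Or.inl ⟨_, hidx j (by omega),
        (linearSupport_eq_iff_hasChain (hidx _ (by omega))).2
          (hasChain_of_swapOrder_eq_one H hm V h2)⟩
    · right
      have h3 := V.le_mul
      have h4 := V.le
      have h5 : hjCoeff c j ≠ 2 := by omega
      have h6 := chainIndex_succ c j
      rw [if_neg h5] at h6
      refine ⟨chainIndex c (j + 1), by omega, hidx _ (by omega), ?_⟩
      rw [chainStart_eq_of_ne_two hj h5]
      exact hsingle V h1 h2
  · intro u hu
    simp only [linearSupport_eq_iff_hasChain hu]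
    obtain ⟨e, he, rfl⟩ := exists_edge_of_le c hu
    have hpos := H.pos
    rcases Nat.eq_zero_or_pos e with rfl | he0
    · have hc0 := two_le_hjCoeff H.two_le 0
      have hcm0 := hcm 0 hpos
      -- The greatest possible l leaves order 1 for x_0, because c_0 ≤ m + 1. This represents the
      -- first chain.
      have V : ValidContact c m 0 1 (hjCoeff c 0 - 1) :=
        ⟨hpos, le_rfl, by omega, by omega, by omega, by omega⟩
      exact ⟨⟨_, isTopPoint_contactPoint H V⟩, hasChain_of_swapOrder_eq_one H hm V
        (by unfold swapOrder; omega)⟩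
    · obtain ⟨j, rfl⟩ : ∃ j, e = j + 1 := ⟨e - 1, by omega⟩
      have hc0 := two_le_hjCoeff H.two_le j
      have V : ValidContact c m j 1 1 := ⟨by omega, le_rfl, by omega, le_rfl, by omega, by omega⟩
      exact ⟨⟨_, isTopPoint_contactPoint H V⟩, hasChain_of_eq_one H hm V⟩
  · rintro u hu ⟨P, hP⟩ ⟨Q, hQ⟩ h h'
    rw [linearSupport_eq_iff_hasChain hu] at h h'
    obtain ⟨j, l, V, rfl⟩ := hP.exists_eq_contactPoint H (by omega)
    obtain ⟨j', l', V', rfl⟩ := hQ.exists_eq_contactPoint H (by omega)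
    obtain ⟨e, he, rfl⟩ := exists_edge_of_le c hu
    exact Subtype.ext (contactPoint_eq_of_linear_part H hm V V'
      (fun k hk => (h k hk).trans (h' k hk).symm) he
      ((h e (by omega)).2 ⟨e, he, rfl, Or.inl rfl⟩)
      ((h (e + 1) (by omega)).2 ⟨e, he, rfl, Or.inr rfl⟩))
  · intro u hu1 hu
    obtain ⟨j, hj, hju, hc2⟩ := exists_chainStart hu1 hu
    have hc0 := two_le_hjCoeff H.two_le j
    have hcm0 := hcm j hj
    rw [hju, Nat.add_sub_cancel]
    -- As c_j ≤ m + 1, the neighbours have orders l and c_j - l. Both exceed 1 exactly for 2 ≤ l ≤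
    -- c_j - 2, which leaves c_j - 3 values.
    have hV {l : ℕ} (hl : l ∈ Finset.Icc 2 (hjCoeff c j - 2)) : ValidContact c m j 1 l := by
      rw [Finset.mem_Icc] at hl
      exact ⟨hj, le_rfl, by omega, by omega, by omega, by omega⟩
    have hcard : ((Finset.Icc 2 (hjCoeff c j - 2) : Finset ℕ) : Set ℕ).ncard =
        {P : {P : JetScheme K (CoordRing K p q) m // IsTopPoint P} |
          linearSupport c P.1 = {j + 1}}.ncard := by
      refine Set.ncard_congr (fun l hl => ⟨contactPoint K H (hV hl), isTopPoint_contactPoint H _⟩)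
        (fun l hl => ?_) (fun l l' hl hl' h => ?_) ?_
      · have hl' := Finset.mem_Icc.1 (Finset.mem_coe.1 hl)
        exact hsingle _ (by omega) (by unfold swapOrder; omega)
      · exact (contactPoint_params H _ _ (congrArg Subtype.val h)).2
      · rintro ⟨P, hP⟩ hP1
        obtain ⟨j', l, V, rfl⟩ := hP.exists_eq_contactPoint H (by omega)
        have hj' := V.lt
        have hl := linear_part_contactPoint (K := K) H V
        have hP2 (k : ℕ) := Finset.ext_iff.1 (show linearSupport c (contactPoint K H V) = {j + 1}
          from hP1) k
        simp only [mem_linearSupport, Finset.mem_singleton] at hP2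
        have h1 := (hP2 (j' + 1)).1 ⟨by omega, hl.1⟩
        obtain rfl : j' = j := by omega
        have h2 : l ≠ 1 := fun h => by
          have := (hP2 (j' + 2)).1 ⟨by omega, hl.2.1.2 h⟩
          omega
        have h3 : swapOrder c m j' 1 l ≠ 1 := fun h => by
          have := (hP2 j').1 ⟨by omega, hl.2.2.2 h⟩
          omega
        have h4 := (V.le_swapOrder H).1
        have h5 := (V.le_swapOrder H).2
        have h6 := V.le
        exact ⟨l, Finset.mem_coe.2 (Finset.mem_Icc.2 (by omega)), rfl⟩
    rw [← hcard, Set.ncard_coe_finset, Nat.card_Icc]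
    omega

end TopPoints
end ToricJets

namespace ToricJets
open PowerSeries Cardinal

/-! ### Transport of jets along isomorphisms of truncated rings. -/

section Correspondence

universe u
variable {K : Type u} [Field K] {A B : Type u} [CommRing A] [Algebra K A] [CommRing B]
  [Algebra K B] {I : Ideal A} {J : Ideal B} {m : ℕ}

/-- Two points of jet schemes correspond to each other under an isomorphism of truncated rings, if
the universal jets at these points do so. -/
def Corresponds (β : (A ⧸ I ^ (m + 1)) ≃ₐ[K] (B ⧸ J ^ (m + 1))) (P : JetScheme K A m)
    (P' : JetScheme K B m) : Prop :=
  ∃ ι : ResRing P ≃ₐ[K] ResRing P', ∀ a b, β (Ideal.Quotient.mk _ a) = Ideal.Quotient.mk _ b →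
    ∀ k, ι (resHom P (jetCoeff K m k a)) = resHom P' (jetCoeff K m k b)

theorem range_le_of_jetCoeff {R : Type*} [CommRing R] [Algebra K R]
    (π : JetAlgebra K A m →ₐ[K] R) {S : Subalgebra K R} (h : ∀ k a, π (jetCoeff K m k a) ∈ S) :
    π.range ≤ S := by
  rintro _ ⟨z, rfl⟩
  obtain ⟨f, rfl⟩ := Ideal.Quotient.mk_surjective z
  change π.comp (Ideal.Quotient.mkₐ K _) f ∈ S
  induction f using MvPolynomial.induction_on with
  | C r => exact (AlgHom.commutes (π.comp (Ideal.Quotient.mkₐ K _)) r) ▸ S.algebraMap_mem r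
  | add f g hf hg => rw [map_add]; exact add_mem hf hg
  | mul_X f v hf => rw [map_mul]; exact mul_mem hf (h v.1 v.2)

/-- A centred jet maps I into the ideal generated by t, and t^(m+1) = 0. Such a jet only sees the
truncation of A. -/
theorem jetHom_eq_zero_of_mem_pow {R : Type*} [CommRing R] [Algebra K R]
    {π : JetAlgebra K A m →ₐ[K] R} (hπ : ∀ a ∈ I, π (jetCoeff K m 0 a) = 0) {a : A}
    (ha : a ∈ I ^ (m + 1)) : jetHom π a = 0 := by
  have hle : I ≤ (Ideal.span {truncMk m (X : R⟦X⟧)}).comap (jetHom π) := by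
    intro a ha
    have : (X : R⟦X⟧) ∣ jetSeries π a := by
      rw [X_dvd_iff, ← coeff_zero_eq_constantCoeff_apply, coeff_jetSeries' _ _ (Nat.zero_le m)]
      exact hπ a ha
    rw [Ideal.mem_comap, jetHom_apply, Ideal.mem_span_singleton]
    exact map_dvd _ this
  have h := (Ideal.pow_right_mono hle (m + 1)).trans (Ideal.le_comap_pow _ _) ha
  rw [Ideal.mem_comap, Ideal.span_singleton_pow, ← map_pow,
    Ideal.Quotient.eq_zero_iff_mem.2 (Ideal.mem_span_singleton_self _),
    Ideal.span_singleton_zero] at h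
  exact h

variable (β : (A ⧸ I ^ (m + 1)) ≃ₐ[K] (B ⧸ J ^ (m + 1)))

/-- The residual jet at P factors through A / I^(m+1), so β turns it into a jet of B over the same
residue ring. It generates this ring because the coefficients of both jets are the same elements. -/
theorem exists_corresponds {P : JetScheme K A m} (hP : ∀ a ∈ I, jetCoeff K m 0 a ∈ P.asIdeal) :
    ∃ P' : JetScheme K B m, Corresponds β P P' := by
  let g : (A ⧸ I ^ (m + 1)) →ₐ[K] TruncSeries (ResRing P) m :=
    Ideal.Quotient.liftₐ _ (jetHom (resHom P)) fun a ha =>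
      jetHom_eq_zero_of_mem_pow (fun a ha => resHom_eq_zero_iff.2 (hP a ha)) ha
  let π' : JetAlgebra K B m →ₐ[K] ResRing P :=
    jetLift ((g.comp β.symm.toAlgHom).comp (Ideal.Quotient.mkₐ K _))
  have key (a : A) (b : B) (hab : β (Ideal.Quotient.mk _ a) = Ideal.Quotient.mk _ b)
      (k : Fin (m + 1)) : π' (jetCoeff K m k b) = resHom P (jetCoeff K m k a) := by
    have h1 : ((g.comp β.symm.toAlgHom).comp (Ideal.Quotient.mkₐ K _)) b = jetHom (resHom P) a := by
      change g (β.symm (Ideal.Quotient.mk _ b)) = _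
      rw [← hab, AlgEquiv.symm_apply_apply]
      rfl
    rw [jetLift_jetCoeff, h1, truncCoeff_jetHom _ _ (Nat.lt_succ_iff.1 k.2)]
  have hsurj : Function.Surjective π' := by
    intro z
    obtain ⟨y, rfl⟩ := resHom_surjective P z
    refine range_le_of_jetCoeff (resHom P) (S := π'.range) (fun k a => ?_) ⟨y, rfl⟩
    obtain ⟨b, hb⟩ := Ideal.Quotient.mk_surjective (β (Ideal.Quotient.mk _ a))
    exact ⟨_, key a b hb.symm k⟩
  let ι : ResRing (kerPoint π') ≃ₐ[K] ResRing P :=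
    Ideal.quotientKerAlgEquivOfSurjective hsurj
  refine ⟨kerPoint π', ι.symm, fun a b hab k => ?_⟩
  rw [AlgEquiv.symm_apply_eq, ← key a b hab k]
  rfl

variable {β} {P Q : JetScheme K A m} {P' Q' : JetScheme K B m}

namespace Corresponds

theorem symm (h : Corresponds β P P') : Corresponds β.symm P' P := by
  obtain ⟨ι, hι⟩ := h
  refine ⟨ι.symm, fun b a hba k => ?_⟩
  rw [AlgEquiv.symm_apply_eq] at hba ⊢
  exact (hι a b hba.symm k).symm

theorem unique (h : Corresponds β P P') (h' : Corresponds β P Q') : P' = Q' := by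
  obtain ⟨ι, hι⟩ := h
  obtain ⟨κ, hκ⟩ := h'
  have hcomp : (ι.symm.trans κ).toAlgHom.comp (resHom P') = resHom Q' := by
    refine jetAlgebra_hom_ext fun k b => ?_
    obtain ⟨a, ha⟩ := Ideal.Quotient.mk_surjective (β.symm (Ideal.Quotient.mk _ b))
    have hab : β (Ideal.Quotient.mk _ a) = Ideal.Quotient.mk _ b := by
      rw [ha, AlgEquiv.apply_symm_apply]
    change κ (ι.symm (resHom P' (jetCoeff K m k b))) = _
    rw [← hι a b hab k, AlgEquiv.symm_apply_apply, hκ a b hab k]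
  ext z
  rw [← resHom_eq_zero_iff, ← resHom_eq_zero_iff, ← hcomp]
  exact (map_eq_zero_iff (ι.symm.trans κ) (ι.symm.trans κ).injective).symm

theorem trdeg_eq (h : Corresponds β P P') :
    Algebra.trdeg K (ResRing P) = Algebra.trdeg K (ResRing P') := by
  obtain ⟨ι, -⟩ := h
  exact ι.trdeg_eq

theorem coeff_eq_zero_iff (h : Corresponds β P P') {a : A} {b : B}
    (hab : β (Ideal.Quotient.mk _ a) = Ideal.Quotient.mk _ b) {n : ℕ} (hn : n ≤ m) :
    coeff n (jetSeries (resHom P) a) = 0 ↔ coeff n (jetSeries (resHom P') b) = 0 := by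
  obtain ⟨ι, hι⟩ := h
  rw [coeff_jetSeries' _ _ hn, coeff_jetSeries' _ _ hn, ← hι a b hab]
  exact (map_eq_zero_iff ι ι.injective).symm

/-- Lifting β to a map of representatives is only well defined modulo J^(m+1), which by `hJ` lies in
the kernels on the side of B. -/
theorem finrank_quotient_eq (h : Corresponds β P P') (h' : Corresponds β Q Q') (hm : 1 ≤ m)
    (hJ : ∀ b ∈ J ^ (m + 1), b ∈ linearKernel P' ∧ b ∈ linearKernel Q') :
    Module.finrank K (A ⧸ (linearKernel P ⊔ linearKernel Q)) =
      Module.finrank K (B ⧸ (linearKernel P' ⊔ linearKernel Q')) := by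
  have hs (a : A) : ∃ b : B, β (Ideal.Quotient.mk _ a) = Ideal.Quotient.mk _ b := by
    obtain ⟨b, hb⟩ := Ideal.Quotient.mk_surjective (β (Ideal.Quotient.mk _ a))
    exact ⟨b, hb.symm⟩
  have hs' (b : B) : ∃ a : A, β (Ideal.Quotient.mk _ a) = Ideal.Quotient.mk _ b := by
    obtain ⟨a, ha⟩ := Ideal.Quotient.mk_surjective (β.symm (Ideal.Quotient.mk _ b))
    exact ⟨a, by rw [ha, AlgEquiv.apply_symm_apply]⟩
  choose s hs using hs
  set W' := linearKernel P' ⊔ linearKernel Q'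
  have hmk {b b' : B} (hbb : Ideal.Quotient.mk (J ^ (m + 1)) b = Ideal.Quotient.mk _ b') :
      W'.mkQ b = W'.mkQ b' := by
    rw [Submodule.mkQ_apply, Submodule.mkQ_apply, Submodule.Quotient.eq]
    exact Submodule.mem_sup_left (hJ _ (Ideal.Quotient.eq.1 hbb)).1
  let φ : A →ₗ[K] B ⧸ W' :=
    { toFun := fun a => W'.mkQ (s a)
      map_add' := fun a b => by
        rw [← map_add]
        exact hmk (by rw [← hs, map_add, map_add, map_add, hs, hs])
      map_smul' := fun r a => by
        rw [RingHom.id_apply, ← map_smul]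
        refine hmk ?_
        rw [← hs]
        exact (map_smul β r (Ideal.Quotient.mk _ a)).trans (congrArg (r • ·) (hs a)) }
  have hφ (a : A) (b : B) (hab : β (Ideal.Quotient.mk _ a) = Ideal.Quotient.mk _ b) :
      φ a = W'.mkQ b := hmk ((hs a).symm.trans hab)
  have hsurj : Function.Surjective φ := by
    intro y
    obtain ⟨b, rfl⟩ := W'.mkQ_surjective y
    obtain ⟨a, ha⟩ := hs' b
    exact ⟨a, hφ a b ha⟩
  have hker : LinearMap.ker φ = linearKernel P ⊔ linearKernel Q := by
    refine le_antisymm (fun a ha => ?_) (sup_le (fun a ha => ?_) (fun a ha => ?_))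
    · rw [LinearMap.mem_ker, hφ a (s a) (hs a), Submodule.mkQ_apply,
        Submodule.Quotient.mk_eq_zero] at ha
      obtain ⟨b₁, hb₁, b₂, hb₂, hb⟩ := Submodule.mem_sup.1 ha
      obtain ⟨a₁, ha₁⟩ := hs' b₁
      have h2 : β (Ideal.Quotient.mk _ (a - a₁)) = Ideal.Quotient.mk _ b₂ := by
        rw [map_sub, map_sub, hs, ha₁, ← hb, map_add, add_sub_cancel_left]
      rw [← add_sub_cancel a₁ a]
      exact Submodule.add_mem_sup ((h.coeff_eq_zero_iff ha₁ hm).2 hb₁)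
        ((h'.coeff_eq_zero_iff h2 hm).2 hb₂)
    · rw [LinearMap.mem_ker, hφ a (s a) (hs a), Submodule.mkQ_apply,
        Submodule.Quotient.mk_eq_zero]
      exact Submodule.mem_sup_left ((h.coeff_eq_zero_iff (hs a) hm).1 ha)
    · rw [LinearMap.mem_ker, hφ a (s a) (hs a), Submodule.mkQ_apply,
        Submodule.Quotient.mk_eq_zero]
      exact Submodule.mem_sup_right ((h'.coeff_eq_zero_iff (hs a) hm).1 ha)
  rw [← hker, (φ.quotKerEquivOfSurjective hsurj).finrank_eq]

end Corresponds

end Correspondence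

/-! ### From the completion to the truncations. -/

section Truncation

variable {K : Type*} [Field K]

/-- The powers of a finitely generated ideal in its adic completion are the kernels of the
projections to the truncations. -/
theorem ker_evalₐ_eq {A : Type*} [CommRing A] {I : Ideal A} (hI : I.FG) (n : ℕ) :
    RingHom.ker (AdicCompletion.evalₐ I n) =
      I.map (algebraMap A (AdicCompletion I A)) ^ n := by
  ext x
  rw [← Ideal.map_pow, ← Submodule.restrictScalars_mem A (Ideal.map _ _), ← Ideal.smul_top_eq_map,
    AdicCompletion.pow_smul_top_eq_ker_eval hI, LinearMap.mem_ker, RingHom.mem_ker]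
  have h : (I ^ n • ⊤ : Ideal A) = I ^ n := by ext x; simp
  exact map_eq_zero_iff _ (Ideal.quotientEquivAlgOfEq A h).injective

/-- The extended ideal is maximal, and by completeness it lies in the Jacobson radical. Being
ring-theoretic, it is respected by isomorphisms that are not assumed to be continuous. -/
theorem map_eq_jacobson_bot {A : Type*} [CommRing A] {I : Ideal A} (hI : I.FG) [hmax : I.IsMaximal] :
    I.map (algebraMap A (AdicCompletion I A)) = Ideal.jacobson ⊥ := by
  have h1 := AdicCompletion.isMaximal_map_of_le I I le_rfl hI
  have h2 := AdicCompletion.isAdicComplete_self I hI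
  exact le_antisymm (IsAdicComplete.le_jacobson_bot _) (sInf_le ⟨bot_le, h1⟩)

/-- An isomorphism of the completions at finitely generated maximal ideals induces isomorphisms of
the truncations. -/
theorem nonempty_truncation_equiv {A B : Type*} [CommRing A] [Algebra K A] [CommRing B]
    [Algebra K B] {I : Ideal A} {J : Ideal B} (hI : I.FG) (hJ : J.FG) [I.IsMaximal] [J.IsMaximal]
    (α : AdicCompletion I A ≃ₐ[K] AdicCompletion J B) (n : ℕ) :
    Nonempty ((A ⧸ I ^ n) ≃ₐ[K] (B ⧸ J ^ n)) := by
  have hjac : (Ideal.jacobson ⊥ : Ideal (AdicCompletion I A)).map (α : _ →+* _) =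
      (Ideal.jacobson ⊥ : Ideal (AdicCompletion J B)) := by
    rw [Ideal.map_jacobson_of_bijective α.bijective, Ideal.map_bot]
  have hker : RingHom.ker ((AdicCompletion.evalₐ J n).restrictScalars K) =
      (RingHom.ker ((AdicCompletion.evalₐ I n).restrictScalars K)).map (α : _ →+* _) := by
    refine (ker_evalₐ_eq hJ n).trans ?_
    rw [map_eq_jacobson_bot hJ, ← hjac, ← map_eq_jacobson_bot hI, ← Ideal.map_pow,
      ← ker_evalₐ_eq hI n]
    rfl
  exact ⟨((Ideal.quotientKerAlgEquivOfSurjective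
    (f := (AdicCompletion.evalₐ I n).restrictScalars K)
      (AdicCompletion.surjective_evalₐ I n)).symm.trans
    (Ideal.quotientEquivAlg _ _ α hker)).trans (Ideal.quotientKerAlgEquivOfSurjective
      (f := (AdicCompletion.evalₐ J n).restrictScalars K) (AdicCompletion.surjective_evalₐ J n))⟩

variable {p q p' q' m : ℕ} {c c' : List ℕ} (H : HJData p q c) (H' : HJData p' q' c')

include H

theorem originIdeal_isMaximal : (originIdeal K p q).IsMaximal := by
  have hpos := H.pos
  have hc0 := two_le_hjCoeff H.two_le 0
  have V : ValidContact c 1 0 1 1 := ⟨hpos, le_rfl, le_rfl, le_rfl, by omega, le_rfl⟩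
  have hne : originIdeal K p q ≠ ⊤ := by
    have h : (PrimeSpectrum.comap (jetBase K (CoordRing K p q) 1) (contactPoint K H V)).asIdeal =
      originIdeal K p q := contactPoint_mem_centralFiber H V
    rw [← h]
    exact (PrimeSpectrum.isPrime _).ne_top
  exact ⟨⟨hne, fun I hI => by_contra fun h => hI.ne (eq_originIdeal_of_le h hI.le).symm⟩⟩

theorem originIdeal_fg : (originIdeal K p q).FG := by
  classical
  refine ⟨(Finset.range (c.length + 2)).image fun k : ℕ =>
    (AddMonoidAlgebra.single (hjGen p q c k) 1 : CoordRing K p q), le_antisymm ?_ ?_⟩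
  · refine Ideal.span_le.2 fun f hf => ?_
    obtain ⟨k, hk, rfl⟩ := Finset.mem_image.1 (Finset.mem_coe.1 hf)
    have := Finset.mem_range.1 hk
    exact Ideal.subset_span ⟨_, H.hjGen_ne_zero (by omega), rfl⟩
  · refine Ideal.span_le.2 ?_
    rintro _ ⟨w, hw, rfl⟩
    refine H.hjGen_induction (P := fun w => w ≠ 0 → (AddMonoidAlgebra.single w 1 : CoordRing K p q)
      ∈ Ideal.span _) (fun h => absurd rfl h) (fun k hk _ => ?_) (fun v w hv hw hne => ?_) w hw
    · exact Ideal.subset_span (Finset.mem_coe.2 (Finset.mem_image.2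
        ⟨k, Finset.mem_range.2 (by omega), rfl⟩))
    · rw [single_add_one]
      by_cases hv0 : v = 0
      · exact Ideal.mul_mem_left _ _ (hw fun h => hne (by rw [hv0, h, add_zero]))
      · exact Ideal.mul_mem_right _ _ (hv hv0)

/-- In A / I^n with I prime, the image of I consists of the nilpotent elements. -/
theorem mem_originIdeal_iff_of_truncation_equiv (H' : HJData p' q' c') {n : ℕ} (hn : n ≠ 0)
    (β : (CoordRing K p q ⧸ originIdeal K p q ^ n) ≃ₐ[K]
      (CoordRing K p' q' ⧸ originIdeal K p' q' ^ n)) {a b}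
    (hab : β (Ideal.Quotient.mk _ a) = Ideal.Quotient.mk _ b) :
    a ∈ originIdeal K p q ↔ b ∈ originIdeal K p' q' := by
  have h1 := (originIdeal_isMaximal (K := K) H).isPrime
  have h2 := (originIdeal_isMaximal (K := K) H').isPrime
  have key {A : Type _} [CommRing A] (I : Ideal A) [I.IsPrime] (a : A) :
      IsNilpotent (Ideal.Quotient.mk (I ^ n) a) ↔ a ∈ I := by
    constructor
    · rintro ⟨k, hk⟩
      rw [← map_pow, Ideal.Quotient.eq_zero_iff_mem] at hk
      exact ‹I.IsPrime›.mem_of_pow_mem k (Ideal.pow_le_self hn hk)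
    · intro h
      exact ⟨n, by rw [← map_pow, Ideal.Quotient.eq_zero_iff_mem]; exact Ideal.pow_mem_pow h n⟩
  rw [← key, ← key, ← hab]
  exact (IsNilpotent.map_iff β.injective).symm

omit H in
theorem pow_le_linearKernel (hm : 1 ≤ m) {P : JetScheme K (CoordRing K p q) m}
    (hP : P ∈ centralFiber K p q m) {a : CoordRing K p q}
    (ha : a ∈ originIdeal K p q ^ (m + 1)) : a ∈ linearKernel P := by
  have h0 : (PrimeSpectrum.comap (jetBase K (CoordRing K p q) m) P).asIdeal =
    originIdeal K p q := hP
  have h := jetHom_eq_zero_of_mem_pow (π := resHom P) (I := originIdeal K p q)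
    (fun b hb => resHom_eq_zero_iff.2 (by rw [← h0] at hb; exact hb)) ha
  rw [mem_linearKernel, coeff_jetSeries' _ _ hm, ← coeff_jetSeries' _ _ hm,
    ← truncCoeff_mk hm, ← jetHom_apply, h, ← map_zero (truncMk m), truncCoeff_mk hm, map_zero]

/-- The definition only involves the centre, the linear kernel and the transcendence degree.
Maximality is transported by carrying competitors back along β⁻¹. -/
theorem Corresponds.isTopPoint (H' : HJData p' q' c') (hm : 1 ≤ m)
    {β : (CoordRing K p q ⧸ originIdeal K p q ^ (m + 1)) ≃ₐ[K]
      (CoordRing K p' q' ⧸ originIdeal K p' q' ^ (m + 1))}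
    {P : JetScheme K (CoordRing K p q) m} {P' : JetScheme K (CoordRing K p' q') m}
    (h : Corresponds β P P') (hP : IsTopPoint P) : IsTopPoint P' := by
  have hcentral {p q p' q' : ℕ} {c c' : List ℕ} (H : HJData p q c) (H' : HJData p' q' c')
      {β : (CoordRing K p q ⧸ originIdeal K p q ^ (m + 1)) ≃ₐ[K]
        (CoordRing K p' q' ⧸ originIdeal K p' q' ^ (m + 1))}
      {P : JetScheme K (CoordRing K p q) m} {P' : JetScheme K (CoordRing K p' q') m}
      (h : Corresponds β P P') (hP : P ∈ centralFiber K p q m ∧ linearKernel P ≠ ⊤) :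
      P' ∈ centralFiber K p' q' m ∧ linearKernel P' ≠ ⊤ := by
    have hs (b : CoordRing K p' q') : ∃ a : CoordRing K p q,
        β (Ideal.Quotient.mk _ a) = Ideal.Quotient.mk _ b := by
      obtain ⟨a, ha⟩ := Ideal.Quotient.mk_surjective (β.symm (Ideal.Quotient.mk _ b))
      exact ⟨a, by rw [ha, AlgEquiv.apply_symm_apply]⟩
    constructor
    · refine mem_centralFiber_iff_monomials.2 fun w hw => ?_
      obtain ⟨a, ha⟩ := hs (AddMonoidAlgebra.single w 1)
      have h1 := (mem_originIdeal_iff_of_truncation_equiv H H' (Nat.succ_ne_zero m) β ha).2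
        (Ideal.subset_span ⟨w, hw, rfl⟩)
      have h2 := h.coeff_eq_zero_iff ha (Nat.zero_le m)
      rw [coeff_jetSeries' _ _ (Nat.zero_le m), coeff_jetSeries' _ _ (Nat.zero_le m),
        resHom_eq_zero_iff, resHom_eq_zero_iff] at h2
      have h0 : (PrimeSpectrum.comap (jetBase K (CoordRing K p q) m) P).asIdeal =
        originIdeal K p q := hP.1
      rw [← h0] at h1
      exact h2.1 h1
    · refine fun htop => hP.2 (eq_top_iff.2 fun a _ => ?_)
      obtain ⟨b, hb⟩ := Ideal.Quotient.mk_surjective (β (Ideal.Quotient.mk _ a))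
      exact (h.coeff_eq_zero_iff hb.symm hm).2 (mem_linearKernel.1 (htop ▸ Submodule.mem_top))
  refine ⟨hcentral H H' h hP.1, fun Q' hQ' hQ1' => ?_⟩
  have h0 : (PrimeSpectrum.comap (jetBase K (CoordRing K p' q') m) Q').asIdeal =
    originIdeal K p' q' := hQ'
  obtain ⟨Q, hQ⟩ := exists_corresponds β.symm (P := Q') fun a ha => by rw [← h0] at ha; exact ha
  have h1 := hcentral H' H hQ ⟨hQ', hQ1'⟩
  rw [hQ.trdeg_eq, ← h.trdeg_eq]
  exact hP.2 Q h1.1 h1.2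

theorem eq_or_eq_reverse_of_sameAnalyticType (H' : HJData p' q' c')
    (h : SameAnalyticType K p q p' q') : c' = c ∨ c' = c.reverse := by
  obtain ⟨α⟩ := h
  -- Any level m ≥ 2 with all coefficients of both lists at most m + 1 would do.
  set m := c.sum + c'.sum + 2 with hm
  have hle (c : List ℕ) (j : ℕ) (hj : j < c.length) : hjCoeff c j ≤ c.sum := by
    rw [hjCoeff, List.getD_eq_getElem _ _ hj]
    exact List.le_sum_of_mem (List.getElem_mem hj)
  have := originIdeal_isMaximal (K := K) H
  have := originIdeal_isMaximal (K := K) H'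
  obtain ⟨β⟩ := nonempty_truncation_equiv (originIdeal_fg H) (originIdeal_fg H') α (m + 1)
  have hex {p q p' q' : ℕ} {c c' : List ℕ} (H : HJData p q c) (H' : HJData p' q' c')
      (β : (CoordRing K p q ⧸ originIdeal K p q ^ (m + 1)) ≃ₐ[K]
        (CoordRing K p' q' ⧸ originIdeal K p' q' ^ (m + 1)))
      (P : {P : JetScheme K (CoordRing K p q) m // IsTopPoint P}) :
      ∃ P' : {P : JetScheme K (CoordRing K p' q') m // IsTopPoint P}, Corresponds β P.1 P'.1 := by
    have h0 : (PrimeSpectrum.comap (jetBase K (CoordRing K p q) m) P.1).asIdeal =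
      originIdeal K p q := P.2.1.1
    obtain ⟨P', hP'⟩ := exists_corresponds β (P := P.1) fun a ha => by rw [← h0] at ha; exact ha
    exact ⟨⟨P', hP'.isTopPoint H H' (by omega) P.2⟩, hP'⟩
  choose f hf using hex H H' β
  choose g hg using hex H' H β.symm
  let φ : {P : JetScheme K (CoordRing K p q) m // IsTopPoint P} ≃
      {P : JetScheme K (CoordRing K p' q') m // IsTopPoint P} :=
    ⟨f, g, fun P => Subtype.ext ((hg (f P)).unique (hf P).symm),
      fun P => Subtype.ext ((hf (g P)).unique (hg P).symm)⟩
  refine (isChainFamily_topPoints (K := K) (m := m) H (by omega) fun j hj => ?_).eq_or_eq_reverse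
    (isChainFamily_topPoints (K := K) (m := m) H' (by omega) fun j hj => ?_) φ fun P Q => ?_
  · have := hle c j hj; omega
  · have := hle c' j hj; omega
  · have hcard {p q : ℕ} {c : List ℕ} (H : HJData p q c)
        (P Q : {P : JetScheme K (CoordRing K p q) m // IsTopPoint P}) :
        (linearSupport c P.1 ∩ linearSupport c Q.1).card =
          Module.finrank K (CoordRing K p q ⧸ (linearKernel P.1 ⊔ linearKernel Q.1)) := by
      obtain ⟨j, l, V, hP⟩ := P.2.exists_eq_contactPoint H (by omega)
      obtain ⟨j', l', V', hQ⟩ := Q.2.exists_eq_contactPoint H (by omega)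
      rw [hP, hQ, finrank_quotient_linearKernel H (by omega)]
    rw [hcard H', hcard H]
    exact ((hf P).finrank_quotient_eq (hf Q) (by omega) fun b hb =>
      ⟨pow_le_linearKernel (by omega) (f P).2.1.1 hb,
        pow_le_linearKernel (by omega) (f Q).2.1.1 hb⟩).symm

end Truncation
end ToricJets

/-! ### The equivalence of the four conditions. -/

theorem corollary4p17 (K : Type*) [Field K]
    (p q p' q' : ℕ) (hp : 0 < p) (hpq : p < q) (hcop : Nat.Coprime p q)
    (hp' : 0 < p') (hpq' : p' < q') (hcop' : Nat.Coprime p' q')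
    (c c' : List ℕ) (hc : ToricJets.IsHJExpansion p q c) (hc' : ToricJets.IsHJExpansion p' q' c') :
    List.TFAE [
      ∃ φ : ToricJets.JetGraphIso K p q c p' q' c', φ.PreservesWeights,
      Nonempty (ToricJets.JetGraphIso K p q c p' q' c'),
      c' = c ∨ c' = c.reverse,
      ToricJets.SameAnalyticType K p q p' q'] := by
  have H := hc.hjData hp (hp.trans hpq) hcop
  have H' := hc'.hjData hp' (hp'.trans hpq') hcop'
  tfae_have 1 → 2 := fun ⟨φ, _⟩ => ⟨φ⟩
  tfae_have 2 → 3 := fun ⟨φ⟩ => φ.eq_or_eq_reverse H H'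
  tfae_have 3 → 1 := ToricJets.exists_jetGraphIso_of_eq_or_eq_reverse H H'
  tfae_have 3 → 4 := ToricJets.sameAnalyticType_of_eq_or_eq_reverse H H'
  tfae_have 4 → 3 := ToricJets.eq_or_eq_reverse_of_sameAnalyticType H H'
  tfae_finish
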